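/- Let $n\ge 1$, $\lambda=(\lambda_1,\dots,\lambda_n)\in(-1/2,\infty)^n$, $\eta\in\{0,1\}^n$. Write $\mathbb{N}=\{0,1,2,\dots\}$, $\mathbb{R}^n_+=(0,\infty)^n$, $|z|$ for the Euclidean norm, and $|M|=M_1+\dots+M_n$ for $M\in\mathbb{N}^n$. Let $dw_\lambda(x)=\prod_{j}|x_j|^{2\lambda_j}\,dx$ on $\mathbb{R}^n$ and let $dw_\lambda^+$ be its restriction to $\mathbb{R}^n_+$; for a function $F$ on $\mathbb{R}^n$ let $F^+$ be its restriction to $\mathbb{R}^n_+$. For $f:\mathbb{R}^n_+\to\mathbb{C}$ let $f^\eta$ be its $\eta$-symmetric extension: $f^\eta(x)=\prod_j \operatorname{sgn}(x_j)^{\eta_j}\,f(|x_1|,\dots,|x_n|)$ if all $x_j\neq0$, and $f^\eta(x)=0$ otherwise. For $z,x\in\mathbb{R}^n$ put $$\psi_z^\lambda(x)=\prod_{j=1}^n\big(\varphi_{z_j}^{\lambda_j}(x_j)+i x_jz_j\,\varphi_{z_j}^{\lambda_j+1}(x_j)\big),\qquad \varphi_{s}^{a}(u)=\sum_{m=0}^\infty\frac{(-1)^m(us/2)^{2m}}{2^{a-1/2}\,m!\,\Gamma(m+a+1/2)}\quad(u,s\in\mathbb{R}).$$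 The Dunkl transform is $D_\lambda f(z)=2^{-n}\int_{\mathbb{R}^n}\overline{\psi_z^\lambda(x)}\,f(x)\,dw_\lambda(x)$ for $f\in C_c^\infty(\mathbb{R}^n)$, extended by continuity to an isometry of $L^2(dw_\lambda)$ (and given by the same integral whenever it converges absolutely); its inverse is $\check D_\lambda f(z)=D_\lambda f(-z)$. For $f\in L^2(dw_\lambda^+)$ and $t>0$ let $$\mathbb{W}_t^{\lambda,\eta,+}f=\big(\check D_\lambda(e^{-t|z|^2}D_\lambda f^\eta(z))\big)^+,$$ which, with the outer transform taken as an absolutely convergent integral, is a smooth function of $(x,t)\in\mathbb{R}^n_+\times(0,\infty)$. Let $\delta_j=\partial_{x_j}$, $\delta_j^*=\partial_{x_j}+2\lambda_j/x_j$, and for $M\in\mathbb{N}^n$ let $\delta_{\eta,M}=\delta_{1,\eta_1,M_1}\circ\dots\circ\delta_{n,\eta_n,M_n}$, where $\delta_{j,0,m}$ equals $(\delta_j^*\delta_j)^{m/2}$ for even $m$ and $\delta_j(\delta_j^*\delta_j)^{(m-1)/2}$ for odd $m$, and $\delta_{j,1,m}$ equals $(\delta_j\delta_j^*)^{m/2}$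 for even $m$ and $\delta_j^*(\delta_j\delta_j^*)^{(m-1)/2}$ for odd $m$. Then the following operators are bounded on $L^2(dw_\lambda^+)$. In each of (1), (2), (6), the function assigned to $f\in L^2(dw_\lambda^+)$ is measurable with $L^2(dw_\lambda^+)$-norm at most $C\|f\|_{L^2(dw_\lambda^+)}$, where $C$ does not depend on $f$. 1. The maximal operator $\mathbb{W}_*^{\lambda,\eta,+}f(x)=\big\|\mathbb{W}_t^{\lambda,\eta,+}f(x)\big\|_{L^\infty((0,\infty),dt)}$. 2. For $K\in\mathbb{N}$, $M\in\mathbb{N}^n$ with $|M|+K>0$, the mixed $g$-function $$g_{K,M}^{\lambda,\eta,+}(f)(x)=\Big(\int_0^\infty \big|\partial_t^K\delta_{\eta,M}\mathbb{W}_t^{\lambda,\eta,+}f(x)\big|^2\,t^{2K+|M|-1}\,dt\Big)^{1/2}.$$ 3. For $\Phi\in L^\infty((0,\infty),dt)$, the multiplier $f\mapsto\big(\check D_\lambda(\mathfrak{m}D_\lambda f^\eta)\big)^+$ with $\mathfrak{m}(z)=|z|^2\int_0^\infty e^{-t|z|^2}\Phi(t)\,dt$; it is a bounded linear operator on $L^2(dw_\lambda^+)$.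 4. For a complex Borel measure $\nu$ on $(0,\infty)$, the multiplier $f\mapsto\big(\check D_\lambda(\mathfrak{m}D_\lambda f^\eta)\big)^+$ with $\mathfrak{m}(z)=\int_{(0,\infty)}e^{-t|z|^2}\,d\nu(t)$; it is a bounded linear operator on $L^2(dw_\lambda^+)$. 5. For $M\in\mathbb{N}^n$ with $|M|>0$, the Riesz transform $$R_M^{\lambda,\eta,+}f=\delta_{\eta,M}\big(\check D_\lambda(|z|^{-|M|}D_\lambda f^\eta(z))\big)^+,$$ defined initially on $C^{\lambda,\eta,+}=\{f\in L^2(dw_\lambda^+): f^\eta\in C^\infty(\mathbb{R}^n),\ (D_\lambda f^\eta)^+\in C_c^\infty(\mathbb{R}^n_+)\}$ (membership in $C^\infty$ and $C_c^\infty$ being understood up to null sets); it extends uniquely to a bounded linear operator on $L^2(dw_\lambda^+)$. 6. For $K\in\mathbb{N}$, $M\in\mathbb{N}^n$ with $|M|+K>0$, the mixed Lusin area integral $$S_{K,M}^{\lambda,\eta,+}(f)(x)=\Big(\int_{\{(z,t)\,:\,z\in\mathbb{R}^n_+,\ t>0,\ |z-x|<\sqrt t\}} t^{2K+|M|-1}\big|\partial_t^K\delta_{\eta,M}\mathbb{W}_t^{\lambda,\eta,+}f(z)\big|^2\,\frac{dw_\lambda^+(z)\,dt}{V_{\sqrt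 t}^{\lambda,+}(x)}\Big)^{1/2},$$ where $V_r^{\lambda,+}(x)=w_\lambda^+\big(\{y\in\mathbb{R}^n_+:|y_j-x_j|<r,\ j=1,\dots,n\}\big)$. -/

import Mathlib

open MeasureTheory Filter Topology
open scoped ENNReal NNReal

noncomputable section

namespace DunklBessel

/-- The squared Euclidean norm `|x|^2` on `ℝ^n` (realized as `Fin n → ℝ`). -/
def normSq {n : ℕ} (x : Fin n → ℝ) : ℝ := ∑ j, x j ^ 2

/-- The open orthant `(0,∞)^n`. -/
def orthant (n : ℕ) : Set (Fin n → ℝ) := {x | ∀ j, 0 < x j}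

/-- The measure `dw_λ(x) = ∏_j |x_j|^{2λ_j} dx` on `ℝ^n`. -/
def w {n : ℕ} (lam : Fin n → ℝ) : Measure (Fin n → ℝ) :=
  volume.withDensity fun x => ENNReal.ofReal (∏ j, |x j| ^ (2 * lam j))

/-- The restriction `dw_λ^+` of `dw_λ` to `(0,∞)^n`. -/
def wPlus {n : ℕ} (lam : Fin n → ℝ) : Measure (Fin n → ℝ) := (w lam).restrict (orthant n)

/-- `J_{a-1/2}(u) / u^{a-1/2}`, given by its everywhere convergent power series; the
one-dimensional function `φ_z^a(x)` is `besselPhi a (x z)`. -/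
def besselPhi (a u : ℝ) : ℝ :=
  ∑' m : ℕ, (-1) ^ m * (u / 2) ^ (2 * m) /
    ((2 : ℝ) ^ (a - 1 / 2) * (m.factorial : ℝ) * Real.Gamma (m + a + 1 / 2))

/-- The Dunkl kernel `ψ_z^λ(x) = ∏_j (φ_{z_j}^{λ_j}(x_j) + i x_j z_j φ_{z_j}^{λ_j+1}(x_j))`. -/
def psi {n : ℕ} (lam z x : Fin n → ℝ) : ℂ :=
  ∏ j, ((besselPhi (lam j) (x j * z j) : ℂ) +
    Complex.I * ((x j * z j * besselPhi (lam j + 1) (x j * z j) : ℝ) : ℂ))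

/-- The Dunkl transform as an (absolutely convergent) integral,
`D_λ f(z) = 2^{-n} ∫ conj(ψ_z^λ(x)) f(x) dw_λ(x)`, for sufficiently regular `f`. -/
def dunkl {n : ℕ} (lam : Fin n → ℝ) (f : (Fin n → ℝ) → ℂ) (z : Fin n → ℝ) : ℂ :=
  1 / 2 ^ n * ∫ x, (starRingEnd ℂ) (psi lam z x) * f x ∂(w lam)

/-- The inverse Dunkl transform as an integral, `Ď_λ f(z) = D_λ f(-z)`. -/
def dunklInv {n : ℕ} (lam : Fin n → ℝ) (f : (Fin n → ℝ) → ℂ) (z : Fin n → ℝ) : ℂ :=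
  dunkl lam f (-z)

/-- `g` is an `L^2(dw_λ)` Dunkl transform of `f`: the pair `(f, g)` lies in the `L^2`-closure of
the graph of the integral transform on `C_c^∞(ℝ^n)`. -/
def IsDunklL2 {n : ℕ} (lam : Fin n → ℝ) (f g : (Fin n → ℝ) → ℂ) : Prop :=
  MemLp f 2 (w lam) ∧ MemLp g 2 (w lam) ∧
    ∃ u : ℕ → (Fin n → ℝ) → ℂ,
      (∀ k, ContDiff ℝ ((⊤ : ℕ∞) : WithTop ℕ∞) (u k) ∧ HasCompactSupport (u k)) ∧
      Tendsto (fun k => eLpNorm (u k - f) 2 (w lam)) atTop (𝓝 0) ∧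
      Tendsto (fun k => eLpNorm (dunkl lam (u k) - g) 2 (w lam)) atTop (𝓝 0)

open Classical in
/-- The Dunkl transform on `L^2(dw_λ)`, i.e. the extension by continuity from `C_c^∞(ℝ^n)` (a
representative of a class modulo null functions; `0` if `f` is not in `L^2(dw_λ)`). -/
def dunklL2 {n : ℕ} (lam : Fin n → ℝ) (f : (Fin n → ℝ) → ℂ) : (Fin n → ℝ) → ℂ :=
  if h : ∃ g, IsDunklL2 lam f g then h.choose else 0

/-- The inverse Dunkl transform on `L^2(dw_λ)`, `Ď_λ f(z) = D_λ f(-z)`. -/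
def dunklInvL2 {n : ℕ} (lam : Fin n → ℝ) (f : (Fin n → ℝ) → ℂ) (z : Fin n → ℝ) : ℂ :=
  dunklL2 lam f (-z)

open Classical in
/-- The `η`-symmetric extension `f^η` to `ℝ^n` of a function on `(0,∞)^n`: it equals
`ε^η f(ε x)` if no coordinate of `x` vanishes, `ε` being the vector of signs of `x`, and `0`
otherwise. Only the values of `f` on `(0,∞)^n` are used. -/
def symmExt {n : ℕ} (η : Fin n → Fin 2) (f : (Fin n → ℝ) → ℂ) (x : Fin n → ℝ) : ℂ :=
  if ∀ j, x j ≠ 0 then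
    ((∏ j, Real.sign (x j) ^ (η j : ℕ) : ℝ) : ℂ) * f (fun j => |x j|)
  else 0

/-- The semigroup `𝕎_t^{λ,η,+} f = (Ď_λ(e^{-t|z|²} D_λ f^η(z)))^+`. The factor `e^{-t|z|²}` makes
the outer transform an absolutely convergent integral, so that this is a function defined at
every point, smooth in `(x,t)` on `(0,∞)^n × (0,∞)`. -/
def heat {n : ℕ} (lam : Fin n → ℝ) (η : Fin n → Fin 2) (t : ℝ) (f : (Fin n → ℝ) → ℂ) :
    (Fin n → ℝ) → ℂ :=
  dunklInv lam fun z => (Real.exp (-t * normSq z) : ℂ) * dunklL2 lam (symmExt η f) z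

/-- `δ_j = ∂_{x_j}`. -/
def del {n : ℕ} (j : Fin n) (F : (Fin n → ℝ) → ℂ) (x : Fin n → ℝ) : ℂ :=
  deriv (fun s : ℝ => F (Function.update x j s)) (x j)

/-- `δ_j^* = ∂_{x_j} + 2 λ_j / x_j`. -/
def delStar {n : ℕ} (lam : Fin n → ℝ) (j : Fin n) (F : (Fin n → ℝ) → ℂ) (x : Fin n → ℝ) : ℂ :=
  del j F x + ((2 * lam j / x j : ℝ) : ℂ) * F x

/-- The operator `δ_{j,e,m}`, an alternating product of `δ_j` and `δ_j^*` with `m` factors, the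
innermost one being `δ_j` if `e = 0` and `δ_j^*` if `e = 1`. -/
def delOne {n : ℕ} (lam : Fin n → ℝ) (j : Fin n) (e : Fin 2) (m : ℕ)
    (F : (Fin n → ℝ) → ℂ) : (Fin n → ℝ) → ℂ :=
  if e = 0 then
    if Even m then (fun G => delStar lam j (del j G))^[m / 2] F
    else del j ((fun G => delStar lam j (del j G))^[(m - 1) / 2] F)
  else
    if Even m then (fun G => del j (delStar lam j G))^[m / 2] F
    else delStar lam j ((fun G => del j (delStar lam j G))^[(m - 1) / 2] F)

/-- `δ_{η,M} = δ_{1,η_1,M_1} ∘ ⋯ ∘ δ_{n,η_n,M_n}`. -/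
def delta {n : ℕ} (lam : Fin n → ℝ) (η : Fin n → Fin 2) (M : Fin n → ℕ)
    (F : (Fin n → ℝ) → ℂ) : (Fin n → ℝ) → ℂ :=
  (List.finRange n).foldr (fun j G => delOne lam j (η j) (M j) G) F

/-- `∂_t^K δ_{η,M} 𝕎_t^{λ,η,+} f(x)`. -/
def heatDeriv {n : ℕ} (lam : Fin n → ℝ) (η : Fin n → Fin 2) (K : ℕ) (M : Fin n → ℕ)
    (f : (Fin n → ℝ) → ℂ) (x : Fin n → ℝ) (t : ℝ) : ℂ :=
  iteratedDeriv K (fun s : ℝ => delta lam η M (heat lam η s f) x) t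

/-- (1) The maximal operator `‖𝕎_t^{λ,η,+} f(x)‖_{L^∞(dt)}`. -/
def maximalOp {n : ℕ} (lam : Fin n → ℝ) (η : Fin n → Fin 2)
    (f : (Fin n → ℝ) → ℂ) (x : Fin n → ℝ) : ℝ≥0∞ :=
  eLpNorm (fun t : ℝ => heat lam η t f x) ∞ (volume.restrict (Set.Ioi 0))

/-- (2) The mixed `g`-function `‖∂_t^K δ_{η,M} 𝕎_t^{λ,η,+} f(x)‖_{L^2(t^{2K+|M|-1}dt)}`. -/
def gFun {n : ℕ} (lam : Fin n → ℝ) (η : Fin n → Fin 2) (K : ℕ) (M : Fin n → ℕ)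
    (f : (Fin n → ℝ) → ℂ) (x : Fin n → ℝ) : ℝ≥0∞ :=
  (∫⁻ t in Set.Ioi (0 : ℝ),
    ENNReal.ofReal (t ^ (2 * (K : ℝ) + ((∑ j, M j : ℕ) : ℝ) - 1)) *
      ‖heatDeriv lam η K M f x t‖ₑ ^ 2) ^ (1 / 2 : ℝ)

/-- The multiplier operator `f ↦ (Ď_λ(𝔪 D_λ f^η))^+`; only its values on `(0,∞)^n` matter. -/
def multiplierOp {n : ℕ} (lam : Fin n → ℝ) (η : Fin n → Fin 2) (m : (Fin n → ℝ) → ℂ)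
    (f : (Fin n → ℝ) → ℂ) : (Fin n → ℝ) → ℂ :=
  dunklInvL2 lam fun z => m z * dunklL2 lam (symmExt η f) z

/-- (3) The Laplace transform type symbol `𝔪(z) = |z|² ∫_0^∞ e^{-t|z|²} Φ(t) dt`. -/
def laplaceSymbol {n : ℕ} (Φ : ℝ → ℂ) (z : Fin n → ℝ) : ℂ :=
  (normSq z : ℂ) * ∫ t in Set.Ioi (0 : ℝ), (Real.exp (-t * normSq z) : ℂ) * Φ t

/-- (4) The Laplace-Stieltjes transform type symbol `𝔪(z) = ∫_{(0,∞)} e^{-t|z|²} dν(t)` of a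
complex Borel measure `ν` on `(0,∞)`. -/
def laplaceStieltjesSymbol {n : ℕ} (ν : ComplexMeasure (Set.Ioi (0 : ℝ)))
    (z : Fin n → ℝ) : ℂ :=
  ∫ᵛ t, Real.exp (-(t : ℝ) * normSq z) ∂•ν

/-- The space `C^{λ,η,+}` of those `f ∈ L^2(dw_λ^+)` for which `f^η` is in `C^∞(ℝ^n)` and
`(D_λ f^η)^+` is in `C_c^∞((0,∞)^n)` (both up to modification on a null set). -/
def rieszDomain {n : ℕ} (lam : Fin n → ℝ) (η : Fin n → Fin 2) : Set ((Fin n → ℝ) → ℂ) :=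
  {f | MemLp f 2 (wPlus lam) ∧
    (∃ F : (Fin n → ℝ) → ℂ, ContDiff ℝ ((⊤ : ℕ∞) : WithTop ℕ∞) F ∧ symmExt η f =ᵐ[w lam] F) ∧
    ∃ g : (Fin n → ℝ) → ℂ, ContDiff ℝ ((⊤ : ℕ∞) : WithTop ℕ∞) g ∧ HasCompactSupport g ∧
      tsupport g ⊆ orthant n ∧ dunklL2 lam (symmExt η f) =ᵐ[wPlus lam] g}

/-- (5) The Riesz transform `R_M^{λ,η,+} f = δ_{η,M} (Ď_λ(|z|^{-|M|} D_λ f^η(z)))^+`. For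
`f ∈ C^{λ,η,+}` the outer transform is applied to a smooth function that is compactly supported
off the coordinate hyperplanes (up to a null set), so it is given by the integral. -/
def rieszOp {n : ℕ} (lam : Fin n → ℝ) (η : Fin n → Fin 2) (M : Fin n → ℕ)
    (f : (Fin n → ℝ) → ℂ) : (Fin n → ℝ) → ℂ :=
  delta lam η M (dunklInv lam fun z =>
    ((Real.sqrt (normSq z) ^ (∑ j, M j))⁻¹ : ℂ) * dunklL2 lam (symmExt η f) z)

/-- `V_r^{λ,+}(x)`: the `w_λ^+` measure of the cube centered at `x` of side lengths `2r`. -/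
def cubeMeasure {n : ℕ} (lam : Fin n → ℝ) (r : ℝ) (x : Fin n → ℝ) : ℝ≥0∞ :=
  wPlus lam {y | ∀ j, |y j - x j| < r}

/-- The parabolic cone `A(x) = {(z,t) : t > 0, |z - x| < √t}` with vertex at `x`. -/
def cone {n : ℕ} (x : Fin n → ℝ) : Set ((Fin n → ℝ) × ℝ) :=
  {p | 0 < p.2 ∧ Real.sqrt (normSq (p.1 - x)) < Real.sqrt p.2}

/-- (6) The mixed Lusin area integral: the square root of
`∫_{A(x)} t^{2K+|M|-1} |∂_t^K δ_{η,M} 𝕎_t^{λ,η,+} f(z)|² dw_λ^+(z) dt / V_{√t}^{λ,+}(x)`,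
where `z` is restricted to `(0,∞)^n`. -/
def lusinOp {n : ℕ} (lam : Fin n → ℝ) (η : Fin n → Fin 2) (K : ℕ) (M : Fin n → ℕ)
    (f : (Fin n → ℝ) → ℂ) (x : Fin n → ℝ) : ℝ≥0∞ :=
  (∫⁻ p in cone x,
    ENNReal.ofReal (p.2 ^ (2 * (K : ℝ) + ((∑ j, M j : ℕ) : ℝ) - 1)) *
      ‖heatDeriv lam η K M f p.1 p.2‖ₑ ^ 2 / cubeMeasure lam (Real.sqrt p.2) x
    ∂((wPlus lam).prod volume)) ^ (1 / 2 : ℝ)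

/-- A (sublinear) operator `S` assigning to functions on `(0,∞)^n` functions with values in
`[0,∞]` is bounded on `L^2(dw_λ^+)`. -/
def SublinearBoundedL2 {n : ℕ} (lam : Fin n → ℝ)
    (S : ((Fin n → ℝ) → ℂ) → (Fin n → ℝ) → ℝ≥0∞) : Prop :=
  ∃ C : ℝ≥0, ∀ f : (Fin n → ℝ) → ℂ, MemLp f 2 (wPlus lam) →
    AEMeasurable (S f) (wPlus lam) ∧
      eLpNorm (S f) 2 (wPlus lam) ≤ C * eLpNorm f 2 (wPlus lam)

/-- An operator `T`, defined on all of `L^2(dw_λ^+)`, is a bounded linear operator there. -/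
def LinearBoundedL2 {n : ℕ} (lam : Fin n → ℝ)
    (T : ((Fin n → ℝ) → ℂ) → (Fin n → ℝ) → ℂ) : Prop :=
  ∃ B : Lp ℂ 2 (wPlus lam) →L[ℂ] Lp ℂ 2 (wPlus lam),
    ∀ (f : (Fin n → ℝ) → ℂ) (hf : MemLp f 2 (wPlus lam)),
      B (hf.toLp f) =ᵐ[wPlus lam] T f

/-- An operator `T`, defined on a set `𝒟` of functions in `L^2(dw_λ^+)`, extends to a bounded
linear operator on `L^2(dw_λ^+)`, and does so in a unique way. -/
def ExtendsBoundedL2 {n : ℕ} (lam : Fin n → ℝ) (𝒟 : Set ((Fin n → ℝ) → ℂ))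
    (T : ((Fin n → ℝ) → ℂ) → (Fin n → ℝ) → ℂ) : Prop :=
  ∃! B : Lp ℂ 2 (wPlus lam) →L[ℂ] Lp ℂ 2 (wPlus lam),
    ∀ f ∈ 𝒟, ∀ hf : MemLp f 2 (wPlus lam), B (hf.toLp f) =ᵐ[wPlus lam] T f

end DunklBessel

end

/-! Everything is transported to the spectral side by Hankel transforms on the orthant. Expanding
the product that defines the Dunkl kernel gives one summand for each type `η`, and under sign
changes of the coordinates each summand transforms by its own character. By orthogonality of these
characters only one summand survives on an `η`-symmetric function, so `D_λ f^η` is `(-i)^{|η|}`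
times the `η`-symmetric extension of the Hankel transform `H_η f` (`dunkl_symmExt`,
`dunklL2_symmExt`).

`H_η` is a self-adjoint unitary involution of `L²(dw_λ^+)`. It sends the Gaussians `x^η exp(-∑ a_j
x_j²/2)` to multiples of the Gaussians with parameters `1/a_j`, with the same Gram matrix, and
Gaussians span a dense subspace by Stone–Weierstrass (`inner_gaussDualLp`, `denseRange_gaussLp`).
For functions with Gaussian decay the integral and the `L²` transform agree (`hankel_ae_eq`). Hence
the multipliers (3) and (4) are `H_η m H_η` with `m` bounded.

Each factor `δ_j` or `δ_j^*` multiplies the transformed function by `± z_j` and flips `η_j`, so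
`δ_{η,M} H_η G = H_{η'}(± z^M G)` (`exists_delta_eq`). Since `|z^M| ≤ |z|^{|M|}`, Plancherel gives
the Riesz transforms. Plancherel, Tonelli and a Gamma integral in `t` give the `g`-functions
(`exists_measurable_heatDeriv`). The area integrals reduce to the same estimate: after exchanging
the integrals, what remains is the integral of `1 / V_{√t}(x)` over a cube around `z`, which is at
most `2^n` (`setLIntegral_inv_cubeMeasure_le`).

The maximal operator follows Stein's scheme. The heat kernel of type `η` is nonnegative on the
orthant and at most a constant times that of type `0` (`exists_heatKernel_le`), which is symmetric
with total mass one. Hopf's maximal inequality controls the averages of the iterates of the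
semigroup at a small time step (`lintegral_maxAverage_sq_le`). The `g`-function with one time
derivative bounds the difference between the semigroup at time `t` and at times in `[t/2, t]`, hence
also its distance to such averages (`heatMajorant_le_maxAverage`). Letting the step run through
`2^{-m}` and using continuity in `t` exhausts all times. -/

noncomputable section

namespace DunklBessel

/-! ### The one-dimensional Bessel series -/

/-- The coefficients of the normalized Bessel series. -/
def besselCoeff (a : ℝ) (m : ℕ) : ℝ :=
  1 / ((2 : ℝ) ^ (a - 1 / 2) * (m.factorial : ℝ) * Real.Gamma (m + a + 1 / 2))

/-- The entire function `∑ c_{a,m} v^m`, with `besselPhi a u = besselSeries a (-(u/2)^2)`. -/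
def besselSeries (a v : ℝ) : ℝ := ∑' m : ℕ, besselCoeff a m * v ^ m

lemma besselPhi_eq (a u : ℝ) : besselPhi a u = besselSeries a (-(u / 2) ^ 2) := by
  unfold besselPhi besselSeries besselCoeff
  refine tsum_congr fun m => ?_
  rw [neg_pow ((u / 2) ^ 2), ← pow_mul]
  ring

lemma besselCoeff_pos {a : ℝ} (ha : -1 / 2 < a) (m : ℕ) : 0 < besselCoeff a m := by
  unfold besselCoeff
  have : 0 < Real.Gamma (m + a + 1 / 2) := by
    apply Real.Gamma_pos_of_pos
    have : (0 : ℝ) ≤ m := Nat.cast_nonneg m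
    linarith
  positivity

/-- This is `Γ(s+1) = s Γ(s)` at `s = m + a + 1/2`; the condition on `a` keeps `s` positive. -/
lemma besselCoeff_eq_mul {a : ℝ} (ha : -1 / 2 < a) (m : ℕ) :
    besselCoeff a m = (2 * m + 2 * a + 1) * besselCoeff (a + 1) m := by
  unfold besselCoeff
  have hm : (0 : ℝ) ≤ m := Nat.cast_nonneg m
  have h1 : (m + (a + 1) + 1 / 2 : ℝ) = (m + a + 1 / 2) + 1 := by ring
  have h0 : (m + a + 1 / 2 : ℝ) ≠ 0 := by
    have : (0 : ℝ) < m + a + 1 / 2 := by linarith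
    exact this.ne'
  have h3 : (2 : ℝ) ^ (a + 1 - 1 / 2) = 2 ^ (a - 1 / 2) * 2 := by
    rw [← Real.rpow_add_one (by norm_num)]; congr 1; ring
  rw [h1, Real.Gamma_add_one h0, h3]
  have h4 : (2 * m + 2 * a + 1 : ℝ) = 2 * (m + a + 1 / 2) := by ring
  have h5 : 0 < Real.Gamma (m + a + 1 / 2) := Real.Gamma_pos_of_pos (by linarith)
  have h6 : (0 : ℝ) < 2 ^ (a - 1 / 2) := by positivity
  rw [h4]
  generalize Real.Gamma (m + a + 1 / 2) = G at h5 ⊢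
  generalize (m + a + 1 / 2 : ℝ) = s at h0 ⊢
  field_simp

/-- The two Gamma arguments coincide, so only the factorial and the power of `2` change and `a` is
arbitrary. -/
lemma besselCoeff_succ (a : ℝ) (m : ℕ) :
    ((m : ℝ) + 1) * besselCoeff a (m + 1) = 2 * besselCoeff (a + 1) m := by
  unfold besselCoeff
  have h1 : (m + (a + 1) + 1 / 2 : ℝ) = ((m + 1 : ℕ) : ℝ) + a + 1 / 2 := by push_cast; ring
  have h3 : (2 : ℝ) ^ (a + 1 - 1 / 2) = 2 ^ (a - 1 / 2) * 2 := by
    rw [← Real.rpow_add_one (by norm_num)]; congr 1; ring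
  have h6 : (0 : ℝ) < 2 ^ (a - 1 / 2) := by positivity
  have h7 : ((m : ℝ) + 1) ≠ 0 := by positivity
  rw [h1, h3, Nat.factorial_succ]
  push_cast
  field_simp

/-- The right side is the coefficient sequence of `cosh(4√v)`, which turns every growth question
about the series into one about exponentials. -/
lemma besselCoeff_le {a : ℝ} (ha : -1 / 2 < a) :
    ∃ C > 0, ∀ m, besselCoeff a m ≤ C * ((16 : ℝ) ^ m / ((2 * m).factorial : ℝ)) := by
  have p0 := besselCoeff_pos ha 0
  have p1 := besselCoeff_pos ha 1
  -- The ratio of consecutive coefficients is `1/((m+1)(m+a+1/2))`. It is controlled uniformly only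
  -- from `m = 1` on, because `a + 1/2` may be close to `0`; hence both `m = 0` and `m = 1` enter
  -- the constant.
  refine ⟨besselCoeff a 0 + besselCoeff a 1, by positivity, fun m => ?_⟩
  induction m with
  | zero => simp; positivity
  | succ m ih =>
    rcases Nat.eq_zero_or_pos m with rfl | hm
    · norm_num [Nat.factorial]; nlinarith
    · have hm' : (1 : ℝ) ≤ m := by exact_mod_cast hm
      have e1 := besselCoeff_succ a m
      have e2 := besselCoeff_eq_mul ha m
      have e3 : besselCoeff a (m + 1) = besselCoeff a m / ((m + 1) * (m + a + 1 / 2)) := by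
        rw [eq_div_iff (by nlinarith), e2]
        linear_combination (m + a + 1 / 2 : ℝ) * e1
      have hpos : (0 : ℝ) < (besselCoeff a 0 + besselCoeff a 1) *
          ((16 : ℝ) ^ m / ((2 * m).factorial : ℝ)) := by positivity
      have e4 : ((16 : ℝ) ^ (m + 1) / ((2 * (m + 1)).factorial : ℝ)) =
          ((16 : ℝ) ^ m / ((2 * m).factorial : ℝ)) * (16 / ((2 * m + 1) * (2 * m + 2))) := by
        have : 2 * (m + 1) = 2 * m + 1 + 1 := by ring
        rw [this, Nat.factorial_succ, Nat.factorial_succ]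
        push_cast
        have h := Nat.factorial_pos (2 * m)
        field_simp
        ring
      rw [e3, e4, ← mul_assoc, div_eq_mul_one_div]
      refine mul_le_mul ih ?_ (by apply div_nonneg <;> nlinarith) hpos.le
      rw [div_le_div_iff₀ (by nlinarith) (by positivity)]
      nlinarith

lemma summable_besselSeries_abs {a : ℝ} (ha : -1 / 2 < a) (v : ℝ) :
    Summable fun m => besselCoeff a m * |v| ^ m := by
  obtain ⟨C, hC, h⟩ := besselCoeff_le ha
  have h1 := (Real.hasSum_cosh (4 * √|v|)).summable.mul_left C
  refine Summable.of_nonneg_of_le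
    (fun m => mul_nonneg (besselCoeff_pos ha m).le (by positivity)) (fun m => ?_) h1
  have : (4 * √|v|) ^ (2 * m) = 16 ^ m * |v| ^ m := by
    rw [pow_mul, mul_pow, Real.sq_sqrt (abs_nonneg v), ← mul_pow]; norm_num
  rw [this]
  calc _ ≤ C * ((16 : ℝ) ^ m / ((2 * m).factorial : ℝ)) * |v| ^ m := by gcongr; exact h m
    _ = _ := by ring

lemma summable_besselSeries {a : ℝ} (ha : -1 / 2 < a) (v : ℝ) :
    Summable fun m => besselCoeff a m * v ^ m := by
  refine Summable.of_norm ?_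
  have := summable_besselSeries_abs ha v
  refine this.congr fun m => ?_
  rw [norm_mul, norm_pow, Real.norm_eq_abs, Real.norm_eq_abs, abs_of_pos (besselCoeff_pos ha m)]

lemma abs_besselSeries_le {a : ℝ} (ha : -1 / 2 < a) :
    ∃ C > 0, ∀ v, |besselSeries a v| ≤ C * Real.exp (4 * √|v|) := by
  obtain ⟨C, hC, h⟩ := besselCoeff_le ha
  refine ⟨C, hC, fun v => ?_⟩
  have h1 := (Real.hasSum_cosh (4 * √|v|)).mul_left C
  have h2 : ‖besselSeries a v‖ ≤ C * Real.cosh (4 * √|v|) := by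
    refine tsum_of_norm_bounded h1 fun m => ?_
    have : (4 * √|v|) ^ (2 * m) = 16 ^ m * |v| ^ m := by
      rw [pow_mul, mul_pow, Real.sq_sqrt (abs_nonneg v), ← mul_pow]; norm_num
    rw [this, norm_mul, norm_pow, Real.norm_eq_abs, Real.norm_eq_abs,
      abs_of_pos (besselCoeff_pos ha m)]
    calc _ ≤ C * ((16 : ℝ) ^ m / ((2 * m).factorial : ℝ)) * |v| ^ m := by gcongr; exact h m
      _ = _ := by ring
  refine h2.trans ?_
  gcongr
  rw [Real.cosh_eq]
  have : Real.exp (-(4 * √|v|)) ≤ Real.exp (4 * √|v|) := by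
    apply Real.exp_le_exp.2
    have := Real.sqrt_nonneg |v|
    linarith
  linarith

lemma abs_besselPhi_le {a : ℝ} (ha : -1 / 2 < a) :
    ∃ C > 0, ∀ u, |besselPhi a u| ≤ C * Real.exp (2 * |u|) := by
  obtain ⟨C, hC, h⟩ := abs_besselSeries_le ha
  refine ⟨C, hC, fun u => ?_⟩
  rw [besselPhi_eq]
  refine (h _).trans (le_of_eq ?_)
  rw [abs_neg, abs_pow, Real.sqrt_sq (abs_nonneg _), abs_div, abs_two]
  congr 2
  ring

lemma besselSeries_nonneg {a v : ℝ} (ha : -1 / 2 < a) (hv : 0 ≤ v) : 0 ≤ besselSeries a v :=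
  tsum_nonneg fun m => mul_nonneg (besselCoeff_pos ha m).le (by positivity)

lemma hasSum_nat_mul_besselCoeff {a : ℝ} (ha : -1 / 2 < a) (v : ℝ) :
    HasSum (fun m : ℕ => besselCoeff a m * (m * v ^ (m - 1))) (2 * besselSeries (a + 1) v) := by
  rw [← hasSum_nat_add_iff' 1]
  simp only [Finset.range_one, Finset.sum_singleton, Nat.cast_zero, zero_mul, mul_zero, sub_zero,
    Nat.add_sub_cancel]
  have := (summable_besselSeries (a := a + 1) (by linarith) v).hasSum.mul_left 2
  refine this.congr_fun fun m => ?_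
  have := besselCoeff_succ a m
  push_cast
  linear_combination v ^ m * this

/-- On the ball of radius `|v| + 1` the differentiated series is dominated by its own value at the
radius, since all coefficients are positive. -/
lemma hasDerivAt_besselSeries {a : ℝ} (ha : -1 / 2 < a) (v : ℝ) :
    HasDerivAt (besselSeries a) (2 * besselSeries (a + 1) v) v := by
  have hR : (0 : ℝ) < |v| + 1 := by positivity
  have key := hasDerivAt_tsum_of_isPreconnected (𝕜 := ℝ)
    (g := fun m (y : ℝ) => besselCoeff a m * y ^ m)
    (g' := fun m (y : ℝ) => besselCoeff a m * (m * y ^ (m - 1)))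
    (u := fun m => besselCoeff a m * (m * (|v| + 1) ^ (m - 1)))
    (t := Metric.ball 0 (|v| + 1)) (y₀ := 0) (y := v)
    (hasSum_nat_mul_besselCoeff ha _).summable Metric.isOpen_ball
    (convex_ball _ _).isPreconnected
    (fun m y _ => (hasDerivAt_pow m y).const_mul _)
    (fun m y hy => ?_) (Metric.mem_ball_self hR) (summable_besselSeries ha 0)
    (by simp)
  · rwa [(hasSum_nat_mul_besselCoeff ha v).tsum_eq] at key
  · have hy' : |y| ≤ |v| + 1 := by
      have := Metric.mem_ball.1 hy
      rw [Real.dist_eq, sub_zero] at this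
      exact this.le
    rw [norm_mul, norm_mul, norm_pow, Real.norm_eq_abs, Real.norm_eq_abs, Real.norm_eq_abs,
      abs_of_pos (besselCoeff_pos ha m), Nat.abs_cast]
    have := (besselCoeff_pos ha m).le
    gcongr

/-- Differentiation only raises the order `a` by one, so induction on the smoothness with `a` free
closes. -/
lemma contDiff_besselSeries {a : ℝ} (ha : -1 / 2 < a) :
    ContDiff ℝ ((⊤ : ℕ∞) : WithTop ℕ∞) (besselSeries a) := by
  rw [contDiff_infty]
  intro n
  induction n generalizing a with
  | zero =>
    rw [Nat.cast_zero, contDiff_zero]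
    exact continuous_iff_continuousAt.2 fun v => (hasDerivAt_besselSeries ha v).continuousAt
  | succ n ih =>
    rw [Nat.cast_succ, contDiff_succ_iff_deriv]
    refine ⟨fun v => (hasDerivAt_besselSeries ha v).differentiableAt, by simp, ?_⟩
    have : deriv (besselSeries a) = fun v => 2 * besselSeries (a + 1) v := by
      funext v; exact (hasDerivAt_besselSeries ha v).deriv
    rw [this]
    exact contDiff_const.mul (ih (by linarith))

lemma contDiff_besselPhi {a : ℝ} (ha : -1 / 2 < a) :
    ContDiff ℝ ((⊤ : ℕ∞) : WithTop ℕ∞) (besselPhi a) := by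
  have : besselPhi a = fun u => besselSeries a (-(u / 2) ^ 2) := funext (besselPhi_eq a)
  rw [this]
  exact (contDiff_besselSeries ha).comp (by fun_prop)

/-- Splitting the factor `2m + 2a + 1` of `besselCoeff_eq_mul` into `2a + 1` and `2m` gives the two
terms; the second one is a derivative. This is the classical three-term recurrence of Bessel
functions. -/
lemma besselSeries_recurrence {a : ℝ} (ha : -1 / 2 < a) (v : ℝ) :
    besselSeries a v = (2 * a + 1) * besselSeries (a + 1) v + 4 * v * besselSeries (a + 2) v := by
  have ha1 : -1 / 2 < a + 1 := by linarith
  have h1 := (summable_besselSeries ha1 v).hasSum.mul_left (2 * a + 1)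
  have h2 := (hasSum_nat_mul_besselCoeff ha1 v).mul_left (2 * v)
  have h3 := h1.add h2
  have h4 : HasSum (fun m => besselCoeff a m * v ^ m) (besselSeries a v) :=
    (summable_besselSeries ha v).hasSum
  have h5 : HasSum (fun m => besselCoeff a m * v ^ m) _ := h3.congr_fun fun m => by
    rw [besselCoeff_eq_mul ha m]
    rcases m with _ | m
    · simp
    · push_cast; ring
  rw [h4.unique h5, show a + 1 + 1 = a + 2 by ring]
  unfold besselSeries
  ring

lemma hasDerivAt_besselPhi {a : ℝ} (ha : -1 / 2 < a) (u : ℝ) :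
    HasDerivAt (besselPhi a) (-(u * besselPhi (a + 1) u)) u := by
  have h : HasDerivAt (fun u : ℝ => -(u / 2) ^ 2) (-(u / 2)) u := by
    have := (((hasDerivAt_id u).div_const 2).pow 2).neg
    convert! this using 1
    simp only [id]; ring
  have := (hasDerivAt_besselSeries ha (-(u / 2) ^ 2)).comp u h
  have e : besselPhi a = fun u => besselSeries a (-(u / 2) ^ 2) := funext (besselPhi_eq a)
  rw [e, besselPhi_eq]
  convert! this using 1
  ring

lemma besselPhi_recurrence {a : ℝ} (ha : -1 / 2 < a) (u : ℝ) :
    besselPhi a u = (2 * a + 1) * besselPhi (a + 1) u - u ^ 2 * besselPhi (a + 2) u := by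
  rw [besselPhi_eq, besselPhi_eq, besselPhi_eq, besselSeries_recurrence ha]
  ring

/-- `∂_u (u φ_{a+1}(u)) + 2 a φ_{a+1}(u) = φ_a(u)`. -/
lemma hasDerivAt_mul_besselPhi {a : ℝ} (ha : -1 / 2 < a) (u : ℝ) :
    HasDerivAt (fun u => u * besselPhi (a + 1) u)
      (besselPhi a u - 2 * a * besselPhi (a + 1) u) u := by
  have := (hasDerivAt_id u).mul (hasDerivAt_besselPhi (a := a + 1) (by linarith) u)
  convert! this using 1
  rw [besselPhi_recurrence ha, show a + 1 + 1 = a + 2 by ring]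
  simp; ring

/-! ### Gaussian integrals of the Bessel series -/

lemma integral_rpow_mul_exp_neg_sq {q b : ℝ} (hq : -1 < q) (hb : 0 < b) :
    ∫ y in Set.Ioi (0 : ℝ), y ^ q * Real.exp (-(b * y ^ 2 / 2)) =
      (b / 2) ^ (-((q + 1) / 2)) * (1 / 2) * Real.Gamma ((q + 1) / 2) := by
  have := integral_rpow_mul_exp_neg_mul_rpow (p := 2) (q := q) (b := b / 2) (by norm_num) hq
    (by positivity)
  rw [neg_div] at this
  rw [← this]
  refine integral_congr_ae (ae_of_all _ fun y => ?_)
  simp only [Real.rpow_two]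
  congr 2; ring

lemma integrableOn_rpow_mul_exp_neg_sq {q b : ℝ} (hq : -1 < q) (hb : 0 < b) :
    IntegrableOn (fun y : ℝ => y ^ q * Real.exp (-(b * y ^ 2 / 2))) (Set.Ioi 0) := by
  have := integrableOn_rpow_mul_exp_neg_mul_rpow (p := 2) (s := q) (b := b / 2) hq (by norm_num)
    (by positivity)
  refine this.congr_fun (fun y _ => ?_) measurableSet_Ioi
  simp only [Real.rpow_two]
  congr 2; ring

/-- `∫_0^∞ S_a(c y²) e^{-b y²/2} y^{2a} dy = b^{-(a+1/2)} e^{2c/b}`. -/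
lemma integral_besselSeries_mul_exp {a b : ℝ} (c : ℝ) (ha : -1 / 2 < a) (hb : 0 < b) :
    ∫ y in Set.Ioi (0 : ℝ), besselSeries a (c * y ^ 2) * Real.exp (-(b * y ^ 2 / 2)) * y ^ (2 * a) =
      b ^ (-(a + 1 / 2)) * Real.exp (2 * c / b) := by
  have hq : ∀ m : ℕ, -1 < 2 * a + 2 * m := fun m => by
    have : (0 : ℝ) ≤ m := Nat.cast_nonneg m
    linarith
  -- The Gamma value produced by the moment integral cancels the one in the coefficient, and what is
  -- left is a term of an exponential series. A free `d` allows both `d = c` for the sum and `d =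
  -- |c|` for absolute convergence.
  have key : ∀ (m : ℕ) (d : ℝ), besselCoeff a m * d ^ m *
      ∫ y in Set.Ioi (0 : ℝ), y ^ (2 * a + 2 * m) * Real.exp (-(b * y ^ 2 / 2)) =
      b ^ (-(a + 1 / 2)) * ((2 * d / b) ^ m / m.factorial) := by
    intro m d
    rw [integral_rpow_mul_exp_neg_sq (hq m) hb]
    have e1 : (2 * a + 2 * m + 1) / 2 = m + a + 1 / 2 := by ring
    rw [e1]
    unfold besselCoeff
    have hG : 0 < Real.Gamma (m + a + 1 / 2) := Real.Gamma_pos_of_pos (by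
      have := hq m; linarith)
    have e2 : (b / 2) ^ (-(m + a + 1 / 2) : ℝ) = (2 / b) ^ m * (b ^ (-(a + 1 / 2)) *
        2 ^ (a + 1 / 2)) := by
      rw [show (-(m + a + 1 / 2) : ℝ) = -(m : ℝ) + -(a + 1 / 2) by ring,
        Real.rpow_add (by positivity), Real.rpow_neg (by positivity), Real.rpow_natCast,
        Real.div_rpow hb.le (by norm_num), Real.rpow_neg (by norm_num : (0 : ℝ) ≤ 2),
        ← inv_pow, inv_div, div_inv_eq_mul]
    have e3 : (2 : ℝ) ^ (a + 1 / 2) = 2 ^ (a - 1 / 2) * 2 := by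
      rw [← Real.rpow_add_one (by norm_num)]; congr 1; ring
    have h6 : (0 : ℝ) < 2 ^ (a - 1 / 2) := by positivity
    rw [e2, e3]
    have hf : (m.factorial : ℝ) ≠ 0 := by positivity
    rw [show (2 * d / b) ^ m = d ^ m * (2 / b) ^ m by rw [← mul_pow]; ring]
    generalize Real.Gamma (m + a + 1 / 2) = G at hG ⊢
    field_simp
  have fterm : ∀ m : ℕ, ∀ y ∈ Set.Ioi (0 : ℝ),
      besselCoeff a m * (c * y ^ 2) ^ m * Real.exp (-(b * y ^ 2 / 2)) * y ^ (2 * a) =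
      besselCoeff a m * c ^ m * (y ^ (2 * a + 2 * m) * Real.exp (-(b * y ^ 2 / 2))) := by
    intro m y hy
    have hy' : (0 : ℝ) < y := hy
    rw [Real.rpow_add hy', mul_pow, ← pow_mul, show (2 * (m : ℝ)) = ((2 * m : ℕ) : ℝ) by push_cast; rfl,
      Real.rpow_natCast]
    ring
  have hint : ∀ m : ℕ, IntegrableOn (fun y : ℝ => besselCoeff a m * (c * y ^ 2) ^ m *
      Real.exp (-(b * y ^ 2 / 2)) * y ^ (2 * a)) (Set.Ioi 0) := fun m =>
    IntegrableOn.congr_fun ((integrableOn_rpow_mul_exp_neg_sq (hq m) hb).const_mul _)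
      (fun y hy => (fterm m y hy).symm) measurableSet_Ioi
  have hnorm : ∀ m : ℕ, ∫ y in Set.Ioi (0 : ℝ), ‖besselCoeff a m * (c * y ^ 2) ^ m *
      Real.exp (-(b * y ^ 2 / 2)) * y ^ (2 * a)‖ =
      b ^ (-(a + 1 / 2)) * ((2 * |c| / b) ^ m / m.factorial) := by
    intro m
    rw [← key, ← integral_const_mul]
    refine setIntegral_congr_fun measurableSet_Ioi fun y hy => ?_
    have hy' : (0 : ℝ) < y := hy
    rw [fterm m y hy, norm_mul, norm_mul, norm_pow, Real.norm_eq_abs, Real.norm_eq_abs,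
      abs_of_pos (besselCoeff_pos ha m), Real.norm_of_nonneg (by positivity)]
  have hsum : Summable fun m : ℕ => ∫ y in Set.Ioi (0 : ℝ), ‖besselCoeff a m * (c * y ^ 2) ^ m *
      Real.exp (-(b * y ^ 2 / 2)) * y ^ (2 * a)‖ := by
    simp_rw [hnorm]
    exact (Real.summable_pow_div_factorial _).mul_left _
  have h1 := hasSum_integral_of_summable_integral_norm hint hsum
  have h2 : ∀ m : ℕ, ∫ y in Set.Ioi (0 : ℝ), besselCoeff a m * (c * y ^ 2) ^ m *
      Real.exp (-(b * y ^ 2 / 2)) * y ^ (2 * a) =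
      b ^ (-(a + 1 / 2)) * ((2 * c / b) ^ m / m.factorial) := by
    intro m
    rw [← key, ← integral_const_mul]
    exact setIntegral_congr_fun measurableSet_Ioi fun y hy => fterm m y hy
  simp_rw [h2] at h1
  have h3 : HasSum (fun m : ℕ => b ^ (-(a + 1 / 2)) * ((2 * c / b) ^ m / m.factorial))
      (b ^ (-(a + 1 / 2)) * Real.exp (2 * c / b)) := by
    rw [Real.exp_eq_exp_ℝ]
    exact (NormedSpace.expSeries_div_hasSum_exp (𝔸 := ℝ) (2 * c / b)).mul_left _
  rw [← h1.unique h3]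
  refine integral_congr_ae (ae_of_all _ fun y => ?_)
  simp only [besselSeries]
  rw [← tsum_mul_right, ← tsum_mul_right]

/-- Comparison of the kernels of consecutive orders. -/
lemma mul_besselSeries_succ_le {a : ℝ} (ha : -1 / 2 < a) :
    ∃ C > 0, ∀ u, 0 ≤ u → u * besselSeries (a + 1) (u ^ 2) ≤ C * besselSeries a (u ^ 2) := by
  have ha1 : -1 / 2 < a + 1 := by linarith
  have hs : 0 < a + 1 / 2 := by linarith
  have hs' : 0 < 2 * a + 1 := by linarith
  refine ⟨2 + 1 / (2 * a + 1), by positivity, fun u hu => ?_⟩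
  have H1 := (summable_besselSeries ha1 (u ^ 2)).hasSum.mul_left (2 * u)
  have H2 := (summable_besselSeries ha (u ^ 2)).hasSum
  have H3 := ((hasSum_nat_add_iff' 1).2 H2).mul_left (1 + 1 / (2 * a + 1))
  have H4 := hasSum_le (fun m => ?_) H1 (H2.add H3)
  · have hS : 0 ≤ besselSeries a (u ^ 2) := besselSeries_nonneg ha (by positivity)
    have hc := (besselCoeff_pos ha 0).le
    simp only [Finset.range_one, Finset.sum_singleton, pow_zero, mul_one] at H4
    change 2 * u * besselSeries (a + 1) (u ^ 2) ≤ besselSeries a (u ^ 2) +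
      (1 + 1 / (2 * a + 1)) * (besselSeries a (u ^ 2) - besselCoeff a 0) at H4
    have h0 : 0 ≤ u * besselSeries (a + 1) (u ^ 2) :=
      mul_nonneg hu (besselSeries_nonneg ha1 (by positivity))
    have h1 : 0 ≤ (1 + 1 / (2 * a + 1)) * besselCoeff a 0 := by positivity
    nlinarith
  · have hm : (0 : ℝ) ≤ m := Nat.cast_nonneg m
    have e1 := besselCoeff_eq_mul ha m
    have e2 := besselCoeff_succ a m
    have hc := besselCoeff_pos ha1 m
    have hc' := besselCoeff_pos ha (m + 1)
    set r : ℝ := 2 * m + 2 * a + 1 with hr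
    have hr0 : 0 < r := by linarith
    -- Arithmetic–geometric mean with the weight `r` that turns the coefficient of order `a + 1`
    -- into the one of order `a`. The term `r` thus reproduces the `m`-th term of the lower order
    -- series, and `u²/r` is absorbed by its `(m+1)`-st term.
    have e3 : 2 * u ≤ r + u ^ 2 / r := by
      rw [← sub_nonneg]
      have : r + u ^ 2 / r - 2 * u = (r - u) ^ 2 / r := by field_simp; ring
      rw [this]; positivity
    have e4 : ((m : ℝ) + 1) / 2 / r ≤ 1 + 1 / (2 * a + 1) := by
      rw [div_le_iff₀ hr0, hr]
      have : (1 + 1 / (2 * a + 1)) * (2 * m + 2 * a + 1) =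
          2 * m + (2 * a + 1) + 1 + 2 * m / (2 * a + 1) := by field_simp; ring
      rw [this]
      have : 0 ≤ 2 * (m : ℝ) / (2 * a + 1) := by positivity
      linarith
    calc 2 * u * (besselCoeff (a + 1) m * (u ^ 2) ^ m)
        ≤ (r + u ^ 2 / r) * (besselCoeff (a + 1) m * (u ^ 2) ^ m) := by gcongr
      _ = besselCoeff a m * (u ^ 2) ^ m +
          (((m : ℝ) + 1) / 2 / r) * (besselCoeff a (m + 1) * (u ^ 2) ^ (m + 1)) := by
          rw [e1]
          have : besselCoeff (a + 1) m = (m + 1) * besselCoeff a (m + 1) / 2 := by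
            rw [e2]; ring
          rw [this]; field_simp; ring
      _ ≤ _ := by gcongr

end DunklBessel
end

noncomputable section

namespace DunklBessel

/-! ### Product structure of the measures and sign changes -/

lemma lintegral_fin_prod_eq_prod {n : ℕ} {μ : Fin n → Measure ℝ} [∀ i, SigmaFinite (μ i)]
    (f : Fin n → ℝ → ℝ≥0∞) (hf : ∀ i, Measurable (f i)) :
    ∫⁻ x : Fin n → ℝ, ∏ i, f i (x i) ∂(Measure.pi μ) = ∏ i, ∫⁻ x, f i x ∂(μ i) := by
  induction n with
  | zero => simp
  | succ n n_ih =>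
      calc
        _ = ∫⁻ x : ℝ × (Fin n → ℝ),
            f 0 x.1 * ∏ i : Fin n, f (Fin.succ i) (x.2 i)
            ∂((μ 0).prod (Measure.pi (fun i ↦ μ i.succ))) := by
          have h := ((measurePreserving_piFinSuccAbove μ 0).symm).lintegral_comp_emb
            (MeasurableEquiv.measurableEmbedding _) (fun x => ∏ i, f i (x i))
          rw [← h]
          refine lintegral_congr fun x => ?_
          rw [Fin.prod_univ_succ]
          rfl
        _ = (∫⁻ x, f 0 x ∂μ 0)
            * ∏ i : Fin n, ∫⁻ x, f (Fin.succ i) x ∂(μ i.succ) := by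
          rw [← n_ih _ (fun i => hf _), ← lintegral_prod_mul (hf 0).aemeasurable]
          exact (Finset.measurable_prod _ fun i _ =>
            (hf i.succ).comp (measurable_pi_apply i)).aemeasurable
        _ = ∏ i, ∫⁻ x, f i x ∂(μ i) := by rw [Fin.prod_univ_succ]

lemma pi_withDensity {n : ℕ} {μ : Fin n → Measure ℝ} [∀ i, SigmaFinite (μ i)]
    (f : Fin n → ℝ → ℝ≥0∞) (hf : ∀ i, Measurable (f i))
    [∀ i, SigmaFinite ((μ i).withDensity (f i))] :
    Measure.pi (fun i => (μ i).withDensity (f i)) =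
      (Measure.pi μ).withDensity fun x => ∏ i, f i (x i) := by
  refine Measure.pi_eq fun s hs => ?_
  rw [withDensity_apply _ (MeasurableSet.univ_pi hs), Measure.restrict_pi_pi,
    lintegral_fin_prod_eq_prod _ hf]
  exact Finset.prod_congr rfl fun i _ => (withDensity_apply _ (hs i)).symm

/-- The measure `|y|^{2a} dy` on the real line. -/
def wLine (a : ℝ) : Measure ℝ := volume.withDensity fun y => ENNReal.ofReal (|y| ^ (2 * a))

instance (a : ℝ) : SigmaFinite (wLine a) := by
  unfold wLine
  exact SigmaFinite.withDensity_of_ne_top (ae_of_all _ fun _ => ENNReal.ofReal_ne_top)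

/-- The measure `y^{2a} dy` on the positive half-line. -/
def wHalf (a : ℝ) : Measure ℝ := (wLine a).restrict (Set.Ioi 0)

instance (a : ℝ) : SigmaFinite (wHalf a) := by unfold wHalf; infer_instance

lemma w_eq_pi {n : ℕ} (lam : Fin n → ℝ) : w lam = Measure.pi fun j => wLine (lam j) := by
  have hm : ∀ j : Fin n, Measurable fun y : ℝ => ENNReal.ofReal (|y| ^ (2 * lam j)) :=
    fun j => by fun_prop
  have : ∀ j : Fin n, SigmaFinite ((volume : Measure ℝ).withDensity
    fun y => ENNReal.ofReal (|y| ^ (2 * lam j))) := fun j =>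
    inferInstanceAs (SigmaFinite (wLine (lam j)))
  unfold w wLine
  rw [pi_withDensity _ hm, ← volume_pi]
  congr 1
  funext x
  exact ENNReal.ofReal_prod_of_nonneg fun j _ => by positivity

lemma orthant_eq_pi (n : ℕ) : orthant n = Set.univ.pi fun _ => Set.Ioi (0 : ℝ) := by
  ext x; simp [orthant]

lemma isOpen_orthant (n : ℕ) : IsOpen (orthant n) := by
  rw [orthant_eq_pi]
  exact isOpen_set_pi Set.finite_univ fun _ _ => isOpen_Ioi

lemma measurableSet_orthant (n : ℕ) : MeasurableSet (orthant n) :=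
  (isOpen_orthant n).measurableSet

lemma wPlus_eq_pi {n : ℕ} (lam : Fin n → ℝ) : wPlus lam = Measure.pi fun j => wHalf (lam j) := by
  unfold wPlus wHalf
  rw [w_eq_pi, orthant_eq_pi, Measure.restrict_pi_pi]

instance {n : ℕ} (lam : Fin n → ℝ) : SigmaFinite (w lam) := by
  rw [w_eq_pi]; infer_instance

instance {n : ℕ} (lam : Fin n → ℝ) : SigmaFinite (wPlus lam) := by
  unfold wPlus; infer_instance

lemma ae_mem_orthant {n : ℕ} (lam : Fin n → ℝ) : ∀ᵐ x ∂(wPlus lam), x ∈ orthant n :=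
  ae_restrict_mem (measurableSet_orthant n)

lemma wHalf_eq (a : ℝ) : wHalf a =
    (volume.restrict (Set.Ioi 0)).withDensity fun y => ENNReal.ofReal (y ^ (2 * a)) := by
  unfold wHalf wLine
  rw [restrict_withDensity measurableSet_Ioi]
  refine withDensity_congr_ae ?_
  filter_upwards [ae_restrict_mem measurableSet_Ioi] with y hy
  rw [abs_of_pos hy]

lemma integrable_wHalf_iff {a : ℝ} {f : ℝ → ℝ} :
    Integrable f (wHalf a) ↔ IntegrableOn (fun y => f y * y ^ (2 * a)) (Set.Ioi 0) := by
  rw [wHalf_eq, integrable_withDensity_iff (by fun_prop) (ae_of_all _ fun _ => ENNReal.ofReal_lt_top)]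
  refine integrable_congr ?_
  filter_upwards [ae_restrict_mem measurableSet_Ioi] with y hy
  have hy' : (0 : ℝ) < y := hy
  rw [ENNReal.toReal_ofReal (by positivity)]

lemma integral_wHalf {a : ℝ} (f : ℝ → ℝ) :
    ∫ y, f y ∂(wHalf a) = ∫ y in Set.Ioi (0 : ℝ), f y * y ^ (2 * a) := by
  rw [wHalf_eq, integral_withDensity_eq_integral_toReal_smul (by fun_prop)
    (ae_of_all _ fun _ => ENNReal.ofReal_lt_top)]
  refine integral_congr_ae ?_
  filter_upwards [ae_restrict_mem measurableSet_Ioi] with y hy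
  have hy' : (0 : ℝ) < y := hy
  rw [ENNReal.toReal_ofReal (by positivity), smul_eq_mul, mul_comm]

/-- The exponent satisfies `2a > -1`, so the density is integrable at the origin. -/
lemma isLocallyFiniteMeasure_wHalf {a : ℝ} (ha : -1 / 2 < a) :
    IsLocallyFiniteMeasure (wHalf a) := by
  refine ⟨fun x => ⟨Set.Iio (|x| + 1), Iio_mem_nhds (by
    have := le_abs_self x; linarith), ?_⟩⟩
  rw [wHalf_eq, withDensity_apply _ measurableSet_Iio, Measure.restrict_restrict measurableSet_Iio]
  have h1 : IntervalIntegrable (fun y : ℝ => y ^ (2 * a)) volume 0 (|x| + 1) :=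
    intervalIntegral.intervalIntegrable_rpow' (by linarith)
  rw [intervalIntegrable_iff_integrableOn_Ioo_of_le (by positivity)] at h1
  have : Set.Iio (|x| + 1) ∩ Set.Ioi 0 = Set.Ioo 0 (|x| + 1) := by
    ext y; simp [and_comm]
  rw [this]
  exact h1.lintegral_lt_top

lemma isLocallyFiniteMeasure_wPlus {n : ℕ} {lam : Fin n → ℝ} (hlam : ∀ j, -1 / 2 < lam j) :
    IsLocallyFiniteMeasure (wPlus lam) := by
  have := fun j => isLocallyFiniteMeasure_wHalf (hlam j)
  rw [wPlus_eq_pi]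
  infer_instance

lemma integral_wPlus_prod {n : ℕ} (lam : Fin n → ℝ) (f : Fin n → ℝ → ℝ) :
    ∫ x, ∏ j, f j (x j) ∂(wPlus lam) =
      ∏ j, ∫ y in Set.Ioi (0 : ℝ), f j y * y ^ (2 * lam j) := by
  rw [wPlus_eq_pi, integral_fintype_prod_eq_prod]
  exact Finset.prod_congr rfl fun j _ => integral_wHalf _

lemma integrable_wPlus_prod {n : ℕ} {lam : Fin n → ℝ} {f : Fin n → ℝ → ℝ}
    (hf : ∀ j, IntegrableOn (fun y => f j y * y ^ (2 * lam j)) (Set.Ioi 0)) :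
    Integrable (fun x => ∏ j, f j (x j)) (wPlus lam) := by
  rw [wPlus_eq_pi]
  exact Integrable.fintype_prod fun j => integrable_wHalf_iff.2 (hf j)

/-- The sign change `x ↦ ((-1)^{ε_j} x_j)_j`. -/
def signFlip {n : ℕ} (ε : Fin n → Fin 2) (x : Fin n → ℝ) : Fin n → ℝ :=
  fun j => (-1) ^ (ε j : ℕ) * x j

lemma neg_one_pow_mul_self (e : ℕ) : ((-1 : ℝ)) ^ e * (-1) ^ e = 1 := by
  rw [← mul_pow]; norm_num

@[simp] lemma signFlip_signFlip {n : ℕ} (ε : Fin n → Fin 2) (x : Fin n → ℝ) :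
    signFlip ε (signFlip ε x) = x := by
  funext j
  simp only [signFlip]
  rw [← mul_assoc, neg_one_pow_mul_self, one_mul]

lemma continuous_signFlip {n : ℕ} (ε : Fin n → Fin 2) : Continuous (signFlip ε) := by
  unfold signFlip; fun_prop

lemma contDiff_signFlip {n : ℕ} (ε : Fin n → Fin 2) :
    ContDiff ℝ ((⊤ : ℕ∞) : WithTop ℕ∞) (signFlip ε) := by
  unfold signFlip; fun_prop

lemma measurable_signFlip {n : ℕ} (ε : Fin n → Fin 2) : Measurable (signFlip ε) :=
  (continuous_signFlip ε).measurable

lemma measurePreserving_neg_wLine (a : ℝ) :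
    MeasurePreserving (fun y : ℝ => -y) (wLine a) (wLine a) := by
  refine ⟨measurable_neg, ?_⟩
  ext s hs
  have hn : MeasurePreserving (fun y : ℝ => -y) volume volume := Measure.measurePreserving_neg _
  rw [Measure.map_apply measurable_neg hs, wLine, withDensity_apply _ (measurable_neg hs),
    withDensity_apply _ hs, ← hn.setLIntegral_comp_preimage hs (by fun_prop)]
  simp

lemma measurePreserving_signFlip {n : ℕ} (lam : Fin n → ℝ) (ε : Fin n → Fin 2) :
    MeasurePreserving (signFlip ε) (w lam) (w lam) := by
  rw [w_eq_pi]
  refine measurePreserving_pi (f := fun j y => (-1) ^ (ε j : ℕ) * y) _ _ fun j => ?_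
  rcases Fin.exists_fin_two.1 ⟨ε j, rfl⟩ with h | h
  · rw [h]; simpa using! MeasurePreserving.id _
  · rw [h]; simpa using! measurePreserving_neg_wLine _

lemma signFlip_mem_orthant_unique {n : ℕ} {ε ε' : Fin n → Fin 2} {x : Fin n → ℝ}
    (h : signFlip ε x ∈ orthant n) (h' : signFlip ε' x ∈ orthant n) : ε = ε' := by
  funext j
  have h1 := h j
  have h2 := h' j
  simp only [signFlip] at h1 h2
  generalize ε j = a at *
  generalize ε' j = b at *
  fin_cases a <;> fin_cases b <;> simp at * <;> linarith

lemma exists_signFlip_mem_orthant {n : ℕ} {x : Fin n → ℝ} (h : ∀ j, x j ≠ 0) :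
    ∃ ε, signFlip ε x ∈ orthant n := by
  refine ⟨fun j => if 0 < x j then 0 else 1, fun j => ?_⟩
  simp only [signFlip]
  split_ifs with hj
  · simpa using hj
  · have := lt_of_le_of_ne (not_lt.1 hj) (h j)
    simpa using this

lemma ae_ne_zero {n : ℕ} (lam : Fin n → ℝ) : ∀ᵐ x ∂(w lam), ∀ j, x j ≠ 0 := by
  have hac : w lam ≪ volume := withDensity_absolutelyContinuous _ _
  refine hac.ae_le (ae_all_iff.2 fun j => ?_)
  have := Measure.pi_hyperplane (fun _ : Fin n => (volume : Measure ℝ)) j 0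
  rw [← volume_pi] at this
  rw [ae_iff]
  simpa using this

/-- Off the null set of coordinate hyperplanes, the space is the disjoint union of the reflected
orthants, and `w` is invariant under reflections. -/
lemma w_eq_sum_map {n : ℕ} (lam : Fin n → ℝ) :
    w lam = ∑ ε : Fin n → Fin 2, (wPlus lam).map (signFlip ε) := by
  ext s hs
  rw [Measure.finsetSum_apply]
  have h1 : w lam s = w lam (⋃ ε : Fin n → Fin 2, s ∩ signFlip ε ⁻¹' orthant n) := by
    refine measure_congr ?_
    filter_upwards [ae_ne_zero lam] with x hx
    obtain ⟨ε, hε⟩ := exists_signFlip_mem_orthant hx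
    refine propext ⟨fun h => Set.mem_iUnion.2 ⟨ε, h, hε⟩, fun h => ?_⟩
    obtain ⟨_, h, _⟩ := Set.mem_iUnion.1 h
    exact h
  rw [h1, measure_iUnion, tsum_fintype]
  · refine Finset.sum_congr rfl fun ε _ => ?_
    rw [Measure.map_apply (measurable_signFlip ε) hs, wPlus,
      Measure.restrict_apply (measurable_signFlip ε hs),
      ← (measurePreserving_signFlip lam ε).measure_preimage
        (hs.inter (measurable_signFlip ε (measurableSet_orthant n))).nullMeasurableSet]
    congr 1
    ext x; simp
  · intro ε ε' hne
    refine Set.disjoint_left.2 fun x hx hx' => hne ?_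
    exact signFlip_mem_orthant_unique hx.2 hx'.2
  · exact fun ε => hs.inter (measurable_signFlip ε (measurableSet_orthant n))

lemma map_signFlip_le {n : ℕ} (lam : Fin n → ℝ) (ε : Fin n → Fin 2) :
    (wPlus lam).map (signFlip ε) ≤ w lam := by
  rw [w_eq_sum_map, ← Finset.add_sum_erase _ _ (Finset.mem_univ ε)]
  exact Measure.le_add_right le_rfl

lemma ae_signFlip {n : ℕ} {lam : Fin n → ℝ} {p : (Fin n → ℝ) → Prop}
    (h : ∀ᵐ x ∂(w lam), p x) (ε : Fin n → Fin 2) : ∀ᵐ x ∂(wPlus lam), p (signFlip ε x) :=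
  ae_of_ae_map (measurable_signFlip ε).aemeasurable
    ((Measure.absolutelyContinuous_of_le (map_signFlip_le lam ε)).ae_le h)

lemma ae_w_of_signFlip {n : ℕ} {lam : Fin n → ℝ} {p : (Fin n → ℝ) → Prop}
    (h : ∀ ε, ∀ᵐ x ∂(wPlus lam), p (signFlip ε x)) : ∀ᵐ x ∂(w lam), p x := by
  have hp : ∀ᵐ x ∂(w lam), ∀ ε, signFlip ε x ∈ orthant n → p x := by
    rw [ae_all_iff]
    intro ε
    have h1 := h ε
    rw [wPlus, ae_restrict_iff' (measurableSet_orthant n)] at h1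
    have h2 := (measurePreserving_signFlip lam ε).quasiMeasurePreserving.ae h1
    simpa using h2
  filter_upwards [hp, ae_ne_zero lam] with x hx hx0
  obtain ⟨ε, hε⟩ := exists_signFlip_mem_orthant hx0
  exact hx ε hε

lemma integral_w {n : ℕ} {lam : Fin n → ℝ} {f : (Fin n → ℝ) → ℂ}
    (hf : ∀ ε, Integrable (fun x => f (signFlip ε x)) (wPlus lam)) :
    ∫ x, f x ∂(w lam) = ∑ ε : Fin n → Fin 2, ∫ x, f (signFlip ε x) ∂(wPlus lam) := by
  have hemb : ∀ ε : Fin n → Fin 2, MeasurableEmbedding (signFlip ε) := fun ε =>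
    (MeasurableEquiv.ofInvolutive (signFlip ε) (signFlip_signFlip ε)
      (measurable_signFlip ε)).measurableEmbedding
  rw [w_eq_sum_map, integral_finsetSum_measure]
  · exact Finset.sum_congr rfl fun ε _ => (hemb ε).integral_map _
  · exact fun ε _ => (hemb ε).integrable_map_iff.2 (hf ε)

lemma measurableEmbedding_signFlip {n : ℕ} (ε : Fin n → Fin 2) :
    MeasurableEmbedding (signFlip ε) :=
  (MeasurableEquiv.ofInvolutive (signFlip ε) (signFlip_signFlip ε)
      (measurable_signFlip ε)).measurableEmbedding

lemma aestronglyMeasurable_w {n : ℕ} {lam : Fin n → ℝ} {f : (Fin n → ℝ) → ℂ}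
    (hf : ∀ ε, AEStronglyMeasurable (fun x => f (signFlip ε x)) (wPlus lam)) :
    AEStronglyMeasurable f (w lam) := by
  rw [w_eq_sum_map, ← Measure.sum_fintype]
  refine aestronglyMeasurable_sum_measure_iff.2 fun ε => ?_
  exact (measurableEmbedding_signFlip ε).aestronglyMeasurable_map_iff.2 (hf ε)

lemma eLpNorm_signFlip_le {n : ℕ} (lam : Fin n → ℝ) (f : (Fin n → ℝ) → ℂ)
    (ε : Fin n → Fin 2) :
    eLpNorm (fun x => f (signFlip ε x)) 2 (wPlus lam) ≤ eLpNorm f 2 (w lam) := by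
  have := (measurableEmbedding_signFlip ε).eLpNorm_map_measure (g := f) (p := 2)
    (μ := wPlus lam)
  refine this.symm.le.trans (eLpNorm_mono_measure _ (map_signFlip_le lam ε))

/-- The squares of the norms add up over the orthants and the square root is subadditive. The loss
in the constant is harmless, since this serves only for finiteness, limits and continuity. -/
lemma eLpNorm_w_le_sum {n : ℕ} (lam : Fin n → ℝ) (f : (Fin n → ℝ) → ℂ) :
    eLpNorm f 2 (w lam) ≤
      ∑ ε : Fin n → Fin 2, eLpNorm (fun x => f (signFlip ε x)) 2 (wPlus lam) := by
  have h2 : ∀ (g : (Fin n → ℝ) → ℂ) (μ : Measure (Fin n → ℝ)),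
      eLpNorm g 2 μ = (∫⁻ x, ‖g x‖ₑ ^ (2 : ℝ) ∂μ) ^ (1 / 2 : ℝ) := fun g μ => by
    rw [eLpNorm_eq_lintegral_rpow_enorm_toReal (by norm_num) (by norm_num)]
    norm_num
  simp_rw [h2]
  rw [w_eq_sum_map, lintegral_finsetSum_measure]
  simp_rw [(measurableEmbedding_signFlip _).lintegral_map]
  induction (Finset.univ : Finset (Fin n → Fin 2)) using Finset.induction_on with
  | empty => simp
  | insert a s ha ih =>
    rw [Finset.sum_insert ha, Finset.sum_insert ha]
    refine (ENNReal.rpow_add_le_add_rpow _ _ (by norm_num) (by norm_num)).trans ?_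
    gcongr

end DunklBessel
end

noncomputable section

namespace DunklBessel

/-! ### The Hankel kernel and Gaussians -/

/-- The kernel `∏_j (x_j z_j)^{η_j} φ^{λ_j + η_j}(x_j z_j)` of the Hankel transform of type `η`. -/
def hankelKernel {n : ℕ} (lam : Fin n → ℝ) (η : Fin n → Fin 2) (x z : Fin n → ℝ) : ℝ :=
  ∏ j, (x j * z j) ^ (η j : ℕ) * besselPhi (lam j + (η j : ℕ)) (x j * z j)

/-- The Hankel transform of type `η` as an integral. -/
def hankel {n : ℕ} (lam : Fin n → ℝ) (η : Fin n → Fin 2) (f : (Fin n → ℝ) → ℂ)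
    (x : Fin n → ℝ) : ℂ :=
  ∫ z, (hankelKernel lam η x z : ℂ) * f z ∂(wPlus lam)

/-- The functions `x^η exp(-∑_j a_j x_j²/2)`. -/
def gauss {n : ℕ} (η : Fin n → Fin 2) (a x : Fin n → ℝ) : ℝ :=
  ∏ j, x j ^ (η j : ℕ) * Real.exp (-(a j * x j ^ 2 / 2))

/-- The factor `∏_j a_j^{-(λ_j+η_j+1/2)}`. -/
def gaussScale {n : ℕ} (lam : Fin n → ℝ) (η : Fin n → Fin 2) (a : Fin n → ℝ) : ℝ :=
  ∏ j, a j ^ (-(lam j + (η j : ℕ) + 1 / 2) : ℝ)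

section
variable {n : ℕ} {lam : Fin n → ℝ} (η : Fin n → Fin 2)

lemma order_gt {lam : Fin n → ℝ} (hlam : ∀ j, -1 / 2 < lam j) (η : Fin n → Fin 2) (j : Fin n) :
    -1 / 2 < lam j + ((η j : ℕ) : ℝ) := by
  have := hlam j
  have h : (0 : ℝ) ≤ ((η j : ℕ) : ℝ) := Nat.cast_nonneg _
  linarith

lemma hankelKernel_comm (x z : Fin n → ℝ) :
    hankelKernel lam η x z = hankelKernel lam η z x := by
  unfold hankelKernel
  exact Finset.prod_congr rfl fun j _ => by rw [mul_comm (x j)]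

lemma contDiff_hankelKernel (hlam : ∀ j, -1 / 2 < lam j) :
    ContDiff ℝ ((⊤ : ℕ∞) : WithTop ℕ∞)
      (fun p : (Fin n → ℝ) × (Fin n → ℝ) => hankelKernel lam η p.1 p.2) := by
  unfold hankelKernel
  refine contDiff_prod fun j _ => ?_
  have h1 : ContDiff ℝ ((⊤ : ℕ∞) : WithTop ℕ∞)
    (fun p : (Fin n → ℝ) × (Fin n → ℝ) => p.1 j * p.2 j) := by fun_prop
  exact (h1.pow _).mul ((contDiff_besselPhi (order_gt hlam η j)).comp h1)

lemma continuous_hankelKernel (hlam : ∀ j, -1 / 2 < lam j) :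
    Continuous (fun p : (Fin n → ℝ) × (Fin n → ℝ) => hankelKernel lam η p.1 p.2) :=
  (contDiff_hankelKernel η hlam).continuous

lemma continuous_hankelKernel_right (hlam : ∀ j, -1 / 2 < lam j) (x : Fin n → ℝ) :
    Continuous (fun z => hankelKernel lam η x z) :=
  (continuous_hankelKernel η hlam).comp (by fun_prop : Continuous fun z => (x, z))

/-- Each factor is at most a constant times `exp(3|x_j z_j|)`, and Young's inequality splits the
exponent. Leaving `τ` free lets any Gaussian decay in `z`, however weak, absorb the kernel. -/
lemma abs_hankelKernel_le (hlam : ∀ j, -1 / 2 < lam j) :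
    ∃ C > 0, ∀ τ > 0, ∀ x z, |hankelKernel lam η x z| ≤
      C * Real.exp (9 / (4 * τ) * normSq x + τ * normSq z) := by
  choose C hC h using fun j => abs_besselPhi_le (order_gt hlam η j)
  refine ⟨∏ j, C j, Finset.prod_pos fun j _ => hC j, fun τ hτ x z => ?_⟩
  unfold hankelKernel normSq
  rw [Finset.abs_prod, Finset.mul_sum, Finset.mul_sum, ← Finset.sum_add_distrib, Real.exp_sum,
    ← Finset.prod_mul_distrib]
  refine Finset.prod_le_prod (fun _ _ => abs_nonneg _) fun j _ => ?_
  set u := x j * z j with hu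
  have h1 : |u ^ (η j : ℕ)| ≤ Real.exp |u| := by
    have h0 : |u| ≤ Real.exp |u| := by
      have := Real.add_one_le_exp |u|
      linarith
    generalize η j = e
    fin_cases e
    · simp
    · simpa using h0
  rw [abs_mul]
  calc |u ^ (η j : ℕ)| * |besselPhi (lam j + (η j : ℕ)) u|
      ≤ Real.exp |u| * (C j * Real.exp (2 * |u|)) := by gcongr; exact h j u
    _ = C j * Real.exp (3 * |u|) := by
        rw [mul_left_comm, ← Real.exp_add]; ring_nf
    _ ≤ _ := by
        have := (hC j).le
        gcongr
        rw [hu, abs_mul, ← sq_abs (x j), ← sq_abs (z j)]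
        rw [← sub_nonneg]
        have : 9 / (4 * τ) * |x j| ^ 2 + τ * |z j| ^ 2 - 3 * (|x j| * |z j|) =
          (3 * |x j| - 2 * τ * |z j|) ^ 2 / (4 * τ) := by field_simp; ring
        rw [this]; positivity

lemma exp_neg_normSq (t : ℝ) (x : Fin n → ℝ) :
    Real.exp (-t * normSq x) = ∏ j, Real.exp (-(2 * t * x j ^ 2 / 2)) := by
  unfold normSq
  rw [← Real.exp_sum, Finset.mul_sum]
  congr 1
  exact Finset.sum_congr rfl fun j _ => by ring

lemma normSq_nonneg (x : Fin n → ℝ) : 0 ≤ normSq x := Finset.sum_nonneg fun _ _ => sq_nonneg _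

lemma continuous_normSq : Continuous (normSq : (Fin n → ℝ) → ℝ) := by unfold normSq; fun_prop

lemma continuous_gauss (a : Fin n → ℝ) : Continuous (gauss η a) := by unfold gauss; fun_prop

lemma gauss_pos {x : Fin n → ℝ} (a : Fin n → ℝ) (hx : x ∈ orthant n) : 0 < gauss η a x :=
  Finset.prod_pos fun j _ => mul_pos (pow_pos (hx j) _) (Real.exp_pos _)

lemma gauss_add (a b x : Fin n → ℝ) :
    gauss η (a + b) x = gauss η a x * ∏ j, Real.exp (-(b j * x j ^ 2 / 2)) := by
  unfold gauss
  rw [← Finset.prod_mul_distrib]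
  refine Finset.prod_congr rfl fun j _ => ?_
  rw [mul_assoc, ← Real.exp_add, Pi.add_apply]
  ring_nf

lemma exp_mul_gauss (t : ℝ) (a x : Fin n → ℝ) :
    Real.exp (-t * normSq x) * gauss η a x = gauss η (fun j => a j + 2 * t) x := by
  rw [exp_neg_normSq, mul_comm]
  exact (gauss_add η a (fun _ => 2 * t) x).symm

/-- The two factors `y^η` from the kernel and the Gaussian merge with the weight, so that type `η`
at `λ` is computed as order `λ + η`. -/
lemma pow_mul_pow_mul_rpow (e : ℕ) (b : ℝ) {y : ℝ} (hy : 0 < y) :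
    y ^ e * y ^ e * y ^ (2 * b) = y ^ (2 * (b + e)) := by
  rw [mul_add, Real.rpow_add hy, ← pow_add, ← two_mul,
    show (2 * (e : ℝ)) = ((2 * e : ℕ) : ℝ) by push_cast; rfl, Real.rpow_natCast, mul_comm]

lemma integrable_gauss_mul_gauss (hlam : ∀ j, -1 / 2 < lam j) {a b : Fin n → ℝ}
    (hab : ∀ j, 0 < a j + b j) :
    Integrable (fun x => gauss η a x * gauss η b x) (wPlus lam) := by
  unfold gauss
  simp_rw [← Finset.prod_mul_distrib]
  refine integrable_wPlus_prod (f := fun j y => y ^ (η j : ℕ) * Real.exp (-(a j * y ^ 2 / 2)) *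
    (y ^ (η j : ℕ) * Real.exp (-(b j * y ^ 2 / 2)))) fun j => ?_
  refine (integrableOn_rpow_mul_exp_neg_sq (q := 2 * (lam j + (η j : ℕ))) (b := a j + b j)
    (by have := order_gt hlam η j; linarith) (hab j)).congr_fun (fun y hy => ?_) measurableSet_Ioi
  simp only
  rw [← pow_mul_pow_mul_rpow _ _ hy, show -((a j + b j) * y ^ 2 / 2) =
    -(a j * y ^ 2 / 2) + -(b j * y ^ 2 / 2) by ring, Real.exp_add]
  ring

lemma integral_gauss_mul_gauss (hlam : ∀ j, -1 / 2 < lam j) {a b : Fin n → ℝ}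
    (hab : ∀ j, 0 < a j + b j) :
    ∫ x, gauss η a x * gauss η b x ∂(wPlus lam) =
      gaussScale lam η (fun j => a j + b j) * ∏ j, (2 : ℝ)⁻¹ ^ (-(lam j + (η j : ℕ) + 1 / 2) : ℝ) *
        (1 / 2) * Real.Gamma (lam j + (η j : ℕ) + 1 / 2) := by
  unfold gauss gaussScale
  simp_rw [← Finset.prod_mul_distrib]
  rw [integral_wPlus_prod lam (fun j y => y ^ (η j : ℕ) * Real.exp (-(a j * y ^ 2 / 2)) *
    (y ^ (η j : ℕ) * Real.exp (-(b j * y ^ 2 / 2))))]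
  refine Finset.prod_congr rfl fun j _ => ?_
  have h := integral_rpow_mul_exp_neg_sq (q := 2 * (lam j + (η j : ℕ))) (b := a j + b j)
    (by have := order_gt hlam η j; linarith) (hab j)
  rw [show (2 * (lam j + (η j : ℕ)) + 1) / 2 = lam j + (η j : ℕ) + 1 / 2 by ring, div_eq_mul_inv,
    Real.mul_rpow (hab j).le (by norm_num), mul_assoc, mul_assoc] at h
  rw [mul_assoc, ← h]
  refine setIntegral_congr_fun measurableSet_Ioi fun y hy => ?_
  rw [← pow_mul_pow_mul_rpow _ _ hy, show -((a j + b j) * y ^ 2 / 2) =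
    -(a j * y ^ 2 / 2) + -(b j * y ^ 2 / 2) by ring, Real.exp_add]
  ring

/-- In each coordinate this is `integral_besselSeries_mul_exp` of order `λ_j + η_j` with `c =
-(x_j/2)²`. -/
lemma integral_hankelKernel_mul_gauss (hlam : ∀ j, -1 / 2 < lam j) {a : Fin n → ℝ}
    (ha : ∀ j, 0 < a j) (x : Fin n → ℝ) :
    ∫ z, hankelKernel lam η x z * gauss η a z ∂(wPlus lam) =
      gaussScale lam η a * gauss η (fun j => (a j)⁻¹) x := by
  unfold gauss gaussScale hankelKernel
  simp_rw [← Finset.prod_mul_distrib]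
  rw [integral_wPlus_prod lam (fun j y => (x j * y) ^ (η j : ℕ) *
    besselPhi (lam j + (η j : ℕ)) (x j * y) * (y ^ (η j : ℕ) * Real.exp (-(a j * y ^ 2 / 2))))]
  refine Finset.prod_congr rfl fun j _ => ?_
  have h := integral_besselSeries_mul_exp (-(x j / 2) ^ 2) (order_gt hlam η j) (ha j)
  rw [show 2 * -(x j / 2) ^ 2 / a j = -((a j)⁻¹ * x j ^ 2 / 2) by ring] at h
  rw [mul_left_comm, ← h, ← integral_const_mul]
  refine setIntegral_congr_fun measurableSet_Ioi fun y hy => ?_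
  rw [← pow_mul_pow_mul_rpow _ _ hy, besselPhi_eq, mul_pow,
    show -(x j * y / 2) ^ 2 = -(x j / 2) ^ 2 * y ^ 2 by ring]
  ring

lemma gaussScale_mul {lam : Fin n → ℝ} {a b : Fin n → ℝ} (ha : ∀ j, 0 ≤ a j) (hb : ∀ j, 0 ≤ b j) :
    gaussScale lam η a * gaussScale lam η b = gaussScale lam η (fun j => a j * b j) := by
  unfold gaussScale
  rw [← Finset.prod_mul_distrib]
  exact Finset.prod_congr rfl fun j _ => (Real.mul_rpow (ha j) (hb j)).symm

lemma gaussScale_one {lam : Fin n → ℝ} : gaussScale lam η (fun _ => 1) = 1 := by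
  simp [gaussScale]

end

lemma norm_prod_exp_le_one {n : ℕ} (k : Fin n → ℕ) (x : Fin n → ℝ) :
    ‖∏ j, Real.exp (-(k j * x j ^ 2))‖ ≤ 1 := by
  rw [norm_prod]
  refine Finset.prod_le_one (fun _ _ => norm_nonneg _) fun j _ => ?_
  rw [Real.norm_of_nonneg (Real.exp_pos _).le, Real.exp_le_one_iff]
  have : (0 : ℝ) ≤ k j * x j ^ 2 := by positivity
  linarith

lemma continuous_prod_exp {n : ℕ} (k : Fin n → ℕ) :
    Continuous fun x : Fin n → ℝ => ∏ j, Real.exp (-(k j * x j ^ 2)) := by fun_prop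

/-! ### Uniqueness from Gaussian moments -/

/-- The positive and negative parts of `F` are densities of two finite measures. They have equal
integrals against the algebra spanned by the products of exponentials, which separates points, so
the measures coincide. -/
lemma ae_eq_zero_of_forall_integral_exp_real {n : ℕ} {μ : Measure (Fin n → ℝ)}
    (hμ : ∀ᵐ x ∂μ, x ∈ orthant n) {F : (Fin n → ℝ) → ℝ} (hF : Integrable F μ)
    (h : ∀ k : Fin n → ℕ, ∫ x, F x * ∏ j, Real.exp (-(k j * x j ^ 2)) ∂μ = 0) : F =ᵐ[μ] 0 := by
  -- The functions `exp(-x_j²)` separate points only for nonnegative coordinates, so the measures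
  -- are pushed to `[0,∞)^n` first.
  set T : (Fin n → ℝ) → (Fin n → ℝ≥0) := fun x j => (x j).toNNReal with hT
  have hTm : Measurable T := by
    refine measurable_pi_lambda _ fun j => ?_
    exact (measurable_pi_apply j).real_toNNReal
  set ρ : ((Fin n → ℝ) → ℝ) → Measure (Fin n → ℝ) :=
    fun G => μ.withDensity fun x => ENNReal.ofReal (G x) with hρ
  have hfin : ∀ G, Integrable G μ → IsFiniteMeasure ((ρ G).map T) := fun G hG => by
    have : IsFiniteMeasure (ρ G) := isFiniteMeasure_withDensity_ofReal hG.2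
    infer_instance
  have h1 := hfin F hF
  have h2 := hfin (-F) hF.neg
  let M : Submonoid (BoundedContinuousFunction (Fin n → ℝ≥0) ℝ) :=
    { carrier := {g | ∃ k : Fin n → ℕ, ∀ x, g x = ∏ j, Real.exp (-(k j * (x j : ℝ) ^ 2))}
      one_mem' := ⟨0, fun x => by simp⟩
      mul_mem' := by
        rintro g g' ⟨k, hk⟩ ⟨k', hk'⟩
        refine ⟨k + k', fun x => ?_⟩
        rw [BoundedContinuousFunction.mul_apply, hk, hk', ← Finset.prod_mul_distrib]
        refine Finset.prod_congr rfl fun j _ => ?_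
        rw [← Real.exp_add, Pi.add_apply]
        push_cast
        ring_nf }
  let A : StarSubalgebra ℝ (BoundedContinuousFunction (Fin n → ℝ≥0) ℝ) :=
    { Algebra.adjoin ℝ (M : Set (BoundedContinuousFunction (Fin n → ℝ≥0) ℝ)) with
      star_mem' := fun {g} hg => by
        have : star g = g := by ext x; simp
        rw [this]; exact hg }
  have hM : ∀ g ∈ M, ∫ x, g x ∂((ρ F).map T) = ∫ x, g x ∂((ρ (-F)).map T) := by
    rintro g ⟨k, hk⟩
    have hint : ∀ G : (Fin n → ℝ) → ℝ, Integrable G μ → ∫ x, g x ∂((ρ G).map T) =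
        ∫ x, max (G x) 0 * ∏ j, Real.exp (-(k j * x j ^ 2)) ∂μ := by
      intro G hG
      rw [integral_map hTm.aemeasurable g.continuous.measurable.aestronglyMeasurable]
      rw [hρ, integral_withDensity_eq_integral_toReal_smul₀
        (hG.aestronglyMeasurable.aemeasurable.ennreal_ofReal)
        (ae_of_all _ fun _ => ENNReal.ofReal_lt_top)]
      refine integral_congr_ae ?_
      filter_upwards [hμ] with x hx
      rw [hk, smul_eq_mul]
      congr 1
      refine Finset.prod_congr rfl fun j _ => ?_
      rw [hT, Real.coe_toNNReal _ (hx j).le]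
    have hb : ∀ G : (Fin n → ℝ) → ℝ, Integrable G μ →
        Integrable (fun x => G x * ∏ j, Real.exp (-(k j * x j ^ 2))) μ := by
      intro G hG
      exact hG.mul_bdd (c := 1) (continuous_prod_exp k).aestronglyMeasurable
        (ae_of_all _ fun x => norm_prod_exp_le_one k x)
    rw [hint F hF, hint _ hF.neg, ← sub_eq_zero, ← integral_sub (hb _ hF.pos_part)
      (hb _ hF.neg.pos_part)]
    refine Eq.trans ?_ (h k)
    refine integral_congr_ae (ae_of_all _ fun x => ?_)
    simp only [Pi.neg_apply]
    rw [← sub_mul]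
    congr 1
    rcases le_total 0 (F x) with hx | hx
    · rw [max_eq_left hx, max_eq_right (by linarith)]; ring
    · rw [max_eq_right hx, max_eq_left (by linarith)]; ring
  have hA : ∀ g ∈ A, ∫ x, (g : (Fin n → ℝ≥0) → ℝ) x ∂((ρ F).map T) =
      ∫ x, (g : (Fin n → ℝ≥0) → ℝ) x ∂((ρ (-F)).map T) := by
    intro g hg
    have hg' : g ∈ Algebra.adjoin ℝ (M : Set (BoundedContinuousFunction (Fin n → ℝ≥0) ℝ)) := hg
    rw [← Subalgebra.mem_toSubmodule, Algebra.adjoin_eq_span, Submonoid.closure_eq] at hg'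
    clear hg
    induction hg' using Submodule.span_induction with
    | mem g hg => exact hM g hg
    | zero => simp
    | add g g' _ _ ih ih' =>
      simp only [BoundedContinuousFunction.coe_add, Pi.add_apply]
      have i := fun (ν : Measure (Fin n → ℝ≥0)) [IsFiniteMeasure ν]
        (g : BoundedContinuousFunction (Fin n → ℝ≥0) ℝ) =>
        BoundedContinuousFunction.integrable ν g
      rw [integral_add (i _ _) (i _ _), integral_add (i _ _) (i _ _)]
      rw [ih, ih']
    | smul c g _ ih =>
      simp only [BoundedContinuousFunction.coe_smul]
      rw [integral_smul, integral_smul, ih]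
  have hsep : (A.map (BoundedContinuousFunction.toContinuousMapStarₐ ℝ)).SeparatesPoints := by
    intro x y hxy
    obtain ⟨j, hj⟩ := Function.ne_iff.1 hxy
    let g : BoundedContinuousFunction (Fin n → ℝ≥0) ℝ :=
      BoundedContinuousFunction.ofNormedAddCommGroup
        (fun x => Real.exp (-((x j : ℝ) ^ 2))) (by fun_prop) 1 (fun x => by
          rw [Real.norm_of_nonneg (Real.exp_pos _).le, Real.exp_le_one_iff]
          have : (0 : ℝ) ≤ (x j : ℝ) ^ 2 := by positivity
          linarith)
    have hgA : g ∈ A := Algebra.subset_adjoin ⟨Pi.single j 1, fun x => by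
      rw [Finset.prod_eq_single j]
      · simp [g]
      · intro i _ hi; simp [hi]
      · simp⟩
    refine ⟨g, ⟨BoundedContinuousFunction.toContinuousMapStarₐ ℝ g, ⟨g, hgA, rfl⟩, rfl⟩, ?_⟩
    change Real.exp (-((x j : ℝ) ^ 2)) ≠ Real.exp (-((y j : ℝ) ^ 2))
    intro he
    have he := neg_injective (Real.exp_injective he)
    exact hj (NNReal.coe_injective ((pow_left_inj₀ (x j).2 (y j).2 two_ne_zero).1 he))
  have key := ext_of_forall_mem_subalgebra_integral_eq_of_pseudoEMetric_complete_countable hsep hA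
  refine hF.ae_eq_zero_of_forall_setIntegral_eq_zero fun s hs _ => ?_
  rw [integral_eq_lintegral_pos_part_sub_lintegral_neg_part hF.integrableOn, sub_eq_zero]
  congr 1
  -- Almost everywhere `T` is undone by the inclusion into `ℝ^n`, so equality of the pushed measures
  -- can be read on `s` itself.
  have hB : MeasurableSet {y : Fin n → ℝ≥0 | (fun j => (y j : ℝ)) ∈ s} := by
    have : Measurable fun y : Fin n → ℝ≥0 => fun j => (y j : ℝ) := by fun_prop
    exact this hs
  have hs' : T ⁻¹' {y : Fin n → ℝ≥0 | (fun j => (y j : ℝ)) ∈ s} =ᵐ[μ] s := by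
    filter_upwards [hμ] with x hx
    refine propext ?_
    have : (fun j => ((T x j : ℝ≥0) : ℝ)) = x := by
      funext j; rw [hT, Real.coe_toNNReal _ (hx j).le]
    change (fun j => ((T x j : ℝ≥0) : ℝ)) ∈ s ↔ x ∈ s
    rw [this]
  have := congrArg (fun ν => ν {y : Fin n → ℝ≥0 | (fun j => (y j : ℝ)) ∈ s}) key
  simp only [Measure.map_apply hTm hB, hρ, withDensity_apply _ (hTm hB)] at this
  rwa [setLIntegral_congr hs', setLIntegral_congr hs'] at this

/-- Gaussian moments with parameters `c + 2k` are exponential moments of the integrable function `F`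
times the Gaussian with parameter `c`, and that Gaussian has no zero on the orthant. The start `c`
is free because `F` may grow. -/
lemma ae_eq_zero_of_forall_integral_gauss {n : ℕ} {lam : Fin n → ℝ} (η : Fin n → Fin 2)
    {F : (Fin n → ℝ) → ℂ} {c : Fin n → ℝ}
    (hF : Integrable (fun x => F x * (gauss η c x : ℂ)) (wPlus lam))
    (h : ∀ k : Fin n → ℕ,
      ∫ x, F x * (gauss η (fun j => c j + 2 * k j) x : ℂ) ∂(wPlus lam) = 0) :
    F =ᵐ[wPlus lam] 0 := by
  have hg : ∀ (k : Fin n → ℕ) x, F x * (gauss η (fun j => c j + 2 * k j) x : ℂ) =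
      (F x * (gauss η c x : ℂ)) * ((∏ j, Real.exp (-(k j * x j ^ 2)) : ℝ) : ℂ) := by
    intro k x
    rw [mul_assoc, ← Complex.ofReal_mul]
    congr 2
    have := gauss_add η c (fun j => 2 * k j) x
    rw [show (c + fun j => 2 * (k j : ℝ)) = fun j => c j + 2 * k j from rfl] at this
    rw [this]
    congr 1
    exact Finset.prod_congr rfl fun j _ => by ring_nf
  simp_rw [hg] at h
  have hint : ∀ k : Fin n → ℕ, Integrable (fun x => (F x * (gauss η c x : ℂ)) *
      ((∏ j, Real.exp (-(k j * x j ^ 2)) : ℝ) : ℂ)) (wPlus lam) := by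
    intro k
    refine hF.mul_bdd (c := 1)
      (Complex.continuous_ofReal.comp (continuous_prod_exp k)).aestronglyMeasurable
      (ae_of_all _ fun x => ?_)
    rw [Complex.norm_real]
    exact norm_prod_exp_le_one k x
  have hre := ae_eq_zero_of_forall_integral_exp_real (ae_mem_orthant lam) hF.re fun k => by
    have := congrArg Complex.re (h k)
    rw [← RCLike.re_eq_complex_re, ← integral_re (hint k)] at this
    simpa only [RCLike.re_eq_complex_re, Complex.re_mul_ofReal, Complex.zero_re] using this
  have him := ae_eq_zero_of_forall_integral_exp_real (ae_mem_orthant lam) hF.im fun k => by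
    have := congrArg Complex.im (h k)
    rw [← RCLike.im_eq_complex_im, ← integral_im (hint k)] at this
    simpa only [RCLike.im_eq_complex_im, Complex.im_mul_ofReal, Complex.zero_im] using this
  filter_upwards [hre, him, ae_mem_orthant lam] with x h1 h2 hx
  have h3 : F x * (gauss η c x : ℂ) = 0 := Complex.ext h1 h2
  have h4 : (gauss η c x : ℂ) ≠ 0 := by exact_mod_cast (gauss_pos η c hx).ne'
  exact (mul_eq_zero.1 h3).resolve_right h4

end DunklBessel
end

noncomputable section

namespace DunklBessel

/-! ### The Hankel transform on `L²` -/

/-- The norm of a linear combination depends only on the Gram matrix. -/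
lemma norm_linearCombination_eq_of_inner_eq {ι E : Type*} [NormedAddCommGroup E]
    [InnerProductSpace ℂ E] {v v' : ι → E} (h : ∀ i j, inner ℂ (v i) (v j) = inner ℂ (v' i) (v' j))
    (c : ι →₀ ℂ) :
    ‖Finsupp.linearCombination ℂ v c‖ = ‖Finsupp.linearCombination ℂ v' c‖ := by
  have key : inner ℂ (Finsupp.linearCombination ℂ v c) (Finsupp.linearCombination ℂ v c) =
      inner ℂ (Finsupp.linearCombination ℂ v' c) (Finsupp.linearCombination ℂ v' c) := by
    simp only [Finsupp.linearCombination_apply, Finsupp.sum, sum_inner, inner_sum,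
      inner_smul_left, inner_smul_right, h]
  rw [inner_self_eq_norm_sq_to_K, inner_self_eq_norm_sq_to_K] at key
  have := sq_eq_sq₀ (norm_nonneg (Finsupp.linearCombination ℂ v c))
    (norm_nonneg (Finsupp.linearCombination ℂ v' c))
  exact this.1 (by exact_mod_cast key)

section
variable {n : ℕ} {lam : Fin n → ℝ} (hlam : ∀ j, -1 / 2 < lam j) (η : Fin n → Fin 2)

lemma inner_toLp_ofReal {μ : Measure (Fin n → ℝ)} {k : (Fin n → ℝ) → ℝ}
    (hk : MemLp (fun x => (k x : ℂ)) 2 μ) (g : Lp ℂ 2 μ) :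
    inner ℂ (hk.toLp _) g = ∫ x, (k x : ℂ) * g x ∂μ := by
  rw [L2.inner_def]
  refine integral_congr_ae ?_
  filter_upwards [hk.coeFn_toLp] with x hx
  rw [hx]
  simp [mul_comm]

include hlam in
lemma memLp_gauss {a : Fin n → ℝ} (ha : ∀ j, 0 < a j) :
    MemLp (fun x => (gauss η a x : ℂ)) 2 (wPlus lam) := by
  have : MemLp (gauss η a) 2 (wPlus lam) := by
    rw [memLp_two_iff_integrable_sq (continuous_gauss η a).aestronglyMeasurable]
    simp_rw [sq]
    exact integrable_gauss_mul_gauss η hlam fun j => add_pos (ha j) (ha j)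
  exact this.ofReal

lemma gauss_zero_const (s : ℝ) (x : Fin n → ℝ) :
    gauss 0 (fun _ => 2 * s) x = Real.exp (-s * normSq x) := by
  rw [exp_neg_normSq]
  simp [gauss]

include hlam in
lemma memLp_exp_neg_normSq {s : ℝ} (hs : 0 < s) :
    MemLp (fun x : Fin n → ℝ => (Real.exp (-s * normSq x) : ℂ)) 2 (wPlus lam) := by
  have := memLp_gauss hlam 0 (a := fun _ => 2 * s) fun _ => by positivity
  simpa only [gauss_zero_const] using this

include hlam in
lemma integrable_gauss {a : Fin n → ℝ} (ha : ∀ j, 0 < a j) :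
    Integrable (gauss η a) (wPlus lam) := by
  -- The Gaussian is a product of two square integrable ones with halved parameters, one of type `η`
  -- and one of type `0`.
  have h1 := memLp_gauss hlam η (a := fun j => a j / 2) fun j => half_pos (ha j)
  have h2 := memLp_gauss hlam 0 (a := fun j => a j / 2) fun j => half_pos (ha j)
  have h3 := (h1.integrable_mul h2).re
  refine h3.congr (ae_of_all _ fun x => ?_)
  have h4 := gauss_add η (fun j => a j / 2) (fun j => a j / 2) x
  have h5 : ((fun j => a j / 2) + fun j => a j / 2) = a := by funext j; simp
  rw [h5] at h4
  simp only [Pi.mul_apply, ← Complex.ofReal_mul, RCLike.re_eq_complex_re, Complex.ofReal_re]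
  rw [h4]
  simp [gauss]

/-- The Gaussian functions of type `η` as elements of `L²`. -/
def gaussLp (a : {a : Fin n → ℝ // ∀ j, 0 < a j}) : Lp ℂ 2 (wPlus lam) :=
  (memLp_gauss hlam η a.2).toLp _

/-- The Hankel transforms of the Gaussian functions as elements of `L²`. -/
def gaussDualLp (a : {a : Fin n → ℝ // ∀ j, 0 < a j}) : Lp ℂ 2 (wPlus lam) :=
  (gaussScale lam η a.1 : ℂ) • gaussLp hlam η ⟨fun j => (a.1 j)⁻¹, fun j => inv_pos.2 (a.2 j)⟩

lemma inner_gaussLp (a b : {a : Fin n → ℝ // ∀ j, 0 < a j}) :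
    inner ℂ (gaussLp hlam η a) (gaussLp hlam η b) =
      ((∫ x, gauss η a.1 x * gauss η b.1 x ∂(wPlus lam) : ℝ) : ℂ) := by
  rw [gaussLp, inner_toLp_ofReal, ← integral_complex_ofReal]
  refine integral_congr_ae ?_
  filter_upwards [(memLp_gauss hlam η b.2).coeFn_toLp] with x hx
  rw [gaussLp, hx]; push_cast; rfl

/-- By `integral_gauss_mul_gauss` the inner products depend on the parameters only through the scale
of `a + b`, and `a b (1/a + 1/b) = a + b`. -/
lemma inner_gaussDualLp (a b : {a : Fin n → ℝ // ∀ j, 0 < a j}) :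
    inner ℂ (gaussDualLp hlam η a) (gaussDualLp hlam η b) =
      inner ℂ (gaussLp hlam η a) (gaussLp hlam η b) := by
  rw [gaussDualLp, gaussDualLp, inner_smul_left, inner_smul_right, inner_gaussLp, inner_gaussLp,
    Complex.conj_ofReal, ← Complex.ofReal_mul, ← Complex.ofReal_mul]
  congr 1
  have ha := a.2
  have hb := b.2
  rw [integral_gauss_mul_gauss η hlam fun j => add_pos (ha j) (hb j),
    integral_gauss_mul_gauss η hlam fun j => add_pos (inv_pos.2 (ha j)) (inv_pos.2 (hb j)),
    ← mul_assoc, ← mul_assoc, gaussScale_mul η (fun j => (ha j).le) (fun j => (hb j).le),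
    gaussScale_mul η (fun j => (mul_pos (ha j) (hb j)).le)
      (fun j => (add_pos (inv_pos.2 (ha j)) (inv_pos.2 (hb j))).le)]
  congr 2
  funext j
  have := (ha j).ne'
  have := (hb j).ne'
  field_simp
  ring

/-- A function orthogonal to all Gaussians has vanishing Gaussian moments and is therefore zero. -/
lemma denseRange_gaussLp :
    DenseRange (Finsupp.linearCombination ℂ (gaussLp hlam η)) := by
  have h1 : (Submodule.span ℂ (Set.range (gaussLp hlam η))).topologicalClosure = ⊤ := by
    rw [Submodule.topologicalClosure_eq_top_iff, Submodule.eq_bot_iff]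
    intro f hf
    rw [Submodule.mem_orthogonal] at hf
    have h2 : ∀ a : {a : Fin n → ℝ // ∀ j, 0 < a j},
        ∫ x, f x * (gauss η a.1 x : ℂ) ∂(wPlus lam) = 0 := fun a => by
      have := hf _ (Submodule.subset_span ⟨a, rfl⟩)
      rw [gaussLp, inner_toLp_ofReal] at this
      rw [← this]
      exact integral_congr_ae (ae_of_all _ fun x => mul_comm _ _)
    have h3 := ae_eq_zero_of_forall_integral_gauss η (F := f) (c := fun _ => 1)
      ((Lp.memLp f).integrable_mul (memLp_gauss hlam η fun _ => one_pos)) fun k =>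
        h2 ⟨fun j => 1 + 2 * k j, fun j => by positivity⟩
    exact (Lp.eq_zero_iff_ae_eq_zero).2 h3
  have h4 := (Submodule.dense_iff_topologicalClosure_eq_top).2 h1
  rw [← Finsupp.range_linearCombination] at h4
  exact h4

/-- The Hankel transform on `L²(dw_λ^+)`. -/
def hankelL2 : Lp ℂ 2 (wPlus lam) →L[ℂ] Lp ℂ 2 (wPlus lam) :=
  -- Extension from coefficient families needs no linear independence of the Gaussians; equality of
  -- the norms makes the map well defined on their span.
  (Finsupp.linearCombination ℂ (gaussDualLp hlam η)).extendOfNorm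
    (Finsupp.linearCombination ℂ (gaussLp hlam η))

lemma hankelL2_gaussLp (a : {a : Fin n → ℝ // ∀ j, 0 < a j}) :
    hankelL2 hlam η (gaussLp hlam η a) = gaussDualLp hlam η a := by
  have := LinearMap.extendOfNorm_eq (f := Finsupp.linearCombination ℂ (gaussDualLp hlam η))
    (denseRange_gaussLp hlam η) ⟨1, fun c => by
      rw [one_mul, norm_linearCombination_eq_of_inner_eq (inner_gaussDualLp hlam η) c]⟩
    (Finsupp.single a 1)
  simpa [hankelL2] using this

lemma norm_hankelL2_le (f : Lp ℂ 2 (wPlus lam)) : ‖hankelL2 hlam η f‖ ≤ ‖f‖ := by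
  have := LinearMap.norm_extendOfNorm_apply_le
    (f := Finsupp.linearCombination ℂ (gaussDualLp hlam η))
    (denseRange_gaussLp hlam η) 1 (fun c => by
      rw [one_mul, norm_linearCombination_eq_of_inner_eq (inner_gaussDualLp hlam η) c]) f
  simpa [hankelL2] using this

lemma clm_ext_gaussLp {E : Type*} [NormedAddCommGroup E] [NormedSpace ℂ E]
    {A B : Lp ℂ 2 (wPlus lam) →L[ℂ] E}
    (h : ∀ a, A (gaussLp hlam η a) = B (gaussLp hlam η a)) : A = B := by
  have : (A : Lp ℂ 2 (wPlus lam) → E) = B := by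
    refine (denseRange_gaussLp hlam η).equalizer A.continuous B.continuous ?_
    funext c
    induction c using Finsupp.induction_linear with
    | zero => simp
    | add f g hf hg =>
      simp only [Function.comp_apply] at hf hg ⊢
      rw [map_add, map_add, map_add, hf, hg]
    | single a c => simp [h a]
  exact ContinuousLinearMap.ext fun f => congrFun this f

@[simp] lemma hankelL2_hankelL2 (f : Lp ℂ 2 (wPlus lam)) :
    hankelL2 hlam η (hankelL2 hlam η f) = f := by
  have : (hankelL2 hlam η).comp (hankelL2 hlam η) = ContinuousLinearMap.id ℂ _ := by
    refine clm_ext_gaussLp hlam η fun a => ?_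
    rw [ContinuousLinearMap.comp_apply, hankelL2_gaussLp, gaussDualLp, map_smul, hankelL2_gaussLp,
      gaussDualLp, smul_smul, ← Complex.ofReal_mul, gaussScale_mul η (fun j => (a.2 j).le)
      (fun j => (inv_pos.2 (a.2 j)).le)]
    -- Inverting the parameters twice restores them, and the two scale factors multiply to the scale
    -- of `1`.
    have h1 : (fun j => a.1 j * (a.1 j)⁻¹) = fun _ => 1 := by
      funext j; exact mul_inv_cancel₀ (a.2 j).ne'
    simp only [h1, gaussScale_one, inv_inv]
    simp
  exact congrArg (fun A : Lp ℂ 2 (wPlus lam) →L[ℂ] Lp ℂ 2 (wPlus lam) => A f) this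

@[simp] lemma norm_hankelL2 (f : Lp ℂ 2 (wPlus lam)) : ‖hankelL2 hlam η f‖ = ‖f‖ := by
  refine le_antisymm (norm_hankelL2_le hlam η f) ?_
  have := norm_hankelL2_le hlam η (hankelL2 hlam η f)
  rwa [hankelL2_hankelL2] at this

/-- An isometry that is its own inverse is self-adjoint. -/
lemma inner_hankelL2_left (f g : Lp ℂ 2 (wPlus lam)) :
    inner ℂ (hankelL2 hlam η f) g = inner ℂ f (hankelL2 hlam η g) := by
  let I : Lp ℂ 2 (wPlus lam) →ₗᵢ[ℂ] Lp ℂ 2 (wPlus lam) :=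
    ⟨(hankelL2 hlam η).toLinearMap, norm_hankelL2 hlam η⟩
  have := I.inner_map_map (hankelL2 hlam η f) g
  rw [← this]
  change inner ℂ (hankelL2 hlam η (hankelL2 hlam η f)) _ = _
  rw [hankelL2_hankelL2]
  rfl

end

/-! ### Functions with Gaussian decay -/

/-- `f` decays like a Gaussian, in the `L²` sense. -/
def GaussDecay {n : ℕ} (lam : Fin n → ℝ) (f : (Fin n → ℝ) → ℂ) : Prop :=
  ∃ t > 0, MemLp (fun z => (Real.exp (t * normSq z) : ℂ) * f z) 2 (wPlus lam)

section
variable {n : ℕ} {lam : Fin n → ℝ} {f : (Fin n → ℝ) → ℂ}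

lemma norm_ofReal_exp (t : ℝ) : ‖(Real.exp t : ℂ)‖ = Real.exp t := by
  rw [Complex.norm_real, Real.norm_of_nonneg (Real.exp_pos _).le]

lemma continuous_exp_normSq (t : ℝ) :
    Continuous fun z : Fin n → ℝ => (Real.exp (t * normSq z) : ℂ) := by
  have := continuous_normSq (n := n)
  fun_prop

lemma gaussDecay_exp_mul {t : ℝ} (ht : 0 < t) (hf : MemLp f 2 (wPlus lam)) :
    GaussDecay lam fun z => (Real.exp (-t * normSq z) : ℂ) * f z := by
  refine ⟨t, ht, hf.congr_norm ?_ (ae_of_all _ fun z => ?_)⟩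
  · exact (continuous_exp_normSq t).aestronglyMeasurable.mul
      ((continuous_exp_normSq (-t)).aestronglyMeasurable.mul hf.1)
  · rw [norm_mul, norm_mul, norm_ofReal_exp, norm_ofReal_exp, ← mul_assoc, ← Real.exp_add]
    simp

lemma GaussDecay.aestronglyMeasurable (h : GaussDecay lam f) :
    AEStronglyMeasurable f (wPlus lam) := by
  obtain ⟨t, ht, hf⟩ := h
  refine ((continuous_exp_normSq (-t)).aestronglyMeasurable.mul hf.1).congr
    (ae_of_all _ fun z => ?_)
  simp only [Pi.mul_apply]
  rw [← mul_assoc, ← Complex.ofReal_mul, ← Real.exp_add]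
  simp

/-- Half of the decay pays for the factor `exp(s|z|²)` and the other half remains. -/
lemma GaussDecay.mono (h : GaussDecay lam f) {g : (Fin n → ℝ) → ℂ}
    (hg : AEStronglyMeasurable g (wPlus lam))
    (hle : ∀ s > 0, ∃ C, ∀ᵐ z ∂(wPlus lam), ‖g z‖ ≤ C * Real.exp (s * normSq z) * ‖f z‖) :
    GaussDecay lam g := by
  obtain ⟨t, ht, hf⟩ := h
  obtain ⟨C, hC⟩ := hle (t / 2) (half_pos ht)
  refine ⟨t / 2, half_pos ht, hf.of_le_mul (c := C)
    ((continuous_exp_normSq _).aestronglyMeasurable.mul hg) ?_⟩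
  filter_upwards [hC] with z hz
  rw [norm_mul, norm_mul, norm_ofReal_exp, norm_ofReal_exp]
  calc Real.exp (t / 2 * normSq z) * ‖g z‖
      ≤ Real.exp (t / 2 * normSq z) * (C * Real.exp (t / 2 * normSq z) * ‖f z‖) := by gcongr
    _ = C * (Real.exp (t / 2 * normSq z) * Real.exp (t / 2 * normSq z) * ‖f z‖) := by ring
    _ = _ := by rw [← Real.exp_add]; ring_nf

lemma GaussDecay.congr (h : GaussDecay lam f) {g : (Fin n → ℝ) → ℂ} (hfg : f =ᵐ[wPlus lam] g) :
    GaussDecay lam g := by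
  obtain ⟨t, ht, hf⟩ := h
  refine ⟨t, ht, (memLp_congr_ae ?_).1 hf⟩
  filter_upwards [hfg] with z hz
  rw [hz]

lemma GaussDecay.memLp (h : GaussDecay lam f) : MemLp f 2 (wPlus lam) := by
  have hm := h.aestronglyMeasurable
  obtain ⟨t, ht, hf⟩ := h
  refine hf.of_le hm (ae_of_all _ fun z => ?_)
  rw [norm_mul, norm_ofReal_exp]
  refine le_mul_of_one_le_left (norm_nonneg _) (Real.one_le_exp ?_)
  have := normSq_nonneg z
  positivity

lemma GaussDecay.exists_integrable (hlam : ∀ j, -1 / 2 < lam j) (h : GaussDecay lam f) :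
    ∃ τ > 0, Integrable (fun z => Real.exp (τ * normSq z) * ‖f z‖) (wPlus lam) := by
  obtain ⟨t, ht, hf⟩ := h
  refine ⟨t / 2, half_pos ht, ?_⟩
  have := ((memLp_exp_neg_normSq hlam (half_pos ht)).integrable_mul hf).norm
  refine this.congr (ae_of_all _ fun z => ?_)
  simp only [Pi.mul_apply]
  rw [norm_mul, norm_mul, norm_ofReal_exp, norm_ofReal_exp, ← mul_assoc, ← Real.exp_add]
  ring_nf

lemma GaussDecay.integrable_kernel_mul (hlam : ∀ j, -1 / 2 < lam j) (η : Fin n → Fin 2)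
    (h : GaussDecay lam f) (x : Fin n → ℝ) :
    Integrable (fun z => (hankelKernel lam η x z : ℂ) * f z) (wPlus lam) := by
  obtain ⟨τ, hτ, hint⟩ := h.exists_integrable hlam
  obtain ⟨C, hC, hE⟩ := abs_hankelKernel_le η hlam
  refine (hint.const_mul (C * Real.exp (9 / (4 * τ) * normSq x))).mono'
    ((Complex.continuous_ofReal.comp
      (continuous_hankelKernel_right η hlam x)).aestronglyMeasurable.mul h.aestronglyMeasurable)
    (ae_of_all _ fun z => ?_)
  rw [norm_mul, Complex.norm_real, Real.norm_eq_abs]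
  calc _ ≤ C * Real.exp (9 / (4 * τ) * normSq x + τ * normSq z) * ‖f z‖ := by
        gcongr; exact hE τ hτ x z
    _ = _ := by rw [Real.exp_add]; ring

/-- For functions with Gaussian decay, the integral computes the `L²` Hankel transform. -/
theorem hankel_ae_eq (hlam : ∀ j, -1 / 2 < lam j) (η : Fin n → Fin 2) (h : GaussDecay lam f)
    (hf : MemLp f 2 (wPlus lam)) :
    hankel lam η f =ᵐ[wPlus lam] hankelL2 hlam η (hf.toLp f) := by
  obtain ⟨τ, hτ, hint⟩ := h.exists_integrable hlam
  obtain ⟨C, hC, hE⟩ := abs_hankelKernel_le η hlam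
  set κ := 9 / (4 * τ) with hκ
  have hκ0 : 0 < κ := by positivity
  -- The kernel may grow like `exp(κ|x|²)` in `x`. A test Gaussian with all `a_j > 2κ` beats this
  -- growth, which makes Fubini legitimate.
  have hprod : ∀ a : Fin n → ℝ, (∀ j, 2 * κ < a j) → Integrable
      (fun p : (Fin n → ℝ) × (Fin n → ℝ) => (hankelKernel lam η p.1 p.2 : ℂ) * f p.2 *
        (gauss η a p.1 : ℂ)) ((wPlus lam).prod (wPlus lam)) := by
    intro a ha
    have h1 := (integrable_gauss hlam η (a := fun j => a j + 2 * (-κ)) fun j => by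
      have := ha j; linarith).norm
    refine ((h1.mul_prod hint).const_mul C).mono' ?_ (ae_of_all _ fun p => ?_)
    · have m1 : Continuous fun p : (Fin n → ℝ) × (Fin n → ℝ) =>
          (hankelKernel lam η p.1 p.2 : ℂ) :=
        Complex.continuous_ofReal.comp (continuous_hankelKernel η hlam)
      have m2 : Continuous fun p : (Fin n → ℝ) × (Fin n → ℝ) => (gauss η a p.1 : ℂ) :=
        Complex.continuous_ofReal.comp ((continuous_gauss η a).comp continuous_fst)
      exact (m1.aestronglyMeasurable.mul h.aestronglyMeasurable.comp_snd).mul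
        m2.aestronglyMeasurable
    · rw [norm_mul, norm_mul, Complex.norm_real, Complex.norm_real, Real.norm_eq_abs,
        ← exp_mul_gauss, norm_mul, Real.norm_of_nonneg (Real.exp_pos _).le, neg_neg]
      calc _ ≤ C * Real.exp (κ * normSq p.1 + τ * normSq p.2) * ‖f p.2‖ * ‖gauss η a p.1‖ := by
            gcongr; exact hE τ hτ p.1 p.2
        _ = _ := by rw [Real.exp_add]; ring
  have hint1 : ∀ a : Fin n → ℝ, (∀ j, 2 * κ < a j) →
      Integrable (fun x => hankel lam η f x * (gauss η a x : ℂ)) (wPlus lam) := by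
    intro a ha
    refine (hprod a ha).integral_prod_left.congr (ae_of_all _ fun x => ?_)
    simp only [hankel]
    rw [← integral_mul_const]
  have hint2 : ∀ a : Fin n → ℝ, (∀ j, 0 < a j) →
      Integrable (fun x => hankelL2 hlam η (hf.toLp f) x * (gauss η a x : ℂ)) (wPlus lam) :=
    fun a ha => (Lp.memLp _).integrable_mul (memLp_gauss hlam η ha)
  have heq : ∀ a : Fin n → ℝ, (∀ j, 2 * κ < a j) →
      ∫ x, hankel lam η f x * (gauss η a x : ℂ) ∂(wPlus lam) =
      ∫ x, hankelL2 hlam η (hf.toLp f) x * (gauss η a x : ℂ) ∂(wPlus lam) := by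
    intro a ha
    have ha0 : ∀ j, 0 < a j := fun j => lt_trans (by positivity) (ha j)
    -- On the `L²` side the Gaussian moment moves to `f` by self-adjointness; on the integral side
    -- the same happens by Fubini and the symmetry of the kernel.
    have e1 : ∫ x, hankelL2 hlam η (hf.toLp f) x * (gauss η a x : ℂ) ∂(wPlus lam) =
        gaussScale lam η a * ∫ x, (gauss η (fun j => (a j)⁻¹) x : ℂ) * f x ∂(wPlus lam) := by
      have h1 := inner_hankelL2_left hlam η (gaussLp hlam η ⟨a, ha0⟩) (hf.toLp f)
      rw [hankelL2_gaussLp, gaussDualLp, inner_smul_left, gaussLp, gaussLp, inner_toLp_ofReal,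
        inner_toLp_ofReal, Complex.conj_ofReal] at h1
      rw [integral_congr_ae (ae_of_all _ fun x => mul_comm _ _), ← h1]
      congr 1
      refine integral_congr_ae ?_
      filter_upwards [hf.coeFn_toLp] with x hx
      rw [hx]
    rw [e1, ← integral_const_mul]
    have e2 : ∀ x, hankel lam η f x * (gauss η a x : ℂ) =
        ∫ z, (hankelKernel lam η x z : ℂ) * f z * (gauss η a x : ℂ) ∂(wPlus lam) :=
      fun x => (integral_mul_const _ _).symm
    simp_rw [e2]
    rw [integral_integral_swap (hprod a ha)]
    refine integral_congr_ae (ae_of_all _ fun z => ?_)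
    simp only
    have e3 : ∀ x, (hankelKernel lam η x z : ℂ) * f z * (gauss η a x : ℂ) =
        ((hankelKernel lam η z x * gauss η a x : ℝ) : ℂ) * f z := fun x => by
      rw [hankelKernel_comm]; push_cast; ring
    simp_rw [e3]
    rw [integral_mul_const, integral_complex_ofReal, integral_hankelKernel_mul_gauss η hlam ha0]
    push_cast; ring
  have key := ae_eq_zero_of_forall_integral_gauss (lam := lam) η
    (F := fun x => hankel lam η f x - hankelL2 hlam η (hf.toLp f) x)
    (c := fun _ => 2 * κ + 1) ?_ fun k => ?_
  · filter_upwards [key] with x hx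
    exact sub_eq_zero.1 hx
  · simp_rw [sub_mul]
    exact (hint1 _ fun j => by linarith).sub (hint2 _ fun j => by positivity)
  · have hk : ∀ j, 2 * κ < 2 * κ + 1 + 2 * (k j : ℝ) := fun j => by
      have : (0 : ℝ) ≤ k j := Nat.cast_nonneg _
      linarith
    simp_rw [sub_mul]
    rw [integral_sub (hint1 _ hk) (hint2 _ fun j => by positivity), heq _ hk, sub_self]

end
end DunklBessel
end

noncomputable section

namespace DunklBessel

/-! ### The Dunkl transform of symmetric functions -/

/-- The character `∏_j ((-1)^{ε_j})^{η_j}` of the group of sign changes. -/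
def signChar {n : ℕ} (η ε : Fin n → Fin 2) : ℝ := ∏ j, ((-1) ^ (ε j : ℕ)) ^ (η j : ℕ)

/-- The factor `(-i)^{|η|}`. -/
def phase {n : ℕ} (η : Fin n → Fin 2) : ℂ := ∏ j, (-Complex.I) ^ (η j : ℕ)

section
variable {n : ℕ} {lam : Fin n → ℝ} (η : Fin n → Fin 2)

lemma norm_phase : ‖phase η‖ = 1 := by
  unfold phase
  rw [norm_prod]
  exact Finset.prod_eq_one fun j _ => by simp

lemma abs_signChar (ε : Fin n → Fin 2) : |signChar η ε| = 1 := by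
  unfold signChar
  rw [Finset.abs_prod]
  exact Finset.prod_eq_one fun j _ => by simp

lemma norm_signChar (ε : Fin n → Fin 2) : ‖(signChar η ε : ℂ)‖ = 1 := by
  rw [Complex.norm_real, Real.norm_eq_abs, abs_signChar]

/-- `((-i)²)^{|η|} (-1)^{|η|} = 1`: the two phases of transform and inverse transform cancel against
the reflection `x ↦ -x`. -/
lemma phase_mul_phase_mul_signChar :
    phase η * phase η * (signChar η (fun _ => 1) : ℂ) = 1 := by
  unfold phase signChar
  rw [Complex.ofReal_prod, ← Finset.prod_mul_distrib, ← Finset.prod_mul_distrib]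
  refine Finset.prod_eq_one fun j _ => ?_
  generalize η j = e
  fin_cases e <;> simp

lemma neg_eq_signFlip (x : Fin n → ℝ) : -x = signFlip (fun _ => 1) x := by
  funext j; simp [signFlip]

lemma normSq_signFlip (ε : Fin n → Fin 2) (x : Fin n → ℝ) :
    normSq (signFlip ε x) = normSq x := by
  unfold normSq signFlip
  refine Finset.sum_congr rfl fun j _ => ?_
  rw [mul_pow, ← pow_mul, mul_comm (ε j : ℕ), pow_mul]; norm_num

/-- The Bessel factor is even, so only `(x_j z_j)^{η_j}` feels the sign. -/
lemma hankelKernel_signFlip (ε : Fin n → Fin 2) (x z : Fin n → ℝ) :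
    hankelKernel lam η (signFlip ε x) z = signChar η ε * hankelKernel lam η x z := by
  unfold hankelKernel signChar
  rw [← Finset.prod_mul_distrib]
  refine Finset.prod_congr rfl fun j _ => ?_
  simp only [signFlip]
  rw [mul_assoc, mul_pow, mul_assoc, besselPhi_eq, besselPhi_eq]
  have : ((-1 : ℝ) ^ (ε j : ℕ) * (x j * z j) / 2) ^ 2 = (x j * z j / 2) ^ 2 := by
    rw [mul_div_assoc, mul_pow, sq ((-1 : ℝ) ^ (ε j : ℕ)), neg_one_pow_mul_self, one_mul]
  rw [this]

lemma hankel_signFlip (f : (Fin n → ℝ) → ℂ) (ε : Fin n → Fin 2) (x : Fin n → ℝ) :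
    hankel lam η f (signFlip ε x) = signChar η ε * hankel lam η f x := by
  unfold hankel
  rw [← integral_const_mul]
  refine integral_congr_ae (ae_of_all _ fun z => ?_)
  simp only [hankelKernel_signFlip]
  push_cast; ring

/-- Expanding the product over `j` chooses in each factor either the even or the odd term; the
choices are the types `η`. -/
lemma conj_psi (z x : Fin n → ℝ) : (starRingEnd ℂ) (psi lam z x) =
    ∑ η : Fin n → Fin 2, phase η * (hankelKernel lam η x z : ℂ) := by
  unfold psi phase hankelKernel
  simp_rw [Complex.ofReal_prod, ← Finset.prod_mul_distrib]
  have h := Finset.prod_univ_sum (fun _ : Fin n => (Finset.univ : Finset (Fin 2)))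
    (fun j (e : Fin 2) => (-Complex.I) ^ (e : ℕ) *
      (((x j * z j) ^ (e : ℕ) * besselPhi (lam j + (e : ℕ)) (x j * z j) : ℝ) : ℂ))
  rw [Fintype.piFinset_univ] at h
  rw [← h, map_prod]
  refine Finset.prod_congr rfl fun j _ => ?_
  rw [Fin.sum_univ_two]
  simp

/-- Orthogonality of the characters of the group of sign changes; the sum factorizes over the
coordinates. -/
lemma sum_signChar_mul (η' : Fin n → Fin 2) :
    ∑ ε, signChar η ε * signChar η' ε = if η' = η then 2 ^ n else 0 := by
  unfold signChar
  simp_rw [← Finset.prod_mul_distrib]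
  have h := Finset.prod_univ_sum (fun _ : Fin n => (Finset.univ : Finset (Fin 2)))
    (fun j (e : Fin 2) => ((-1 : ℝ) ^ (e : ℕ)) ^ (η j : ℕ) * ((-1 : ℝ) ^ (e : ℕ)) ^ (η' j : ℕ))
  rw [Fintype.piFinset_univ] at h
  rw [← h]
  have h2 : ∀ j, ∑ e : Fin 2, ((-1 : ℝ) ^ (e : ℕ)) ^ (η j : ℕ) * ((-1 : ℝ) ^ (e : ℕ)) ^ (η' j : ℕ) =
      if η' j = η j then 2 else 0 := by
    intro j
    rw [Fin.sum_univ_two]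
    generalize η j = a
    generalize η' j = b
    fin_cases a <;> fin_cases b <;> norm_num
  simp_rw [h2]
  split_ifs with heq
  · subst heq; simp
  · obtain ⟨j, hj⟩ := Function.ne_iff.1 heq
    exact Finset.prod_eq_zero (Finset.mem_univ j) (if_neg hj)

lemma dunkl_eq_sum (hlam : ∀ j, -1 / 2 < lam j) {f : (Fin n → ℝ) → ℂ}
    (hf : ∀ ε, GaussDecay lam fun x => f (signFlip ε x)) (z : Fin n → ℝ) :
    dunkl lam f z = 1 / 2 ^ n * ∑ ε, ∑ η, phase η * (signChar η ε : ℂ) *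
      hankel lam η (fun x => f (signFlip ε x)) z := by
  unfold dunkl
  have h1 : ∀ ε x, (starRingEnd ℂ) (psi lam z (signFlip ε x)) * f (signFlip ε x) =
      ∑ η, phase η * (signChar η ε : ℂ) *
        ((hankelKernel lam η z x : ℂ) * f (signFlip ε x)) := by
    intro ε x
    rw [conj_psi, Finset.sum_mul]
    refine Finset.sum_congr rfl fun η _ => ?_
    rw [hankelKernel_signFlip, hankelKernel_comm]
    push_cast; ring
  have h2 : ∀ ε η, Integrable (fun x => phase η * (signChar η ε : ℂ) *
        ((hankelKernel lam η z x : ℂ) * f (signFlip ε x))) (wPlus lam) := fun ε η =>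
    ((hf ε).integrable_kernel_mul hlam η z).const_mul _
  rw [integral_w]
  · simp_rw [h1]
    congr 1
    refine Finset.sum_congr rfl fun ε _ => ?_
    rw [integral_finsetSum _ fun η _ => h2 ε η]
    exact Finset.sum_congr rfl fun η _ => integral_const_mul _ _
  · intro ε
    simp_rw [h1]
    exact integrable_finsetSum _ fun η _ => h2 ε η

lemma symmExt_signFlip (f : (Fin n → ℝ) → ℂ) (ε : Fin n → Fin 2) {x : Fin n → ℝ}
    (hx : x ∈ orthant n) : symmExt η f (signFlip ε x) = signChar η ε * f x := by
  have hs : ∀ j, Real.sign (signFlip ε x j) = (-1) ^ (ε j : ℕ) := by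
    intro j
    have := hx j
    simp only [signFlip]
    generalize ε j = e
    fin_cases e
    · simp [Real.sign_of_pos this]
    · simp [Real.sign_of_neg, this]
  have hab : (fun j => |signFlip ε x j|) = x := by
    funext j
    simp [signFlip, abs_mul, abs_of_pos (hx j)]
  unfold symmExt
  rw [if_pos, hab]
  · simp_rw [hs]; rfl
  · intro j
    simp only [signFlip]
    exact mul_ne_zero (pow_ne_zero _ (by norm_num)) (hx j).ne'

lemma symmExt_signFlip_ae (f : (Fin n → ℝ) → ℂ) (ε : Fin n → Fin 2) :
    (fun x => symmExt η f (signFlip ε x)) =ᵐ[wPlus lam] fun x => (signChar η ε : ℂ) * f x := by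
  filter_upwards [ae_mem_orthant lam] with x hx
  exact symmExt_signFlip η f ε hx

lemma hankel_congr_ae {f g : (Fin n → ℝ) → ℂ} (h : f =ᵐ[wPlus lam] g) :
    hankel lam η f = hankel lam η g := by
  funext x
  refine integral_congr_ae ?_
  filter_upwards [h] with z hz
  rw [hz]

lemma hankel_const_mul (c : ℂ) (f : (Fin n → ℝ) → ℂ) (x : Fin n → ℝ) :
    hankel lam η (fun z => c * f z) x = c * hankel lam η f x := by
  unfold hankel
  rw [← integral_const_mul]
  exact integral_congr_ae (ae_of_all _ fun z => mul_left_comm _ _ _)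

lemma GaussDecay.const_mul {f : (Fin n → ℝ) → ℂ} (h : GaussDecay lam f) (c : ℂ) :
    GaussDecay lam fun z => c * f z := by
  obtain ⟨t, ht, hf⟩ := h
  refine ⟨t, ht, (hf.const_mul c).congr_norm ?_ (ae_of_all _ fun z => ?_)⟩
  · exact (hf.const_mul c).1.congr (ae_of_all _ fun z => mul_left_comm _ _ _)
  · rw [mul_left_comm]

lemma gaussDecay_symmExt_signFlip {f : (Fin n → ℝ) → ℂ} (h : GaussDecay lam f)
    (ε : Fin n → Fin 2) : GaussDecay lam fun x => symmExt η f (signFlip ε x) :=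
  (h.const_mul (signChar η ε : ℂ)).congr (symmExt_signFlip_ae η f ε).symm

/-- On the reflected orthants `f^η` carries the character of `η`, so orthogonality removes every
other type from `dunkl_eq_sum`; the factor `2^n` cancels the normalization. -/
theorem dunkl_symmExt (hlam : ∀ j, -1 / 2 < lam j) {f : (Fin n → ℝ) → ℂ}
    (h : GaussDecay lam f) (z : Fin n → ℝ) :
    dunkl lam (symmExt η f) z = phase η * hankel lam η f z := by
  rw [dunkl_eq_sum hlam (gaussDecay_symmExt_signFlip η h)]
  have h1 : ∀ ε η', hankel lam η' (fun x => symmExt η f (signFlip ε x)) z =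
      signChar η ε * hankel lam η' f z := fun ε η' => by
    rw [hankel_congr_ae η' (symmExt_signFlip_ae η f ε), hankel_const_mul]
  simp_rw [h1]
  rw [Finset.sum_comm]
  have h2 : ∀ η', ∑ ε, phase η' * (signChar η' ε : ℂ) * (signChar η ε * hankel lam η' f z) =
      if η' = η then 2 ^ n * (phase η * hankel lam η f z) else 0 := by
    intro η'
    have := sum_signChar_mul η η'
    have h3 : (∑ ε, (signChar η ε : ℂ) * (signChar η' ε : ℂ)) = if η' = η then 2 ^ n else 0 := by
      have := congrArg (fun r : ℝ => (r : ℂ)) this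
      push_cast at this
      rw [this]; split_ifs <;> simp
    calc _ = (∑ ε, (signChar η ε : ℂ) * (signChar η' ε : ℂ)) *
          (phase η' * hankel lam η' f z) := by
          rw [Finset.sum_mul]; exact Finset.sum_congr rfl fun ε _ => by ring
      _ = _ := by
          rw [h3]; split_ifs with he
          · rw [he]
          · rw [zero_mul]
  simp_rw [h2]
  rw [Finset.sum_ite_eq' Finset.univ η, if_pos (Finset.mem_univ _)]
  have : (2 : ℂ) ^ n ≠ 0 := pow_ne_zero _ two_ne_zero
  field_simp

lemma eLpNorm_symmExt_signFlip (f : (Fin n → ℝ) → ℂ) (ε : Fin n → Fin 2) :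
    eLpNorm (fun x => symmExt η f (signFlip ε x)) 2 (wPlus lam) = eLpNorm f 2 (wPlus lam) := by
  rw [eLpNorm_congr_ae (symmExt_signFlip_ae η f ε)]
  refine eLpNorm_congr_norm_ae (ae_of_all _ fun x => ?_)
  rw [norm_mul, norm_signChar, one_mul]

lemma memLp_symmExt {f : (Fin n → ℝ) → ℂ} (hf : MemLp f 2 (wPlus lam)) :
    MemLp (symmExt η f) 2 (w lam) := by
  refine ⟨aestronglyMeasurable_w fun ε => ?_, (eLpNorm_w_le_sum lam _).trans_lt ?_⟩
  · exact (hf.1.const_mul (signChar η ε : ℂ)).congr (symmExt_signFlip_ae η f ε).symm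
  · refine ENNReal.sum_lt_top.2 fun ε _ => ?_
    rw [eLpNorm_symmExt_signFlip]
    exact hf.2

lemma aestronglyMeasurable_hankel (hlam : ∀ j, -1 / 2 < lam j) {f : (Fin n → ℝ) → ℂ}
    (h : GaussDecay lam f) : AEStronglyMeasurable (hankel lam η f) (wPlus lam) :=
  (Lp.aestronglyMeasurable _).congr (hankel_ae_eq hlam η h h.memLp).symm

lemma eLpNorm_hankel (hlam : ∀ j, -1 / 2 < lam j) {f : (Fin n → ℝ) → ℂ}
    (h : GaussDecay lam f) :
    eLpNorm (hankel lam η f) 2 (wPlus lam) = eLpNorm f 2 (wPlus lam) := by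
  rw [eLpNorm_congr_ae (hankel_ae_eq hlam η h h.memLp), ← Lp.enorm_def,
    ← ofReal_norm, norm_hankelL2, ofReal_norm, Lp.enorm_toLp]

lemma dunkl_signFlip (hlam : ∀ j, -1 / 2 < lam j) {f : (Fin n → ℝ) → ℂ}
    (hf : ∀ ε, GaussDecay lam fun x => f (signFlip ε x)) (ε' : Fin n → Fin 2) :
    (fun z => dunkl lam f (signFlip ε' z)) = ∑ ε, ∑ η,
      ((1 / 2 ^ n * (phase η * (signChar η ε : ℂ)) * (signChar η ε' : ℂ)) : ℂ) •
        hankel lam η (fun x => f (signFlip ε x)) := by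
  funext z
  rw [dunkl_eq_sum hlam hf, Finset.mul_sum, Finset.sum_apply]
  refine Finset.sum_congr rfl fun ε _ => ?_
  rw [Finset.mul_sum, Finset.sum_apply]
  refine Finset.sum_congr rfl fun η _ => ?_
  rw [hankel_signFlip, Pi.smul_apply, smul_eq_mul]
  ring

lemma aestronglyMeasurable_dunkl (hlam : ∀ j, -1 / 2 < lam j) {f : (Fin n → ℝ) → ℂ}
    (hf : ∀ ε, GaussDecay lam fun x => f (signFlip ε x)) :
    AEStronglyMeasurable (dunkl lam f) (w lam) := by
  refine aestronglyMeasurable_w fun ε' => ?_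
  rw [dunkl_signFlip hlam hf]
  exact Finset.aestronglyMeasurable_sum _ fun ε _ => Finset.aestronglyMeasurable_sum _ fun η _ =>
    (aestronglyMeasurable_hankel η hlam (hf ε)).const_smul _

/-- The constant `8^n` is crude. Only continuity is needed, to show that the extension from test
functions is unambiguous. -/
lemma exists_eLpNorm_dunkl_le (hlam : ∀ j, -1 / 2 < lam j) :
    ∃ C : ℝ≥0, ∀ f : (Fin n → ℝ) → ℂ, (∀ ε, GaussDecay lam fun x => f (signFlip ε x)) →
      eLpNorm (dunkl lam f) 2 (w lam) ≤ C * eLpNorm f 2 (w lam) := by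
  refine ⟨∑ _ : Fin n → Fin 2, ∑ _ : Fin n → Fin 2, ∑ _ : Fin n → Fin 2, 1, fun f hf => ?_⟩
  push_cast
  rw [Finset.sum_mul]
  refine (eLpNorm_w_le_sum lam _).trans (Finset.sum_le_sum fun ε' _ => ?_)
  rw [dunkl_signFlip hlam hf, Finset.sum_mul]
  refine (eLpNorm_sum_le (fun ε _ => Finset.aestronglyMeasurable_sum _ fun η _ =>
    (aestronglyMeasurable_hankel η hlam (hf ε)).const_smul _) (by norm_num)).trans
    (Finset.sum_le_sum fun ε _ => ?_)
  rw [Finset.sum_mul]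
  refine (eLpNorm_sum_le (fun η _ => (aestronglyMeasurable_hankel η hlam (hf ε)).const_smul _)
    (by norm_num)).trans (Finset.sum_le_sum fun η _ => ?_)
  rw [eLpNorm_const_smul, eLpNorm_hankel η hlam (hf ε)]
  gcongr
  · rw [← ofReal_norm]
    refine ENNReal.ofReal_le_one.2 ?_
    rw [norm_mul, norm_mul, norm_mul, norm_phase, norm_signChar, norm_signChar]
    simp only [mul_one]
    rw [norm_div, norm_pow]
    simp only [norm_one, Complex.norm_ofNat, one_div]
    exact inv_le_one_of_one_le₀ (one_le_pow₀ (by norm_num))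
  · exact eLpNorm_signFlip_le lam f ε

lemma hankel_sub (hlam : ∀ j, -1 / 2 < lam j) {f g : (Fin n → ℝ) → ℂ}
    (hf : GaussDecay lam f) (hg : GaussDecay lam g) (x : Fin n → ℝ) :
    hankel lam η (fun z => f z - g z) x = hankel lam η f x - hankel lam η g x := by
  unfold hankel
  rw [← integral_sub (hf.integrable_kernel_mul hlam η x) (hg.integrable_kernel_mul hlam η x)]
  exact integral_congr_ae (ae_of_all _ fun z => mul_sub _ _ _)

lemma GaussDecay.sub {f g : (Fin n → ℝ) → ℂ} (hf : GaussDecay lam f) (hg : GaussDecay lam g) :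
    GaussDecay lam fun z => f z - g z := by
  have hfm := hf.aestronglyMeasurable
  have hgm := hg.aestronglyMeasurable
  obtain ⟨t, ht, hf⟩ := hf
  obtain ⟨s, hs, hg⟩ := hg
  have key : ∀ (h : (Fin n → ℝ) → ℂ) (t s : ℝ), s ≤ t → AEStronglyMeasurable h (wPlus lam) →
      MemLp (fun z => (Real.exp (t * normSq z) : ℂ) * h z) 2 (wPlus lam) →
      MemLp (fun z => (Real.exp (s * normSq z) : ℂ) * h z) 2 (wPlus lam) := by
    intro h t s hst hm hh
    refine hh.of_le ((continuous_exp_normSq s).aestronglyMeasurable.mul hm)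
      (ae_of_all _ fun z => ?_)
    rw [norm_mul, norm_mul, norm_ofReal_exp, norm_ofReal_exp]
    have := normSq_nonneg z
    gcongr
  refine ⟨min t s, lt_min ht hs, ?_⟩
  have := (key f t _ (min_le_left t s) hfm hf).sub (key g s _ (min_le_right t s) hgm hg)
  exact (memLp_congr_ae (ae_of_all _ fun z => (mul_sub _ _ _).symm)).1 this

lemma dunkl_sub (hlam : ∀ j, -1 / 2 < lam j) {f g : (Fin n → ℝ) → ℂ}
    (hf : ∀ ε, GaussDecay lam fun x => f (signFlip ε x))
    (hg : ∀ ε, GaussDecay lam fun x => g (signFlip ε x)) :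
    dunkl lam (f - g) = dunkl lam f - dunkl lam g := by
  funext z
  rw [Pi.sub_apply, dunkl_eq_sum hlam hf, dunkl_eq_sum hlam hg,
    dunkl_eq_sum hlam (f := f - g) fun ε => (hf ε).sub (hg ε), ← mul_sub,
    ← Finset.sum_sub_distrib]
  congr 1
  refine Finset.sum_congr rfl fun ε _ => ?_
  rw [← Finset.sum_sub_distrib]
  refine Finset.sum_congr rfl fun η _ => ?_
  rw [← mul_sub, ← hankel_sub η hlam (hf ε) (hg ε)]
  rfl

lemma gaussDecay_of_hasCompactSupport (hlam : ∀ j, -1 / 2 < lam j) {f : (Fin n → ℝ) → ℂ}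
    (hf : Continuous f) (hc : HasCompactSupport f) : GaussDecay lam f := by
  have := isLocallyFiniteMeasure_wPlus hlam
  exact ⟨1, one_pos, ((continuous_exp_normSq 1).mul hf).memLp_of_hasCompactSupport hc.mul_left⟩

lemma gaussDecay_signFlip_of_hasCompactSupport (hlam : ∀ j, -1 / 2 < lam j)
    {f : (Fin n → ℝ) → ℂ} (hf : Continuous f) (hc : HasCompactSupport f) (ε : Fin n → Fin 2) :
    GaussDecay lam fun x => f (signFlip ε x) := by
  refine gaussDecay_of_hasCompactSupport hlam (hf.comp (continuous_signFlip ε)) ?_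
  let e : (Fin n → ℝ) ≃ₜ (Fin n → ℝ) :=
    { toFun := signFlip ε
      invFun := signFlip ε
      left_inv := signFlip_signFlip ε
      right_inv := signFlip_signFlip ε
      continuous_toFun := continuous_signFlip ε
      continuous_invFun := continuous_signFlip ε }
  exact hc.comp_homeomorph e

/-- Two approximating sequences of `f` differ by a null sequence in `L²`, hence so do their
transforms. This makes the choice in `dunklL2` irrelevant up to null sets. -/
lemma isDunklL2_unique (hlam : ∀ j, -1 / 2 < lam j) {f g g' : (Fin n → ℝ) → ℂ}
    (h : IsDunklL2 lam f g) (h' : IsDunklL2 lam f g') : g =ᵐ[w lam] g' := by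
  obtain ⟨hf, hg, u, hu, hu1, hu2⟩ := h
  obtain ⟨-, hg', v, hv, hv1, hv2⟩ := h'
  obtain ⟨C, hC⟩ := exists_eLpNorm_dunkl_le (n := n) hlam
  have gu := fun k => gaussDecay_signFlip_of_hasCompactSupport hlam (hu k).1.continuous (hu k).2
  have gv := fun k => gaussDecay_signFlip_of_hasCompactSupport hlam (hv k).1.continuous (hv k).2
  have hle : ∀ k, eLpNorm (g - g') 2 (w lam) ≤ (eLpNorm (dunkl lam (u k) - g) 2 (w lam) +
      C * (eLpNorm (u k - f) 2 (w lam) + eLpNorm (v k - f) 2 (w lam))) +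
      eLpNorm (dunkl lam (v k) - g') 2 (w lam) := by
    intro k
    have mu := aestronglyMeasurable_dunkl hlam (gu k)
    have mv := aestronglyMeasurable_dunkl hlam (gv k)
    have e1 : g - g' = ((g - dunkl lam (u k)) + (dunkl lam (u k) - dunkl lam (v k))) +
      (dunkl lam (v k) - g') := by ring
    rw [e1]
    refine (eLpNorm_add_le ((hg.1.sub mu).add (mu.sub mv)) (mv.sub hg'.1) (by norm_num)).trans ?_
    gcongr
    refine (eLpNorm_add_le (hg.1.sub mu) (mu.sub mv) (by norm_num)).trans ?_
    gcongr
    · rw [eLpNorm_sub_comm]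
    · rw [← dunkl_sub hlam (gu k) (gv k)]
      refine (hC _ fun ε => (gu k ε).sub (gv k ε)).trans ?_
      gcongr
      have e2 : u k - v k = (u k - f) + (f - v k) := by ring
      rw [e2, eLpNorm_sub_comm (v k) f]
      exact eLpNorm_add_le ((hu k).1.continuous.aestronglyMeasurable.sub hf.1)
        (hf.1.sub (hv k).1.continuous.aestronglyMeasurable) (by norm_num)
  have hlim : Tendsto (fun k => (eLpNorm (dunkl lam (u k) - g) 2 (w lam) +
      C * (eLpNorm (u k - f) 2 (w lam) + eLpNorm (v k - f) 2 (w lam))) +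
      eLpNorm (dunkl lam (v k) - g') 2 (w lam)) atTop (𝓝 0) := by
    have := (hu2.add (ENNReal.Tendsto.const_mul (a := (C : ℝ≥0∞)) (hu1.add hv1)
      (Or.inr ENNReal.coe_ne_top))).add hv2
    simpa using this
  have h0 : eLpNorm (g - g') 2 (w lam) = 0 := le_antisymm (ge_of_tendsto' hlim hle) (by positivity)
  rw [eLpNorm_eq_zero_iff (hg.1.sub hg'.1) (by norm_num)] at h0
  filter_upwards [h0] with x hx
  exact sub_eq_zero.1 hx

/-! ### Density of test functions -/

/-- Smooth functions with compact support in the orthant. -/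
def IsTest (g : (Fin n → ℝ) → ℂ) : Prop :=
  ContDiff ℝ ((⊤ : ℕ∞) : WithTop ℕ∞) g ∧ HasCompactSupport g ∧ tsupport g ⊆ orthant n

lemma IsTest.gaussDecay (hlam : ∀ j, -1 / 2 < lam j) {g : (Fin n → ℝ) → ℂ} (hg : IsTest g) :
    GaussDecay lam g :=
  gaussDecay_of_hasCompactSupport hlam hg.1.continuous hg.2.1

/-- A function in the orthogonal complement integrates to zero against all test functions in the
orthant and so vanishes almost everywhere there. Supports inside the orthant keep the symmetric
extension smooth. -/
lemma exists_isTest_eLpNorm_sub_lt (hlam : ∀ j, -1 / 2 < lam j) {f : (Fin n → ℝ) → ℂ}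
    (hf : MemLp f 2 (wPlus lam)) {δ : ℝ} (hδ : 0 < δ) :
    ∃ g, IsTest g ∧ eLpNorm (g - f) 2 (wPlus lam) ≤ ENNReal.ofReal δ := by
  have hloc := isLocallyFiniteMeasure_wPlus hlam
  let S : Submodule ℂ (Lp ℂ 2 (wPlus lam)) :=
    { carrier := {F | ∃ g, IsTest g ∧ F =ᵐ[wPlus lam] g}
      zero_mem' := ⟨0, ⟨contDiff_const, HasCompactSupport.zero, by simp⟩,
        Lp.coeFn_zero _ _ _⟩
      add_mem' := by
        rintro F G ⟨g, hg, hFg⟩ ⟨g', hg', hGg⟩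
        refine ⟨g + g', ⟨hg.1.add hg'.1, hg.2.1.add hg'.2.1,
          (tsupport_add g g').trans (Set.union_subset hg.2.2 hg'.2.2)⟩, ?_⟩
        exact (Lp.coeFn_add F G).trans (hFg.add hGg)
      smul_mem' := by
        rintro c F ⟨g, hg, hFg⟩
        refine ⟨c • g, ⟨hg.1.const_smul c, hg.2.1.mono (Function.support_const_smul_subset c g),
          (closure_mono (Function.support_const_smul_subset c g)).trans hg.2.2⟩, ?_⟩
        exact (Lp.coeFn_smul c F).trans (hFg.const_smul c) }
  have hdense : S.topologicalClosure = ⊤ := by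
    rw [Submodule.topologicalClosure_eq_top_iff, Submodule.eq_bot_iff]
    intro F hF
    rw [Submodule.mem_orthogonal] at hF
    have h1 := (isOpen_orthant n).ae_eq_zero_of_integral_contDiff_smul_eq_zero (μ := wPlus lam)
      (f := F) (((Lp.memLp F).locallyIntegrable (by norm_num)).locallyIntegrableOn _) ?_
    · refine (Lp.eq_zero_iff_ae_eq_zero).2 ?_
      filter_upwards [h1, ae_mem_orthant lam] with x hx hx'
      exact hx hx'
    · intro g hg hgc hgs
      have hmem : MemLp (fun x => (g x : ℂ)) 2 (wPlus lam) :=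
        (hg.continuous.memLp_of_hasCompactSupport hgc).ofReal
      have hsupp : Function.support (fun x => (g x : ℂ)) ⊆ Function.support g := by
        intro x hx hx0
        exact hx (by simp [hx0])
      have := hF (hmem.toLp _) ⟨fun x => (g x : ℂ), ⟨Complex.ofRealCLM.contDiff.comp hg,
        hgc.mono hsupp, (closure_mono hsupp).trans hgs⟩, hmem.coeFn_toLp⟩
      rw [inner_toLp_ofReal] at this
      rw [← this]
      exact integral_congr_ae (ae_of_all _ fun x => Complex.real_smul)
  have hmem : hf.toLp f ∈ closure (S : Set (Lp ℂ 2 (wPlus lam))) := by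
    rw [← Submodule.topologicalClosure_coe, hdense]; trivial
  obtain ⟨G, ⟨g, hg, hGg⟩, hdist⟩ := Metric.mem_closure_iff.1 hmem δ hδ
  refine ⟨g, hg, ?_⟩
  rw [dist_comm, dist_eq_norm, Lp.norm_def] at hdist
  have h2 : eLpNorm (g - f) 2 (wPlus lam) = eLpNorm (G - hf.toLp f : Lp ℂ 2 (wPlus lam)) 2
      (wPlus lam) := by
    refine eLpNorm_congr_ae ?_
    filter_upwards [Lp.coeFn_sub G (hf.toLp f), hGg, hf.coeFn_toLp] with x h1 h2 h3
    rw [h1, Pi.sub_apply, Pi.sub_apply, h2, h3]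
  rw [h2]
  exact (ENNReal.le_ofReal_iff_toReal_le (Lp.eLpNorm_ne_top _) hδ.le).2 hdist.le

/-- `g` vanishes off the orthant, so at most one reflection contributes, and none on the
hyperplanes. -/
lemma symmExt_eq_sum {g : (Fin n → ℝ) → ℂ} (hg : tsupport g ⊆ orthant n) (x : Fin n → ℝ) :
    symmExt η g x = ∑ ε, (signChar η ε : ℂ) * g (signFlip ε x) := by
  have h0 : ∀ y, y ∉ orthant n → g y = 0 := fun y hy =>
    image_eq_zero_of_notMem_tsupport fun h => hy (hg h)
  by_cases hx : ∀ j, x j ≠ 0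
  · obtain ⟨ε, hε⟩ := exists_signFlip_mem_orthant hx
    rw [Finset.sum_eq_single ε]
    · have := symmExt_signFlip η g ε hε
      rwa [signFlip_signFlip] at this
    · intro ε' _ hne
      rw [h0 _ fun h => hne (signFlip_mem_orthant_unique h hε), mul_zero]
    · simp
  · unfold symmExt
    rw [if_neg hx]
    push Not at hx
    obtain ⟨j, hj⟩ := hx
    refine (Finset.sum_eq_zero fun ε _ => ?_).symm
    rw [h0 _ fun h => ?_, mul_zero]
    have := h j
    simp [signFlip, hj] at this

lemma IsTest.contDiff_symmExt {g : (Fin n → ℝ) → ℂ} (hg : IsTest g) :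
    ContDiff ℝ ((⊤ : ℕ∞) : WithTop ℕ∞) (symmExt η g) := by
  have : symmExt η g = fun x => ∑ ε, (signChar η ε : ℂ) * g (signFlip ε x) :=
    funext (symmExt_eq_sum η hg.2.2)
  rw [this]
  exact ContDiff.sum fun ε _ => contDiff_const.mul (hg.1.comp (contDiff_signFlip ε))

lemma IsTest.hasCompactSupport_symmExt {g : (Fin n → ℝ) → ℂ} (hg : IsTest g) :
    HasCompactSupport (symmExt η g) := by
  refine HasCompactSupport.intro (K := ⋃ ε, signFlip ε '' tsupport g)
    (isCompact_iUnion fun ε => IsCompact.image hg.2.1 (continuous_signFlip ε)) fun x hx => ?_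
  rw [symmExt_eq_sum η hg.2.2]
  refine Finset.sum_eq_zero fun ε _ => ?_
  have : g (signFlip ε x) = 0 := image_eq_zero_of_notMem_tsupport fun h =>
    hx (Set.mem_iUnion.2 ⟨ε, signFlip ε x, h, signFlip_signFlip ε x⟩)
  rw [this, mul_zero]

/-! ### The `L²` Dunkl transform of symmetric functions -/

/-- The approximants are symmetric extensions of test functions `v k → f`. On each reflected orthant
both errors have exactly the norm of `v k - f`, the second one because `H_η` is isometric. -/
lemma isDunklL2_symmExt (hlam : ∀ j, -1 / 2 < lam j) {f : (Fin n → ℝ) → ℂ}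
    (hf : MemLp f 2 (wPlus lam)) :
    IsDunklL2 lam (symmExt η f)
      (fun z => phase η * symmExt η (hankelL2 hlam η (hf.toLp f)) z) := by
  have hδ : ∀ k : ℕ, (0 : ℝ) < 1 / ((k : ℝ) + 1) := fun k => by positivity
  choose v hv hvle using fun k => exists_isTest_eLpNorm_sub_lt hlam hf (hδ k)
  have hlim : Tendsto (fun k => eLpNorm (v k - f) 2 (wPlus lam)) atTop (𝓝 0) := by
    have h1 : Tendsto (fun k : ℕ => ENNReal.ofReal (1 / ((k : ℝ) + 1))) atTop (𝓝 0) := by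
      have := ENNReal.tendsto_ofReal tendsto_one_div_add_atTop_nhds_zero_nat
      simpa using this
    exact tendsto_of_tendsto_of_tendsto_of_le_of_le tendsto_const_nhds h1
      (fun _ => by positivity) hvle
  have hlim2 : Tendsto (fun k => ∑ _ε : Fin n → Fin 2, eLpNorm (v k - f) 2 (wPlus lam)) atTop
      (𝓝 0) := by
    have := tendsto_finsetSum (Finset.univ : Finset (Fin n → Fin 2)) fun _ _ => hlim
    simpa using this
  refine ⟨memLp_symmExt η hf, (memLp_symmExt η (Lp.memLp _)).const_mul _,
    fun k => symmExt η (v k),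
    fun k => ⟨(hv k).contDiff_symmExt η, (hv k).hasCompactSupport_symmExt η⟩, ?_, ?_⟩
  · refine tendsto_of_tendsto_of_tendsto_of_le_of_le tendsto_const_nhds hlim2
      (fun _ => by positivity) fun k => ?_
    refine (eLpNorm_w_le_sum lam _).trans (Finset.sum_le_sum fun ε _ => le_of_eq ?_)
    refine eLpNorm_congr_norm_ae ?_
    filter_upwards [ae_mem_orthant lam] with x hx
    rw [Pi.sub_apply, symmExt_signFlip η _ ε hx, symmExt_signFlip η _ ε hx, ← mul_sub, norm_mul,
      norm_signChar, one_mul, Pi.sub_apply]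
  · refine tendsto_of_tendsto_of_tendsto_of_le_of_le tendsto_const_nhds hlim2
      (fun _ => by positivity) fun k => ?_
    have gv := (hv k).gaussDecay (lam := lam) hlam
    refine (eLpNorm_w_le_sum lam _).trans (Finset.sum_le_sum fun ε _ => le_of_eq ?_)
    have h1 : eLpNorm (v k - f) 2 (wPlus lam) =
        eLpNorm (hankelL2 hlam η (gv.memLp.toLp _ - hf.toLp f) : Lp ℂ 2 (wPlus lam)) 2
          (wPlus lam) := by
      rw [← Lp.enorm_def, ← ofReal_norm, norm_hankelL2, ofReal_norm,
        ← MemLp.toLp_sub, Lp.enorm_toLp]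
    rw [h1]
    refine eLpNorm_congr_norm_ae ?_
    rw [map_sub]
    filter_upwards [ae_mem_orthant lam, hankel_ae_eq hlam η gv gv.memLp,
      Lp.coeFn_sub (hankelL2 hlam η (gv.memLp.toLp _)) (hankelL2 hlam η (hf.toLp f))]
      with x hx h2 h3
    rw [h3, Pi.sub_apply, Pi.sub_apply, symmExt_signFlip η _ ε hx, dunkl_symmExt η hlam gv,
      hankel_signFlip, h2, ← mul_sub, ← mul_sub, norm_mul, norm_mul, norm_phase, norm_signChar,
      one_mul, one_mul]

theorem dunklL2_symmExt (hlam : ∀ j, -1 / 2 < lam j) {f : (Fin n → ℝ) → ℂ}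
    (hf : MemLp f 2 (wPlus lam)) :
    dunklL2 lam (symmExt η f) =ᵐ[w lam]
      fun z => phase η * symmExt η (hankelL2 hlam η (hf.toLp f)) z := by
  have hex : ∃ g, IsDunklL2 lam (symmExt η f) g := ⟨_, isDunklL2_symmExt η hlam hf⟩
  unfold dunklL2
  rw [dif_pos hex]
  exact isDunklL2_unique hlam hex.choose_spec (isDunklL2_symmExt η hlam hf)

/-- The closure relation sees `f` only up to null sets, and a choice from the same predicate is the
same function, whence equality at every point. -/
lemma dunklL2_congr_ae {f f' : (Fin n → ℝ) → ℂ} (h : f =ᵐ[w lam] f') :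
    dunklL2 lam f = dunklL2 lam f' := by
  have : IsDunklL2 lam f = IsDunklL2 lam f' := by
    funext g
    refine propext ?_
    unfold IsDunklL2
    rw [memLp_congr_ae h]
    have h2 : ∀ u : (Fin n → ℝ) → ℂ, eLpNorm (u - f) 2 (w lam) = eLpNorm (u - f') 2 (w lam) :=
      fun u => eLpNorm_congr_ae ((EventuallyEq.refl _ u).sub h)
    simp_rw [h2]
  have key : ∀ P Q : ((Fin n → ℝ) → ℂ) → Prop, P = Q →
      (open Classical in if h : ∃ g, P g then h.choose else 0) =
        (open Classical in if h : ∃ g, Q g then h.choose else 0) := by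
    rintro P _ rfl; rfl
  exact key _ _ this

lemma mul_dunklL2_symmExt_ae (hlam : ∀ j, -1 / 2 < lam j) {f : (Fin n → ℝ) → ℂ}
    (hf : MemLp f 2 (wPlus lam)) {p : (Fin n → ℝ) → ℂ} (hp : ∀ ε z, p (signFlip ε z) = p z) :
    (fun z => p z * dunklL2 lam (symmExt η f) z) =ᵐ[w lam]
      symmExt η (fun z => phase η * (p z * hankelL2 hlam η (hf.toLp f) z)) := by
  refine ae_w_of_signFlip fun ε => ?_
  filter_upwards [ae_signFlip (dunklL2_symmExt η hlam hf) ε, ae_mem_orthant lam] with z hz hz'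
  rw [hz, hp, symmExt_signFlip η _ ε hz', symmExt_signFlip η _ ε hz']
  ring

/-- The integral inverse transform of an even multiple of `D_λ f^η`. -/
theorem dunklInv_mul_dunklL2 (hlam : ∀ j, -1 / 2 < lam j) {f : (Fin n → ℝ) → ℂ}
    (hf : MemLp f 2 (wPlus lam)) {p : (Fin n → ℝ) → ℂ} (hp : ∀ ε z, p (signFlip ε z) = p z)
    (hd : GaussDecay lam fun z => p z * hankelL2 hlam η (hf.toLp f) z) (x : Fin n → ℝ) :
    dunklInv lam (fun z => p z * dunklL2 lam (symmExt η f) z) x =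
      hankel lam η (fun z => p z * hankelL2 hlam η (hf.toLp f) z) x := by
  unfold dunklInv
  have h1 : dunkl lam (fun z => p z * dunklL2 lam (symmExt η f) z) (-x) =
      dunkl lam (symmExt η (fun z => phase η * (p z * hankelL2 hlam η (hf.toLp f) z))) (-x) := by
    unfold dunkl
    congr 1
    refine integral_congr_ae ?_
    filter_upwards [mul_dunklL2_symmExt_ae η hlam hf hp] with z hz
    rw [hz]
  rw [h1, dunkl_symmExt η hlam (hd.const_mul _), hankel_const_mul, neg_eq_signFlip,
    hankel_signFlip]
  linear_combination (hankel lam η (fun z => p z * hankelL2 hlam η (hf.toLp f) z) x) *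
    phase_mul_phase_mul_signChar η

/-- The spectral multiplier operators in terms of the Hankel transform. -/
theorem multiplierOp_ae_eq (hlam : ∀ j, -1 / 2 < lam j) {f : (Fin n → ℝ) → ℂ}
    (hf : MemLp f 2 (wPlus lam)) {p : (Fin n → ℝ) → ℂ} (hp : ∀ ε z, p (signFlip ε z) = p z)
    (hd : MemLp (fun z => p z * hankelL2 hlam η (hf.toLp f) z) 2 (wPlus lam)) :
    multiplierOp lam η p f =ᵐ[wPlus lam] hankelL2 hlam η (hd.toLp _) := by
  have hd' : MemLp (fun z => phase η * (p z * hankelL2 hlam η (hf.toLp f) z)) 2 (wPlus lam) :=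
    hd.const_mul _
  have h1 := ae_signFlip (dunklL2_symmExt η hlam hd') (fun _ => 1)
  have h2 : hd'.toLp _ = phase η • hd.toLp _ := rfl
  rw [h2, map_smul] at h1
  unfold multiplierOp dunklInvL2
  rw [dunklL2_congr_ae (mul_dunklL2_symmExt_ae η hlam hf hp)]
  filter_upwards [h1, ae_mem_orthant lam,
    Lp.coeFn_smul (phase η) (hankelL2 hlam η (hd.toLp _))] with x hx hx' hs
  rw [neg_eq_signFlip, hx, symmExt_signFlip η _ _ hx', hs, Pi.smul_apply, smul_eq_mul]
  linear_combination (hankelL2 hlam η (hd.toLp _) x) * phase_mul_phase_mul_signChar η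

end
end DunklBessel
end

noncomputable section

namespace DunklBessel

/-! ### Spectral multipliers -/

lemma exists_mulCLM {n : ℕ} {μ : Measure (Fin n → ℝ)} {m : (Fin n → ℝ) → ℂ}
    (hm : AEStronglyMeasurable m μ) {C : ℝ} (hC : ∀ᵐ z ∂μ, ‖m z‖ ≤ C) :
    ∃ T : Lp ℂ 2 μ →L[ℂ] Lp ℂ 2 μ, ∀ F : Lp ℂ 2 μ, T F =ᵐ[μ] fun z => m z * F z := by
  have hmem : ∀ F : Lp ℂ 2 μ, MemLp (fun z => m z * F z) 2 μ := fun F =>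
    (Lp.memLp F).of_le_mul (c := C) (hm.mul (Lp.aestronglyMeasurable F)) (by
      filter_upwards [hC] with z hz
      rw [norm_mul]
      gcongr)
  let L : Lp ℂ 2 μ →ₗ[ℂ] Lp ℂ 2 μ :=
    { toFun := fun F => (hmem F).toLp _
      map_add' := fun F G => by
        rw [← MemLp.toLp_add]
        refine MemLp.toLp_congr _ _ ?_
        filter_upwards [Lp.coeFn_add F G] with z hz
        rw [hz, Pi.add_apply, Pi.add_apply, mul_add]
      map_smul' := fun c F => by
        rw [RingHom.id_apply, ← MemLp.toLp_const_smul]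
        refine MemLp.toLp_congr _ _ ?_
        filter_upwards [Lp.coeFn_smul c F] with z hz
        rw [hz, Pi.smul_apply, Pi.smul_apply, smul_eq_mul, smul_eq_mul, mul_left_comm] }
  refine ⟨L.mkContinuous C fun F => ?_, fun F => (hmem F).coeFn_toLp⟩
  refine Lp.norm_le_mul_norm_of_ae_le_mul ?_
  filter_upwards [hC, (hmem F).coeFn_toLp] with z hz hz'
  change ‖((hmem F).toLp _ : (Fin n → ℝ) → ℂ) z‖ ≤ _
  rw [hz', norm_mul]
  gcongr

/-- Invariance of the symbol under sign changes preserves the symmetry type, so the operator is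
`H_η` after multiplication after `H_η`. -/
theorem linearBoundedL2_multiplierOp {n : ℕ} {lam : Fin n → ℝ} (hlam : ∀ j, -1 / 2 < lam j)
    (η : Fin n → Fin 2) {m : (Fin n → ℝ) → ℂ} (hm : AEStronglyMeasurable m (wPlus lam)) {C : ℝ}
    (hC : ∀ᵐ z ∂(wPlus lam), ‖m z‖ ≤ C) (hp : ∀ ε z, m (signFlip ε z) = m z) :
    LinearBoundedL2 lam (multiplierOp lam η m) := by
  obtain ⟨T, hT⟩ := exists_mulCLM hm hC
  refine ⟨(hankelL2 hlam η).comp (T.comp (hankelL2 hlam η)), fun f hf => ?_⟩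
  have h1 := hT (hankelL2 hlam η (hf.toLp f))
  have hd : MemLp (fun z => m z * hankelL2 hlam η (hf.toLp f) z) 2 (wPlus lam) :=
    (memLp_congr_ae h1).1 (Lp.memLp _)
  have h2 : hd.toLp _ = T (hankelL2 hlam η (hf.toLp f)) :=
    (MemLp.toLp_congr hd (Lp.memLp _) h1.symm).trans (Lp.toLp_coeFn _ _)
  have h3 := multiplierOp_ae_eq η hlam hf hp hd
  rw [h2] at h3
  exact h3.symm

lemma aestronglyMeasurable_laplaceSymbol {n : ℕ} {Φ : ℝ → ℂ}
    (hΦ : AEStronglyMeasurable Φ (volume.restrict (Set.Ioi 0))) (μ : Measure (Fin n → ℝ))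
    [SFinite μ] : AEStronglyMeasurable (laplaceSymbol (n := n) Φ) μ := by
  unfold laplaceSymbol
  have hN : Continuous fun z : Fin n → ℝ => (normSq z : ℂ) :=
    Complex.continuous_ofReal.comp continuous_normSq
  refine hN.aestronglyMeasurable.mul ?_
  have h1 : Continuous fun p : (Fin n → ℝ) × ℝ => (Real.exp (-p.2 * normSq p.1) : ℂ) := by
    have := (continuous_normSq (n := n)).comp (continuous_fst (X := Fin n → ℝ) (Y := ℝ))
    exact Complex.continuous_ofReal.comp (Real.continuous_exp.comp (continuous_snd.neg.mul this))
  exact (h1.aestronglyMeasurable.mul hΦ.comp_snd).integral_prod_right'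

lemma integral_exp_neg_mul_Ioi {r : ℝ} (hr : 0 < r) :
    ∫ t in Set.Ioi (0 : ℝ), Real.exp (-t * r) = 1 / r := by
  have := Real.integral_rpow_mul_exp_neg_mul_Ioi one_pos hr
  simp only [sub_self, Real.rpow_zero, one_mul, Real.rpow_one, Real.Gamma_one, mul_one] at this
  rw [← this]
  refine integral_congr_ae (ae_of_all _ fun t => ?_)
  simp only
  ring_nf

lemma norm_laplaceSymbol_le {n : ℕ} {Φ : ℝ → ℂ} (hΦ : MemLp Φ ∞ (volume.restrict (Set.Ioi 0)))
    (z : Fin n → ℝ) :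
    ‖laplaceSymbol Φ z‖ ≤ (eLpNorm Φ ∞ (volume.restrict (Set.Ioi 0))).toReal := by
  unfold laplaceSymbol
  rcases (normSq_nonneg z).eq_or_lt with h0 | h0
  · rw [← h0]; simp
  · have hb : ∀ᵐ t ∂(volume.restrict (Set.Ioi (0 : ℝ))),
        ‖Φ t‖ ≤ (eLpNorm Φ ∞ (volume.restrict (Set.Ioi 0))).toReal := by
      have h1 := ae_le_eLpNormEssSup (f := Φ) (μ := volume.restrict (Set.Ioi (0 : ℝ)))
      filter_upwards [h1] with t ht
      rw [eLpNorm_exponent_top, ← toReal_enorm]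
      refine ENNReal.toReal_mono ?_ ht
      rw [← eLpNorm_exponent_top]; exact hΦ.2.ne
    set S := (eLpNorm Φ ∞ (volume.restrict (Set.Ioi (0 : ℝ)))).toReal
    -- The integral of a non-integrable function is `0` by convention, while here it is `1/|z|²`.
    have hexp : Integrable (fun t => Real.exp (-t * normSq z)) (volume.restrict (Set.Ioi 0)) := by
      by_contra hcon
      have h1 := integral_exp_neg_mul_Ioi h0
      rw [integral_undef hcon] at h1
      exact (one_div_pos.2 h0).ne h1
    have h2 : ‖∫ t in Set.Ioi (0 : ℝ), (Real.exp (-t * normSq z) : ℂ) * Φ t‖ ≤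
        ∫ t in Set.Ioi (0 : ℝ), Real.exp (-t * normSq z) * S := by
      refine norm_integral_le_of_norm_le (hexp.mul_const _) ?_
      filter_upwards [hb] with t ht
      rw [norm_mul, norm_ofReal_exp]
      gcongr
    rw [integral_mul_const, integral_exp_neg_mul_Ioi h0] at h2
    rw [norm_mul, Complex.norm_real, Real.norm_of_nonneg h0.le]
    calc _ ≤ normSq z * (1 / normSq z * S) := by gcongr
      _ = S := by field_simp

theorem linearBoundedL2_laplace {n : ℕ} {lam : Fin n → ℝ} (hlam : ∀ j, -1 / 2 < lam j)
    (η : Fin n → Fin 2) {Φ : ℝ → ℂ} (hΦ : MemLp Φ ∞ (volume.restrict (Set.Ioi 0))) :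
    LinearBoundedL2 lam (multiplierOp lam η (laplaceSymbol Φ)) :=
  linearBoundedL2_multiplierOp hlam η (aestronglyMeasurable_laplaceSymbol hΦ.1 _)
    (ae_of_all _ (norm_laplaceSymbol_le hΦ)) fun ε z => by
      unfold laplaceSymbol; rw [normSq_signFlip]

/-- The variation is dominated by the total variations of the real and imaginary parts, which are
finite. -/
lemma isFiniteMeasure_variation_complexMeasure {X : Type*} {_ : MeasurableSpace X}
    (ν : ComplexMeasure X) : IsFiniteMeasure ν.variation := by
  have hle : ν.variation ≤ (ComplexMeasure.re ν).totalVariation +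
      (ComplexMeasure.im ν).totalVariation := by
    refine VectorMeasure.variation_le_of_forall_enorm_le fun E _ => ?_
    have h1 : ν E = ((ComplexMeasure.re ν E : ℝ) : ℂ) +
        ((ComplexMeasure.im ν E : ℝ) : ℂ) * Complex.I :=
      (Complex.re_add_im (ν E)).symm
    rw [h1, Measure.add_apply]
    refine (enorm_add_le _ _).trans (add_le_add ?_ ?_)
    · refine le_trans (le_of_eq ?_) (SignedMeasure.enorm_le_totalVariation _ E)
      rw [← ofReal_norm, Complex.norm_real, ofReal_norm]
    · refine le_trans (le_of_eq ?_) (SignedMeasure.enorm_le_totalVariation _ E)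
      rw [← ofReal_norm, norm_mul, Complex.norm_real, Complex.norm_I, mul_one, ofReal_norm]
  exact isFiniteMeasure_of_le _ hle

theorem linearBoundedL2_laplaceStieltjes {n : ℕ} {lam : Fin n → ℝ} (hlam : ∀ j, -1 / 2 < lam j)
    (η : Fin n → Fin 2) (ν : ComplexMeasure (Set.Ioi (0 : ℝ))) :
    LinearBoundedL2 lam (multiplierOp lam η (laplaceStieltjesSymbol ν)) := by
  have hfin := isFiniteMeasure_variation_complexMeasure ν
  have hb : ∀ (z : Fin n → ℝ) (t : Set.Ioi (0 : ℝ)),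
      ‖Real.exp (-(t : ℝ) * normSq z)‖ ≤ 1 := fun z t => by
    rw [Real.norm_of_nonneg (Real.exp_pos _).le, Real.exp_le_one_iff]
    have h1 := normSq_nonneg z
    have h2 : (0 : ℝ) < t := t.2
    nlinarith
  have hcont : Continuous (laplaceStieltjesSymbol (n := n) ν) := by
    unfold laplaceStieltjesSymbol
    refine VectorMeasure.continuous_of_dominated (bound := fun _ => 1) (fun z => ?_)
      (fun z => ae_of_all _ fun t => hb z t) (integrable_const _) (ae_of_all _ fun t => ?_)
    · refine Measurable.aestronglyMeasurable ?_
      fun_prop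
    · have := continuous_normSq (n := n)
      fun_prop
  refine linearBoundedL2_multiplierOp hlam η hcont.aestronglyMeasurable (ae_of_all _ fun z =>
    VectorMeasure.norm_integral_le_of_norm_le_const (ae_of_all _ fun t => hb z t)) fun ε z => by
      unfold laplaceStieltjesSymbol; rw [normSq_signFlip]

end DunklBessel
end

noncomputable section

namespace DunklBessel

/-! ### Derivatives of Hankel transforms -/

section
variable {n : ℕ} {lam : Fin n → ℝ} {η : Fin n → Fin 2}

lemma GaussDecay.continuous_mul {f p : (Fin n → ℝ) → ℂ} (h : GaussDecay lam f) (hp : Continuous p)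
    (hle : ∀ s > 0, ∃ C, ∀ z, ‖p z‖ ≤ C * Real.exp (s * normSq z)) :
    GaussDecay lam fun z => p z * f z := by
  refine h.mono (hp.aestronglyMeasurable.mul h.aestronglyMeasurable) fun s hs => ?_
  obtain ⟨C, hC⟩ := hle s hs
  refine ⟨C, ae_of_all _ fun z => ?_⟩
  rw [norm_mul]
  gcongr
  exact hC z

lemma normSq_le_exp {s : ℝ} (hs : 0 < s) (z : Fin n → ℝ) :
    normSq z ≤ 1 / s * Real.exp (s * normSq z) := by
  have := Real.add_one_le_exp (s * normSq z)
  rw [one_div, inv_mul_eq_div, le_div_iff₀ hs]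
  linarith

lemma sq_le_normSq (z : Fin n → ℝ) (j : Fin n) : z j ^ 2 ≤ normSq z :=
  Finset.single_le_sum (f := fun j => z j ^ 2) (fun _ _ => sq_nonneg _) (Finset.mem_univ j)

lemma abs_coord_le_exp {s : ℝ} (hs : 0 < s) (z : Fin n → ℝ) (j : Fin n) :
    |z j| ≤ (1 + 1 / s) * Real.exp (s * normSq z) := by
  have h1 := normSq_le_exp hs z
  have h2 := sq_le_normSq z j
  have h3 : 1 ≤ Real.exp (s * normSq z) := Real.one_le_exp (by have := normSq_nonneg z; positivity)
  have h4 : |z j| ≤ 1 + z j ^ 2 := by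
    rw [← sq_abs]; nlinarith [sq_nonneg (|z j| - 1), abs_nonneg (z j)]
  linarith

lemma GaussDecay.coord_mul {f : (Fin n → ℝ) → ℂ} (h : GaussDecay lam f) (j : Fin n) :
    GaussDecay lam fun z => (z j : ℂ) * f z :=
  h.continuous_mul (Complex.continuous_ofReal.comp (continuous_apply j)) fun s hs =>
    ⟨_, fun z => by rw [Complex.norm_real]; exact abs_coord_le_exp hs z j⟩

lemma GaussDecay.normSq_mul {f : (Fin n → ℝ) → ℂ} (h : GaussDecay lam f) :
    GaussDecay lam fun z => (normSq z : ℂ) * f z :=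
  h.continuous_mul (Complex.continuous_ofReal.comp continuous_normSq) fun s hs =>
    ⟨_, fun z => by
      rw [Complex.norm_real, Real.norm_of_nonneg (normSq_nonneg z)]; exact normSq_le_exp hs z⟩

lemma GaussDecay.coord_pow_mul {f : (Fin n → ℝ) → ℂ} (h : GaussDecay lam f) (j : Fin n) (m : ℕ) :
    GaussDecay lam fun z => (z j : ℂ) ^ m * f z := by
  induction m with
  | zero => simpa using h
  | succ m ih =>
    refine (ih.coord_mul j).congr (ae_of_all _ fun z => ?_)
    simp only; ring

lemma GaussDecay.normSq_pow_mul {f : (Fin n → ℝ) → ℂ} (h : GaussDecay lam f) (m : ℕ) :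
    GaussDecay lam fun z => (-(normSq z : ℂ)) ^ m * f z := by
  induction m with
  | zero => simpa using h
  | succ m ih =>
    refine (ih.normSq_mul.const_mul (-1)).congr (ae_of_all _ fun z => ?_)
    simp only; ring

lemma hankelKernel_update (η : Fin n → Fin 2) (x z : Fin n → ℝ) (j : Fin n) (e : Fin 2) (s : ℝ) :
    hankelKernel lam (Function.update η j e) (Function.update x j s) z =
      (s * z j) ^ (e : ℕ) * besselPhi (lam j + (e : ℕ)) (s * z j) *
        ∏ i ∈ Finset.univ.erase j,
          (x i * z i) ^ (η i : ℕ) * besselPhi (lam i + (η i : ℕ)) (x i * z i) := by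
  unfold hankelKernel
  rw [← Finset.mul_prod_erase _ _ (Finset.mem_univ j), Function.update_self, Function.update_self]
  congr 1
  refine Finset.prod_congr rfl fun i hi => ?_
  have := Finset.ne_of_mem_erase hi
  rw [Function.update_of_ne this, Function.update_of_ne this]

lemma hankelKernel_update_right (x z : Fin n → ℝ) (j : Fin n) (s : ℝ) :
    hankelKernel lam η (Function.update x j s) z =
      (s * z j) ^ (η j : ℕ) * besselPhi (lam j + (η j : ℕ)) (s * z j) *
        ∏ i ∈ Finset.univ.erase j,
          (x i * z i) ^ (η i : ℕ) * besselPhi (lam i + (η i : ℕ)) (x i * z i) := by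
  have := hankelKernel_update (lam := lam) η x z j (η j) s
  rwa [Function.update_eq_self] at this

/-- From `φ_a' = -u φ_{a+1}`: an even factor of order `λ_j` becomes an odd one of order `λ_j + 1`.
-/
lemma hasDerivAt_hankelKernel_zero (hlam : ∀ j, -1 / 2 < lam j) {j : Fin n} (hη : η j = 0)
    (x z : Fin n → ℝ) (s : ℝ) :
    HasDerivAt (fun s => hankelKernel lam η (Function.update x j s) z)
      (-z j * hankelKernel lam (Function.update η j 1) (Function.update x j s) z) s := by
  simp_rw [hankelKernel_update, hankelKernel_update_right, hη]
  have h1 : HasDerivAt (fun s => s * z j) (z j) s := by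
    simpa using (hasDerivAt_id s).mul_const (z j)
  have h2 := (hasDerivAt_besselPhi (hlam j) (s * z j)).comp s h1
  have h3 := h2.mul_const (∏ i ∈ Finset.univ.erase j,
          (x i * z i) ^ (η i : ℕ) * besselPhi (lam i + (η i : ℕ)) (x i * z i))
  convert! h3 using 1
  · funext s; simp
  · simp; ring

/-- From `(u φ_{a+1})' + 2a φ_{a+1} = φ_a`. The subtracted term is exactly what the zero order part
of `δ_j^*` restores. -/
lemma hasDerivAt_hankelKernel_one (hlam : ∀ j, -1 / 2 < lam j) {j : Fin n} (hη : η j = 1)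
    (x z : Fin n → ℝ) {s : ℝ} (hs : s ≠ 0) :
    HasDerivAt (fun s => hankelKernel lam η (Function.update x j s) z)
      (z j * hankelKernel lam (Function.update η j 0) (Function.update x j s) z -
        2 * lam j / s * hankelKernel lam η (Function.update x j s) z) s := by
  simp_rw [hankelKernel_update, hankelKernel_update_right, hη]
  have h1 : HasDerivAt (fun s => s * z j) (z j) s := by
    simpa using (hasDerivAt_id s).mul_const (z j)
  have h2 := (hasDerivAt_mul_besselPhi (hlam j) (s * z j)).comp s h1
  have h3 := h2.mul_const (∏ i ∈ Finset.univ.erase j,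
          (x i * z i) ^ (η i : ℕ) * besselPhi (lam i + (η i : ℕ)) (x i * z i))
  convert! h3 using 1
  · funext s; simp
  · simp; field_simp

lemma normSq_update_le (x : Fin n → ℝ) (j : Fin n) {s b : ℝ} (hs : |s| ≤ b) :
    normSq (Function.update x j s) ≤ normSq x + b ^ 2 := by
  unfold normSq
  rw [← Finset.add_sum_erase _ _ (Finset.mem_univ j),
    ← Finset.add_sum_erase (a := j) Finset.univ (fun j => x j ^ 2) (Finset.mem_univ j),
    Function.update_self]
  have h1 : ∑ i ∈ Finset.univ.erase j, Function.update x j s i ^ 2 =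
      ∑ i ∈ Finset.univ.erase j, x i ^ 2 :=
    Finset.sum_congr rfl fun i hi => by rw [Function.update_of_ne (Finset.ne_of_mem_erase hi)]
  rw [h1]
  have h2 : s ^ 2 ≤ b ^ 2 := sq_le_sq' (abs_le.1 hs).1 (abs_le.1 hs).2
  have h3 := sq_nonneg (x j)
  linarith

/-- A locally uniform bound for the Hankel kernel against a function with Gaussian decay. -/
lemma GaussDecay.exists_bound (hlam : ∀ j, -1 / 2 < lam j) (η : Fin n → Fin 2)
    {f : (Fin n → ℝ) → ℂ} (h : GaussDecay lam f) (R : ℝ) :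
    ∃ b : (Fin n → ℝ) → ℝ, Integrable b (wPlus lam) ∧ ∀ y z, normSq y ≤ R →
      ‖(hankelKernel lam η y z : ℂ) * f z‖ ≤ b z := by
  obtain ⟨τ, hτ, hint⟩ := h.exists_integrable hlam
  obtain ⟨C, hC, hE⟩ := abs_hankelKernel_le η hlam
  refine ⟨_, hint.const_mul (C * Real.exp (9 / (4 * τ) * R)), fun y z hy => ?_⟩
  rw [norm_mul, Complex.norm_real, Real.norm_eq_abs]
  calc _ ≤ C * Real.exp (9 / (4 * τ) * normSq y + τ * normSq z) * ‖f z‖ := by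
        gcongr; exact hE τ hτ y z
    _ ≤ C * Real.exp (9 / (4 * τ) * R + τ * normSq z) * ‖f z‖ := by gcongr
    _ = _ := by rw [Real.exp_add]; ring

lemma update_mem_orthant {x : Fin n → ℝ} (hx : x ∈ orthant n) (j : Fin n) {s : ℝ} (hs : 0 < s) :
    Function.update x j s ∈ orthant n := by
  intro i
  by_cases h : i = j
  · subst h; simpa using hs
  · simpa [h] using hx i

/-- `F` agrees on the orthant with the Hankel transform of type `η` of `G`. -/
def EqHankelOn (lam : Fin n → ℝ) (η : Fin n → Fin 2) (G F : (Fin n → ℝ) → ℂ) : Prop :=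
  ∀ x ∈ orthant n, F x = hankel lam η G x

lemma EqHankelOn.del (hlam : ∀ j, -1 / 2 < lam j) {F G : (Fin n → ℝ) → ℂ}
    (h : EqHankelOn lam η G F) (hG : GaussDecay lam G) {j : Fin n} (hη : η j = 0) :
    EqHankelOn lam (Function.update η j 1) (fun z => -1 * ((z j : ℂ) * G z)) (del j F) := by
  intro x hx
  have hxj := hx j
  obtain ⟨b, hb, hbound⟩ := ((hG.coord_mul j).const_mul (-1)).exists_bound hlam
    (Function.update η j 1) (normSq x + (2 * x j) ^ 2)
  -- `F` is known only on the orthant, so the neighbourhood must keep the `j`-th coordinate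
  -- positive.
  have hnhds : Set.Ioo 0 (2 * x j) ∈ 𝓝 (x j) := Ioo_mem_nhds hxj (by linarith)
  have key := hasDerivAt_integral_of_dominated_loc_of_deriv_le (𝕜 := ℝ) (μ := wPlus lam)
    (F := fun s z => (hankelKernel lam η (Function.update x j s) z : ℂ) * G z)
    (F' := fun s z => (hankelKernel lam (Function.update η j 1) (Function.update x j s) z : ℂ) *
      (-1 * ((z j : ℂ) * G z))) (x₀ := x j) (bound := b) hnhds
    (Eventually.of_forall fun s => (hG.integrable_kernel_mul hlam η _).aestronglyMeasurable)
    (hG.integrable_kernel_mul hlam η _)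
    (((hG.coord_mul j).const_mul (-1)).integrable_kernel_mul hlam _ _).aestronglyMeasurable
    (ae_of_all _ fun z s hs => hbound _ z (normSq_update_le x j
      (abs_le.2 ⟨by linarith [hs.1], hs.2.le⟩))) hb
    (ae_of_all _ fun z s _ => by
      have h1 := ((hasDerivAt_hankelKernel_zero hlam hη x z s).ofReal_comp).mul_const (G z)
      convert! h1 using 1
      push_cast; ring)
  have he : (fun s => F (Function.update x j s)) =ᶠ[𝓝 (x j)]
      fun s => hankel lam η G (Function.update x j s) := by
    filter_upwards [hnhds] with s hs
    exact h _ (update_mem_orthant hx j hs.1)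
  unfold DunklBessel.del
  rw [he.deriv_eq]
  have := key.2.deriv
  rw [Function.update_eq_self] at this
  exact this

lemma EqHankelOn.delStar (hlam : ∀ j, -1 / 2 < lam j) {F G : (Fin n → ℝ) → ℂ}
    (h : EqHankelOn lam η G F) (hG : GaussDecay lam G) {j : Fin n} (hη : η j = 1) :
    EqHankelOn lam (Function.update η j 0) (fun z => (z j : ℂ) * G z) (delStar lam j F) := by
  intro x hx
  have hxj := hx j
  obtain ⟨b, hb, hbound⟩ := (hG.coord_mul j).exists_bound hlam
    (Function.update η j 0) (normSq x + (2 * x j) ^ 2)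
  obtain ⟨b', hb', hbound'⟩ := hG.exists_bound hlam η (normSq x + (2 * x j) ^ 2)
  -- The lower end `x_j/2` additionally bounds the singular factor `2λ_j/s`.
  have hnhds : Set.Ioo (x j / 2) (2 * x j) ∈ 𝓝 (x j) := Ioo_mem_nhds (by linarith) (by linarith)
  have i1 := fun y => (hG.coord_mul j).integrable_kernel_mul hlam (Function.update η j 0) y
  have i2 := fun y => hG.integrable_kernel_mul hlam η y
  have key := hasDerivAt_integral_of_dominated_loc_of_deriv_le (𝕜 := ℝ) (μ := wPlus lam)
    (F := fun s z => (hankelKernel lam η (Function.update x j s) z : ℂ) * G z)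
    (F' := fun s z => (hankelKernel lam (Function.update η j 0) (Function.update x j s) z : ℂ) *
      ((z j : ℂ) * G z) - ((2 * lam j / s : ℝ) : ℂ) *
        ((hankelKernel lam η (Function.update x j s) z : ℂ) * G z)) (x₀ := x j)
    (bound := fun z => b z + |2 * lam j| / (x j / 2) * b' z) hnhds
    (Eventually.of_forall fun s => (i2 _).aestronglyMeasurable) (i2 _)
    ((i1 _).sub ((i2 _).const_mul _)).aestronglyMeasurable
    (ae_of_all _ fun z s hs => ?_) (hb.add (hb'.const_mul _))
    (ae_of_all _ fun z s hs => by
      have hs0 : s ≠ 0 := (lt_trans (by linarith) hs.1).ne'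
      have h1 := ((hasDerivAt_hankelKernel_one hlam hη x z hs0).ofReal_comp).mul_const (G z)
      convert! h1 using 1
      push_cast; ring)
  · have he : (fun s => F (Function.update x j s)) =ᶠ[𝓝 (x j)]
        fun s => hankel lam η G (Function.update x j s) := by
      filter_upwards [hnhds] with s hs
      exact h _ (update_mem_orthant hx j (lt_trans (by linarith) hs.1))
    have hd := key.2.deriv
    rw [Function.update_eq_self, integral_sub (i1 _) ((i2 _).const_mul _),
      integral_const_mul] at hd
    unfold DunklBessel.delStar DunklBessel.del
    rw [he.deriv_eq]
    rw [h x hx]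
    unfold hankel
    rw [hd]
    ring
  · have hs0 : 0 < s := lt_trans (by linarith) hs.1
    have hle := normSq_update_le x j (s := s) (b := 2 * x j)
      (abs_le.2 ⟨by linarith, hs.2.le⟩)
    refine (norm_sub_le _ _).trans (add_le_add (hbound _ z hle) ?_)
    rw [norm_mul, Complex.norm_real, Real.norm_eq_abs, abs_div, abs_of_pos hs0]
    have := hs.1.le
    gcongr
    exact hbound' _ z hle

lemma EqHankelOn.congr_right {F G G' : (Fin n → ℝ) → ℂ} (h : EqHankelOn lam η G F)
    (hG : ∀ z, G z = G' z) : EqHankelOn lam η G' F := by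
  have : G = G' := funext hG
  rwa [← this]

lemma fin_two_eq_one_of_ne_zero {e : Fin 2} (h : e ≠ 0) : e = 1 := by
  fin_cases e
  · exact absurd rfl h
  · rfl

/-- Two successive derivatives flip `η_j` twice and multiply by `-z_j²`. -/
lemma iterate_delStar_del (hlam : ∀ j, -1 / 2 < lam j) {j : Fin n} (hη : η j = 0)
    (k : ℕ) : ∀ {F G : (Fin n → ℝ) → ℂ}, EqHankelOn lam η G F → GaussDecay lam G →
    EqHankelOn lam η (fun z => (-1) ^ k * ((z j : ℂ) ^ (2 * k) * G z))
      ((fun G => delStar lam j (del j G))^[k] F) := by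
  induction k with
  | zero => intro F G h _; exact h.congr_right fun z => by simp
  | succ k ih =>
    intro F G h hG
    have h1 := (h.del hlam hG hη).delStar hlam ((hG.coord_mul j).const_mul _) (j := j) (by simp)
    rw [Function.update_idem, ← hη, Function.update_eq_self] at h1
    rw [Function.iterate_succ_apply]
    refine (ih h1 (((hG.coord_mul j).const_mul _).coord_mul j)).congr_right fun z => ?_
    ring

lemma iterate_del_delStar (hlam : ∀ j, -1 / 2 < lam j) {j : Fin n} (hη : η j = 1)
    (k : ℕ) : ∀ {F G : (Fin n → ℝ) → ℂ}, EqHankelOn lam η G F → GaussDecay lam G →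
    EqHankelOn lam η (fun z => (-1) ^ k * ((z j : ℂ) ^ (2 * k) * G z))
      ((fun G => del j (delStar lam j G))^[k] F) := by
  induction k with
  | zero => intro F G h _; exact h.congr_right fun z => by simp
  | succ k ih =>
    intro F G h hG
    have h1 := (h.delStar hlam hG hη).del hlam (hG.coord_mul j) (j := j) (by simp)
    rw [Function.update_idem, ← hη, Function.update_eq_self] at h1
    rw [Function.iterate_succ_apply]
    refine (ih h1 (((hG.coord_mul j).coord_mul j).const_mul _)).congr_right fun z => ?_
    ring

/-- The exact sign and the new type are left existential: only the modulus of `c` enters the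
estimates, but neither may depend on `F` or `G`. -/
lemma exists_delOne_eq (hlam : ∀ j, -1 / 2 < lam j) (η : Fin n → Fin 2) (j : Fin n) (m : ℕ) :
    ∃ (e : Fin 2) (c : ℂ), ‖c‖ = 1 ∧ ∀ F G : (Fin n → ℝ) → ℂ, EqHankelOn lam η G F →
      GaussDecay lam G → EqHankelOn lam (Function.update η j e)
        (fun z => c * ((z j : ℂ) ^ m * G z)) (delOne lam j (η j) m F) := by
  have hdec : ∀ {G : (Fin n → ℝ) → ℂ} (k : ℕ), GaussDecay lam G →
      GaussDecay lam fun z => (-1) ^ k * ((z j : ℂ) ^ (2 * k) * G z) :=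
    fun k hG => (hG.coord_pow_mul j _).const_mul _
  unfold delOne
  by_cases hη : η j = 0
  · by_cases hm : Even m
    · obtain ⟨k, rfl⟩ := hm.two_dvd
      refine ⟨η j, (-1) ^ k, by simp, fun F G h hG => ?_⟩
      rw [if_pos hη, if_pos hm, Function.update_eq_self, Nat.mul_div_cancel_left _ two_pos]
      exact iterate_delStar_del hlam hη k h hG
    · obtain ⟨k, rfl⟩ := Nat.not_even_iff_odd.1 hm
      refine ⟨1, (-1) ^ (k + 1), by simp, fun F G h hG => ?_⟩
      rw [if_pos hη, if_neg hm, Nat.add_sub_cancel, Nat.mul_div_cancel_left _ two_pos]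
      refine ((iterate_delStar_del hlam hη k h hG).del hlam (hdec k hG) hη).congr_right fun z => ?_
      ring
  · have hη' := fin_two_eq_one_of_ne_zero hη
    by_cases hm : Even m
    · obtain ⟨k, rfl⟩ := hm.two_dvd
      refine ⟨η j, (-1) ^ k, by simp, fun F G h hG => ?_⟩
      rw [if_neg hη, if_pos hm, Function.update_eq_self, Nat.mul_div_cancel_left _ two_pos]
      exact iterate_del_delStar hlam hη' k h hG
    · obtain ⟨k, rfl⟩ := Nat.not_even_iff_odd.1 hm
      refine ⟨0, (-1) ^ k, by simp, fun F G h hG => ?_⟩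
      rw [if_neg hη, if_neg hm, Nat.add_sub_cancel, Nat.mul_div_cancel_left _ two_pos]
      refine ((iterate_del_delStar hlam hη' k h hG).delStar hlam (hdec k hG) hη').congr_right
        fun z => ?_
      ring

lemma GaussDecay.list_prod_mul {G : (Fin n → ℝ) → ℂ} (hG : GaussDecay lam G) (M : Fin n → ℕ)
    (l : List (Fin n)) :
    GaussDecay lam fun z => (l.map fun j => (z j : ℂ) ^ M j).prod * G z := by
  induction l with
  | nil => simpa using hG
  | cons j l ih =>
    refine (ih.coord_pow_mul j (M j)).congr (ae_of_all _ fun z => ?_)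
    simp only [List.map_cons, List.prod_cons]
    ring

/-- The operators already applied have changed the type only in other coordinates, since the list
has no repetition; so the next operator still meets the type `η j` it was built for. -/
lemma exists_foldr_delOne_eq (hlam : ∀ j, -1 / 2 < lam j) (η : Fin n → Fin 2) (M : Fin n → ℕ)
    (l : List (Fin n)) (hl : l.Nodup) :
    ∃ (η' : Fin n → Fin 2) (c : ℂ), ‖c‖ = 1 ∧ (∀ i, i ∉ l → η' i = η i) ∧
      ∀ F G : (Fin n → ℝ) → ℂ, EqHankelOn lam η G F → GaussDecay lam G →
        EqHankelOn lam η' (fun z => c * ((l.map fun j => (z j : ℂ) ^ M j).prod * G z))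
          (l.foldr (fun j G => delOne lam j (η j) (M j) G) F) := by
  induction l with
  | nil => exact ⟨η, 1, by simp, fun _ _ => rfl, fun F G h _ => h.congr_right fun z => by simp⟩
  | cons j l ih =>
    obtain ⟨hj, hl'⟩ := List.nodup_cons.1 hl
    obtain ⟨η', c, hc, hη', h⟩ := ih hl'
    obtain ⟨e, c', hc', h'⟩ := exists_delOne_eq hlam η' j (M j)
    refine ⟨Function.update η' j e, c' * c, by rw [norm_mul, hc, hc', one_mul], fun i hi => ?_,
      fun F G hF hG => ?_⟩
    · rw [List.mem_cons, not_or] at hi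
      rw [Function.update_of_ne hi.1, hη' i hi.2]
    · rw [List.foldr_cons, ← hη' j hj]
      refine (h' _ _ (h F G hF hG) ((hG.list_prod_mul M l).const_mul c)).congr_right fun z => ?_
      simp only [List.map_cons, List.prod_cons]
      ring

/-- The monomial `z^M`. -/
def monomial (M : Fin n → ℕ) (z : Fin n → ℝ) : ℂ := ∏ j, (z j : ℂ) ^ M j

lemma continuous_monomial (M : Fin n → ℕ) : Continuous (monomial M) := by
  unfold monomial; fun_prop

lemma list_prod_finRange (M : Fin n → ℕ) (z : Fin n → ℝ) :
    ((List.finRange n).map fun j => (z j : ℂ) ^ M j).prod = monomial M z := by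
  rw [monomial, List.prod_ofFn.symm, List.ofFn_eq_map]

lemma GaussDecay.monomial_mul {G : (Fin n → ℝ) → ℂ} (hG : GaussDecay lam G) (M : Fin n → ℕ) :
    GaussDecay lam fun z => monomial M z * G z := by
  simp_rw [← list_prod_finRange]
  exact hG.list_prod_mul M _

/-- `δ_{η,M}` acts on Hankel transforms of type `η` as multiplication by `± z^M` and a change of
type. -/
theorem exists_delta_eq (hlam : ∀ j, -1 / 2 < lam j) (η : Fin n → Fin 2) (M : Fin n → ℕ) :
    ∃ (η' : Fin n → Fin 2) (c : ℂ), ‖c‖ = 1 ∧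
      ∀ F G : (Fin n → ℝ) → ℂ, EqHankelOn lam η G F → GaussDecay lam G →
        EqHankelOn lam η' (fun z => c * (monomial M z * G z)) (delta lam η M F) := by
  obtain ⟨η', c, hc, -, h⟩ := exists_foldr_delOne_eq hlam η M (List.finRange n)
    (List.nodup_finRange n)
  refine ⟨η', c, hc, fun F G hF hG => (h F G hF hG).congr_right fun z => ?_⟩
  rw [list_prod_finRange]

/-! ### The heat semigroup and its derivatives -/

theorem heat_eq (hlam : ∀ j, -1 / 2 < lam j) {f : (Fin n → ℝ) → ℂ} (hf : MemLp f 2 (wPlus lam))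
    {t : ℝ} (ht : 0 < t) (x : Fin n → ℝ) :
    heat lam η t f x = hankel lam η
      (fun z => (Real.exp (-t * normSq z) : ℂ) * hankelL2 hlam η (hf.toLp f) z) x :=
  dunklInv_mul_dunklL2 η hlam hf (fun ε z => by rw [normSq_signFlip])
    (gaussDecay_exp_mul ht (Lp.memLp _)) x

lemma hasDerivAt_hankel_exp (hlam : ∀ j, -1 / 2 < lam j) (η : Fin n → Fin 2)
    {G : (Fin n → ℝ) → ℂ}
    (hG : ∀ s > 0, GaussDecay lam fun z => (Real.exp (-s * normSq z) : ℂ) * G z)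
    (x : Fin n → ℝ) {t : ℝ} (ht : 0 < t) :
    HasDerivAt (fun s => hankel lam η (fun z => (Real.exp (-s * normSq z) : ℂ) * G z) x)
      (hankel lam η (fun z => (Real.exp (-t * normSq z) : ℂ) * (-(normSq z : ℂ) * G z)) x) t := by
  -- For `s > t/2` the differentiated integrand is dominated by its modulus at time `t/2`.
  have hb := ((hG (t / 2) (half_pos ht)).normSq_mul.integrable_kernel_mul hlam η x).norm
  have hG' : ∀ s > 0, GaussDecay lam fun z =>
      (Real.exp (-s * normSq z) : ℂ) * (-(normSq z : ℂ) * G z) := fun s hs =>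
    ((hG s hs).normSq_mul.const_mul (-1)).congr (ae_of_all _ fun z => by simp only; ring)
  have hnhds : Set.Ioi (t / 2) ∈ 𝓝 t := Ioi_mem_nhds (by linarith)
  refine (hasDerivAt_integral_of_dominated_loc_of_deriv_le (𝕜 := ℝ) (μ := wPlus lam)
    (F := fun s z => (hankelKernel lam η x z : ℂ) * ((Real.exp (-s * normSq z) : ℂ) * G z))
    (F' := fun s z => (hankelKernel lam η x z : ℂ) *
      ((Real.exp (-s * normSq z) : ℂ) * (-(normSq z : ℂ) * G z))) (x₀ := t) hnhds
    ?_ ((hG t ht).integrable_kernel_mul hlam η _)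
    ((hG' t ht).integrable_kernel_mul hlam η _).aestronglyMeasurable
    (ae_of_all _ fun z s hs => ?_) hb (ae_of_all _ fun z s _ => ?_)).2
  · filter_upwards [hnhds] with s hs
    exact ((hG s (lt_trans (half_pos ht) hs)).integrable_kernel_mul hlam η _).aestronglyMeasurable
  · have hs' : t / 2 < s := hs
    have := normSq_nonneg z
    rw [norm_mul, norm_mul, norm_mul, norm_mul, norm_mul, norm_mul, norm_neg, norm_ofReal_exp,
      norm_ofReal_exp, mul_left_comm (Real.exp (-s * normSq z))]
    gcongr
  · have h1 : HasDerivAt (fun s => Real.exp (-s * normSq z))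
        (Real.exp (-s * normSq z) * (-normSq z)) s := by
      have := ((hasDerivAt_id s).neg.mul_const (normSq z)).exp
      simpa using this
    have h2 := (h1.ofReal_comp.mul_const (G z)).const_mul (hankelKernel lam η x z : ℂ)
    convert! h2 using 1
    push_cast; ring

/-- `∂_t^K δ_{η,M} 𝕎_t f` as a Hankel transform. -/
theorem exists_heatDeriv_eq (hlam : ∀ j, -1 / 2 < lam j) (η : Fin n → Fin 2) (M : Fin n → ℕ) :
    ∃ (η' : Fin n → Fin 2) (c : ℂ), ‖c‖ = 1 ∧
      ∀ (K : ℕ) (f : (Fin n → ℝ) → ℂ) (hf : MemLp f 2 (wPlus lam)), ∀ x ∈ orthant n, ∀ t > 0,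
        heatDeriv lam η K M f x t = hankel lam η' (fun z => (Real.exp (-t * normSq z) : ℂ) *
          ((-(normSq z : ℂ)) ^ K * (c * (monomial M z * hankelL2 hlam η (hf.toLp f) z)))) x := by
  obtain ⟨η', c, hc, h⟩ := exists_delta_eq hlam η M
  refine ⟨η', c, hc, fun K f hf x hx => ?_⟩
  set g := hankelL2 hlam η (hf.toLp f)
  have hdec : ∀ (K : ℕ), ∀ s > 0, GaussDecay lam fun z => (Real.exp (-s * normSq z) : ℂ) *
          ((-(normSq z : ℂ)) ^ K * (c * (monomial M z * g z))) := fun K s hs =>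
    ((((gaussDecay_exp_mul hs (Lp.memLp g)).monomial_mul M).const_mul c).normSq_pow_mul K).congr
      (ae_of_all _ fun z => by simp only; ring)
  unfold heatDeriv
  induction K with
  | zero =>
    intro t ht
    rw [iteratedDeriv_zero]
    refine (h _ _ (fun x _ => heat_eq hlam hf ht x) (gaussDecay_exp_mul ht (Lp.memLp _))
      x hx).trans ?_
    congr 1
    funext z
    ring
  | succ K ih =>
    intro t ht
    rw [iteratedDeriv_succ]
    have he : iteratedDeriv K (fun s => delta lam η M (heat lam η s f) x) =ᶠ[𝓝 t]
        fun s => hankel lam η' (fun z => (Real.exp (-s * normSq z) : ℂ) *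
          ((-(normSq z : ℂ)) ^ K * (c * (monomial M z * g z)))) x := by
      filter_upwards [Ioi_mem_nhds ht] with s hs
      exact ih s hs
    rw [he.deriv_eq, (hasDerivAt_hankel_exp hlam η' (hdec K) x ht).deriv]
    congr 1
    funext z
    ring

end
end DunklBessel
end

noncomputable section

namespace DunklBessel

/-! ### The `g`-functions -/

lemma eLpNorm_two_sq {α ε : Type*} [MeasurableSpace α] {μ : Measure α} [TopologicalSpace ε]
    [ContinuousENorm ε] (f : α → ε) : eLpNorm f 2 μ ^ 2 = ∫⁻ x, ‖f x‖ₑ ^ 2 ∂μ := by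
  have := eLpNorm_nnreal_pow_eq_lintegral (μ := μ) (f := f) (p := 2) (by norm_num)
  simpa using this

lemma sublinearBoundedL2_of_sq {n : ℕ} {lam : Fin n → ℝ}
    {S : ((Fin n → ℝ) → ℂ) → (Fin n → ℝ) → ℝ≥0∞}
    (h : ∃ C : ℝ≥0, ∀ f : (Fin n → ℝ) → ℂ, MemLp f 2 (wPlus lam) →
      AEMeasurable (S f) (wPlus lam) ∧
        ∫⁻ x, S f x ^ 2 ∂wPlus lam ≤ C * ∫⁻ x, ‖f x‖ₑ ^ 2 ∂wPlus lam) :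
    SublinearBoundedL2 lam S := by
  obtain ⟨C, hC⟩ := h
  refine ⟨NNReal.sqrt C, fun f hf => ⟨(hC f hf).1, ?_⟩⟩
  rw [← ENNReal.pow_le_pow_left_iff two_ne_zero, mul_pow, eLpNorm_two_sq, eLpNorm_two_sq,
    ← ENNReal.coe_pow, NNReal.sq_sqrt]
  simpa only [enorm_eq_self] using (hC f hf).2

lemma lintegral_rpow_mul_exp_neg {p s : ℝ} (hp : 0 < p) (hs : 0 < s) :
    ∫⁻ t in Set.Ioi (0 : ℝ), ENNReal.ofReal (t ^ (p - 1) * Real.exp (-(s * t))) =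
      ENNReal.ofReal ((1 / s) ^ p * Real.Gamma p) := by
  have h := Real.integral_rpow_mul_exp_neg_mul_Ioi hp hs
  have hpos : 0 < (1 / s) ^ p * Real.Gamma p :=
    mul_pos (Real.rpow_pos_of_pos (by positivity) _) (Real.Gamma_pos_of_pos hp)
  rw [← h, ofReal_integral_eq_lintegral_ofReal]
  · exact Integrable.of_integral_ne_zero (by rw [h]; exact hpos.ne')
  · filter_upwards [self_mem_ae_restrict measurableSet_Ioi] with t ht
    have ht' : 0 < t := ht
    positivity

section
variable {n : ℕ} {lam : Fin n → ℝ} {η : Fin n → Fin 2}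

/-- The integral ignores null sets, so `h` may be replaced by one strongly measurable representative
for all `(x,t)` simultaneously. -/
lemma measurable_hankel_exp (hlam : ∀ j, -1 / 2 < lam j) (η : Fin n → Fin 2)
    {h : (Fin n → ℝ) → ℂ} (hh : AEStronglyMeasurable h (wPlus lam)) :
    Measurable fun p : (Fin n → ℝ) × ℝ =>
      hankel lam η (fun z => (Real.exp (-p.2 * normSq z) : ℂ) * h z) p.1 := by
  obtain ⟨h', hh', hae⟩ := hh
  have he : (fun p : (Fin n → ℝ) × ℝ =>
      hankel lam η (fun z => (Real.exp (-p.2 * normSq z) : ℂ) * h z) p.1) =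
      fun p => ∫ z, (hankelKernel lam η p.1 z : ℂ) *
        ((Real.exp (-p.2 * normSq z) : ℂ) * h' z) ∂wPlus lam := by
    funext p
    rw [hankel_congr_ae η (g := fun z => (Real.exp (-p.2 * normSq z) : ℂ) * h' z)
      (by filter_upwards [hae] with z hz; rw [hz])]
    rfl
  rw [he]
  refine (StronglyMeasurable.integral_prod_right' (f := fun q : ((Fin n → ℝ) × ℝ) × (Fin n → ℝ) =>
    (hankelKernel lam η q.1.1 q.2 : ℂ) *
        ((Real.exp (-q.1.2 * normSq q.2) : ℂ) * h' q.2)) ?_).measurable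
  have h1 : Continuous fun q : ((Fin n → ℝ) × ℝ) × (Fin n → ℝ) =>
      (hankelKernel lam η q.1.1 q.2 : ℂ) :=
    Complex.continuous_ofReal.comp ((continuous_hankelKernel η hlam).comp
      ((continuous_fst.comp continuous_fst).prodMk continuous_snd))
  have h2 : Continuous fun q : ((Fin n → ℝ) × ℝ) × (Fin n → ℝ) =>
      (Real.exp (-q.1.2 * normSq q.2) : ℂ) := by
    have := continuous_normSq (n := n)
    fun_prop
  exact h1.stronglyMeasurable.mul (h2.stronglyMeasurable.mul (hh'.comp_measurable measurable_snd))

lemma norm_monomial_le (M : Fin n → ℕ) (z : Fin n → ℝ) :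
    ‖monomial M z‖ ^ 2 ≤ normSq z ^ (∑ j, M j) := by
  rw [monomial, norm_prod, ← Finset.prod_pow, ← Finset.prod_pow_eq_pow_sum]
  refine Finset.prod_le_prod (fun _ _ => by positivity) fun j _ => ?_
  rw [norm_pow, Complex.norm_real, Real.norm_eq_abs, ← pow_mul, mul_comm, pow_mul, sq_abs]
  exact pow_le_pow_left₀ (sq_nonneg _) (sq_le_normSq z j) _

lemma gaussDecay_heatSymbol {g : (Fin n → ℝ) → ℂ} (hg : MemLp g 2 (wPlus lam)) (c : ℂ) (K : ℕ)
    (M : Fin n → ℕ) {t : ℝ} (ht : 0 < t) :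
    GaussDecay lam fun z => (Real.exp (-t * normSq z) : ℂ) *
      ((-(normSq z : ℂ)) ^ K * (c * (monomial M z * g z))) :=
  ((((gaussDecay_exp_mul ht hg).monomial_mul M).const_mul c).normSq_pow_mul K).congr
    (ae_of_all _ fun z => by simp only; ring)

/-- With `s = |z|²` and `p = 2K + |M|` the integral is at most `s^p ∫ t^{p-1} e^{-2st} dt |u|² =
2^{-p} Γ(p) |u|²`. The exponent of `t` is precisely the one that makes this independent of `z`. -/
lemma lintegral_heatSymbol_le {c : ℂ} (hc : ‖c‖ = 1) (K : ℕ) (M : Fin n → ℕ)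
    (hKM : 0 < ∑ j, M j + K) (z : Fin n → ℝ) (u : ℂ) :
    ∫⁻ t in Set.Ioi (0 : ℝ), ENNReal.ofReal (t ^ (2 * (K : ℝ) + ((∑ j, M j : ℕ) : ℝ) - 1)) *
      ‖(Real.exp (-t * normSq z) : ℂ) * ((-(normSq z : ℂ)) ^ K * (c * (monomial M z * u)))‖ₑ ^ 2
      ≤ ENNReal.ofReal (Real.Gamma (2 * (K : ℝ) + ((∑ j, M j : ℕ) : ℝ))) * ‖u‖ₑ ^ 2 := by
  set m := ∑ j, M j with hm
  set p : ℝ := 2 * (K : ℝ) + (m : ℝ) with hp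
  have hp0 : 0 < p := by
    have : (0 : ℝ) < (m : ℝ) + K := by exact_mod_cast hKM
    have : (0 : ℝ) ≤ K := Nat.cast_nonneg K
    linarith
  have hs0 := normSq_nonneg z
  have hnorm : ∀ t : ℝ,
      ‖(Real.exp (-t * normSq z) : ℂ) * ((-(normSq z : ℂ)) ^ K * (c * (monomial M z * u)))‖ₑ ^ 2
      ≤ ENNReal.ofReal (Real.exp (-(2 * normSq z * t)) * normSq z ^ (2 * K + m)) * ‖u‖ₑ ^ 2 := by
    intro t
    rw [← ofReal_norm, ← ofReal_norm, ← ENNReal.ofReal_pow (norm_nonneg _),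
      ← ENNReal.ofReal_pow (norm_nonneg _), ← ENNReal.ofReal_mul (by positivity)]
    refine ENNReal.ofReal_le_ofReal ?_
    rw [norm_mul, norm_mul, norm_mul, norm_mul, hc, norm_ofReal_exp, norm_pow, norm_neg,
      Complex.norm_real, Real.norm_of_nonneg hs0]
    have h1 := norm_monomial_le M z
    have h2 : Real.exp (-(2 * normSq z * t)) = Real.exp (-t * normSq z) ^ 2 := by
      rw [← Real.exp_nat_mul]; congr 1; push_cast; ring
    calc (Real.exp (-t * normSq z) * (normSq z ^ K * (1 * (‖monomial M z‖ * ‖u‖)))) ^ 2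
        = Real.exp (-t * normSq z) ^ 2 * (normSq z ^ (2 * K) * ‖monomial M z‖ ^ 2) * ‖u‖ ^ 2 := by
          ring
      _ ≤ Real.exp (-t * normSq z) ^ 2 * (normSq z ^ (2 * K) * normSq z ^ m) * ‖u‖ ^ 2 := by
          gcongr
      _ = _ := by rw [h2, pow_add]
  rcases hs0.eq_or_lt with hs | hs
  · have hne : 2 * K + m ≠ 0 := by omega
    have hz : ∀ t : ℝ, ‖(Real.exp (-t * normSq z) : ℂ) *
        ((-(normSq z : ℂ)) ^ K * (c * (monomial M z * u)))‖ₑ ^ 2 = 0 := fun t => by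
      refine le_antisymm ((hnorm t).trans ?_) bot_le
      rw [← hs, zero_pow hne]
      simp
    simp_rw [hz]
    simp
  calc _ ≤ ∫⁻ t in Set.Ioi (0 : ℝ), ENNReal.ofReal (t ^ (p - 1) *
        Real.exp (-(2 * normSq z * t))) * (ENNReal.ofReal (normSq z ^ (2 * K + m)) * ‖u‖ₑ ^ 2) := by
        refine setLIntegral_mono' measurableSet_Ioi fun t ht => ?_
        have ht' : 0 < t := ht
        refine (mul_le_mul_right (hnorm t) _).trans (le_of_eq ?_)
        rw [ENNReal.ofReal_mul (Real.exp_pos _).le, ENNReal.ofReal_mul (by positivity)]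
        ring
    _ = ENNReal.ofReal ((1 / (2 * normSq z)) ^ p * Real.Gamma p * normSq z ^ (2 * K + m)) *
          ‖u‖ₑ ^ 2 := by
        have hG := (Real.Gamma_pos_of_pos hp0).le
        rw [lintegral_mul_const _ (by fun_prop), lintegral_rpow_mul_exp_neg hp0 (by positivity),
          ENNReal.ofReal_mul (p := (1 / (2 * normSq z)) ^ p * Real.Gamma p) (by positivity),
          mul_assoc]
    _ ≤ _ := by
        gcongr
        have hG := (Real.Gamma_pos_of_pos hp0).le
        have h1 : normSq z ^ (2 * K + m) = normSq z ^ p := by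
          rw [← Real.rpow_natCast]; congr 1; push_cast; ring
        rw [h1, mul_right_comm, ← Real.mul_rpow (by positivity) hs.le]
        have h2 : (1 / (2 * normSq z) * normSq z) = 1 / 2 := by field_simp
        rw [h2]
        have h3 : (1 / 2 : ℝ) ^ p ≤ 1 := Real.rpow_le_one (by norm_num) (by norm_num) hp0.le
        nlinarith

/-- The square function estimate behind the `g`-functions and the area integrals. -/
theorem exists_measurable_heatDeriv (hlam : ∀ j, -1 / 2 < lam j) (η : Fin n → Fin 2) (K : ℕ)
    (M : Fin n → ℕ) (hKM : 0 < ∑ j, M j + K) :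
    ∃ C : ℝ≥0, ∀ f : (Fin n → ℝ) → ℂ, MemLp f 2 (wPlus lam) →
      ∃ Ψ : (Fin n → ℝ) × ℝ → ℝ≥0∞, Measurable Ψ ∧
        (∀ x ∈ orthant n, ∀ t > 0,
          ENNReal.ofReal (t ^ (2 * (K : ℝ) + ((∑ j, M j : ℕ) : ℝ) - 1)) *
            ‖heatDeriv lam η K M f x t‖ₑ ^ 2 = Ψ (x, t)) ∧
        ∫⁻ p, Ψ p ∂(wPlus lam).prod (volume.restrict (Set.Ioi 0)) ≤
          C * ∫⁻ x, ‖f x‖ₑ ^ 2 ∂wPlus lam := by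
  obtain ⟨η', c, hc, h⟩ := exists_heatDeriv_eq hlam η M
  refine ⟨(Real.Gamma (2 * (K : ℝ) + ((∑ j, M j : ℕ) : ℝ))).toNNReal, fun f hf => ?_⟩
  set g := hankelL2 hlam η (hf.toLp f) with hg
  have hgm : AEStronglyMeasurable
      (fun z => (-(normSq z : ℂ)) ^ K * (c * (monomial M z * g z))) (wPlus lam) := by
    have h1 := continuous_normSq (n := n)
    have h2 := continuous_monomial M
    exact Continuous.aestronglyMeasurable (by fun_prop) |>.mul
      ((h2.aestronglyMeasurable.mul (Lp.memLp g).1).const_mul c)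
  have hm := measurable_hankel_exp hlam η' hgm
  have hpow : Measurable fun p : (Fin n → ℝ) × ℝ =>
      ENNReal.ofReal (p.2 ^ (2 * (K : ℝ) + ((∑ j, M j : ℕ) : ℝ) - 1)) := by fun_prop
  have hΨ := hpow.mul (hm.enorm.pow_const 2)
  refine ⟨_, hΨ, fun x hx t ht => by rw [h K f hf x hx t ht]; rfl, ?_⟩
  have hK : Measurable fun q : ℝ × (Fin n → ℝ) =>
      ENNReal.ofReal (q.1 ^ (2 * (K : ℝ) + ((∑ j, M j : ℕ) : ℝ) - 1)) := by fun_prop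
  calc _ = ∫⁻ t in Set.Ioi (0 : ℝ), ∫⁻ x,
          ENNReal.ofReal (t ^ (2 * (K : ℝ) + ((∑ j, M j : ℕ) : ℝ) - 1)) *
          ‖hankel lam η' (fun z => (Real.exp (-t * normSq z) : ℂ) *
            ((-(normSq z : ℂ)) ^ K * (c * (monomial M z * g z)))) x‖ₑ ^ 2 ∂wPlus lam :=
        lintegral_prod_symm' _ hΨ
    _ = ∫⁻ t in Set.Ioi (0 : ℝ), ∫⁻ z,
          ENNReal.ofReal (t ^ (2 * (K : ℝ) + ((∑ j, M j : ℕ) : ℝ) - 1)) *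
          ‖(Real.exp (-t * normSq z) : ℂ) *
            ((-(normSq z : ℂ)) ^ K * (c * (monomial M z * g z)))‖ₑ ^ 2 ∂wPlus lam := by
        -- Plancherel at each fixed time: the Hankel transform preserves the norm on functions with
        -- Gaussian decay.
        refine setLIntegral_congr_fun measurableSet_Ioi fun t ht => ?_
        have hd := gaussDecay_heatSymbol (Lp.memLp g) c K M (lam := lam) (show 0 < t from ht)
        rw [lintegral_const_mul' _ _ ENNReal.ofReal_ne_top,
          lintegral_const_mul' _ _ ENNReal.ofReal_ne_top, ← eLpNorm_two_sq, ← eLpNorm_two_sq,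
          eLpNorm_hankel η' hlam hd]
    _ = ∫⁻ z, (∫⁻ t in Set.Ioi (0 : ℝ),
          ENNReal.ofReal (t ^ (2 * (K : ℝ) + ((∑ j, M j : ℕ) : ℝ) - 1)) *
          ‖(Real.exp (-t * normSq z) : ℂ) *
            ((-(normSq z : ℂ)) ^ K * (c * (monomial M z * g z)))‖ₑ ^ 2) ∂wPlus lam := by
        refine lintegral_lintegral_swap ?_
        have hc1 : Continuous fun q : ℝ × (Fin n → ℝ) => (Real.exp (-q.1 * normSq q.2) : ℂ) := by
          have := continuous_normSq (n := n)
          fun_prop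
        exact hK.aemeasurable.mul ((hc1.aestronglyMeasurable.mul hgm.comp_snd).enorm.pow_const 2)
    _ ≤ ∫⁻ z, ENNReal.ofReal (Real.Gamma (2 * (K : ℝ) + ((∑ j, M j : ℕ) : ℝ))) * ‖g z‖ₑ ^ 2
          ∂wPlus lam := lintegral_mono fun z => lintegral_heatSymbol_le hc K M hKM z (g z)
    _ = _ := by
        rw [lintegral_const_mul' _ _ ENNReal.ofReal_ne_top, ← eLpNorm_two_sq, ← eLpNorm_two_sq,
          ← Lp.enorm_def, ← ofReal_norm, hg, norm_hankelL2, ofReal_norm, Lp.enorm_toLp]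
        rfl

theorem sublinearBoundedL2_gFun (hlam : ∀ j, -1 / 2 < lam j) (η : Fin n → Fin 2) (K : ℕ)
    (M : Fin n → ℕ) (hKM : 0 < ∑ j, M j + K) : SublinearBoundedL2 lam (gFun lam η K M) := by
  obtain ⟨C, hC⟩ := exists_measurable_heatDeriv hlam η K M hKM
  refine sublinearBoundedL2_of_sq ⟨C, fun f hf => ?_⟩
  obtain ⟨Ψ, hΨ, heq, hle⟩ := hC f hf
  have he : ∀ x ∈ orthant n,
      gFun lam η K M f x = (∫⁻ t in Set.Ioi (0 : ℝ), Ψ (x, t)) ^ (1 / 2 : ℝ) := fun x hx => by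
    rw [gFun]
    congr 1
    exact setLIntegral_congr_fun measurableSet_Ioi fun t ht => heq x hx t ht
  have hae : gFun lam η K M f =ᵐ[wPlus lam]
      fun x => (∫⁻ t in Set.Ioi (0 : ℝ), Ψ (x, t)) ^ (1 / 2 : ℝ) :=
    (ae_mem_orthant lam).mono he
  refine ⟨⟨_, hΨ.lintegral_prod_right'.pow_const _, hae⟩, ?_⟩
  rw [lintegral_prod _ hΨ.aemeasurable] at hle
  refine (le_of_eq (lintegral_congr_ae ?_)).trans hle
  filter_upwards [hae] with x hx
  rw [hx, ← ENNReal.rpow_natCast, ← ENNReal.rpow_mul]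
  norm_num

/-! ### The area integrals -/

/-- The corner of the cube `{x | ∀ j, |x j - z j| < r}` with signs given by `σ`. -/
def cubeCorner (z : Fin n → ℝ) (r : ℝ) (σ : Fin n → Bool) : Set (Fin n → ℝ) :=
  {x | ∀ j, x j ∈ if σ j then Set.Ico (z j) (z j + r) else Set.Ioo (z j - r) (z j)}

lemma measurableSet_cubeCorner (z : Fin n → ℝ) (r : ℝ) (σ : Fin n → Bool) :
    MeasurableSet (cubeCorner z r σ) := by
  have : cubeCorner z r σ = Set.univ.pi fun j =>
      if σ j then Set.Ico (z j) (z j + r) else Set.Ioo (z j - r) (z j) := by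
    ext x; simp [cubeCorner]
  rw [this]
  refine MeasurableSet.univ_pi fun j => ?_
  split_ifs
  exacts [measurableSet_Ico, measurableSet_Ioo]

/-- Two points of the same corner differ by less than `r` in every coordinate. Hence `V_r(x)`
dominates the measure of any corner containing `x`. -/
lemma cubeCorner_subset {z x : Fin n → ℝ} {r : ℝ} {σ : Fin n → Bool} (hx : x ∈ cubeCorner z r σ) :
    cubeCorner z r σ ⊆ {y | ∀ j, |y j - x j| < r} := by
  intro y hy j
  have h1 := hx j
  have h2 := hy j
  rw [abs_lt]
  split_ifs at h1 h2 with hσ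
  · exact ⟨by linarith [h1.2, h2.1], by linarith [h1.1, h2.2]⟩
  · exact ⟨by linarith [h1.2, h2.1], by linarith [h1.1, h2.2]⟩

lemma cube_subset_iUnion_cubeCorner (z : Fin n → ℝ) (r : ℝ) :
    {x | ∀ j, |x j - z j| < r} ⊆ ⋃ σ, cubeCorner z r σ := by
  intro x hx
  refine Set.mem_iUnion.2 ⟨fun j => decide (z j ≤ x j), fun j => ?_⟩
  have := abs_lt.1 (hx j)
  by_cases h : z j ≤ x j
  · simpa [h] using by linarith
  · have h' := not_le.1 h
    simpa [h, h'] using by linarith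

/-- Each of the `2^n` corners contributes at most one by `cubeCorner_subset`. This replaces the
doubling property of the measure. -/
lemma setLIntegral_inv_cubeMeasure_le (lam : Fin n → ℝ) (z : Fin n → ℝ) (r : ℝ) :
    ∫⁻ x in {x | ∀ j, |x j - z j| < r}, (cubeMeasure lam r x)⁻¹ ∂wPlus lam ≤ 2 ^ n := by
  calc _ ≤ ∫⁻ x in ⋃ σ, cubeCorner z r σ, (cubeMeasure lam r x)⁻¹ ∂wPlus lam :=
        lintegral_mono_set (cube_subset_iUnion_cubeCorner z r)
    _ ≤ ∑' σ, ∫⁻ x in cubeCorner z r σ, (cubeMeasure lam r x)⁻¹ ∂wPlus lam :=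
        lintegral_iUnion_le _ _
    _ ≤ ∑' _ : Fin n → Bool, 1 := by
        refine ENNReal.tsum_le_tsum fun σ => ?_
        calc _ ≤ ∫⁻ _ in cubeCorner z r σ, (wPlus lam (cubeCorner z r σ))⁻¹ ∂wPlus lam :=
              setLIntegral_mono' (measurableSet_cubeCorner z r σ) fun x hx =>
                ENNReal.inv_le_inv.2 (measure_mono (cubeCorner_subset hx))
          _ ≤ 1 := by
              rw [setLIntegral_const]
              -- The inequality also covers corners of measure `0` or `∞`.
              exact ENNReal.inv_mul_le_one _
    _ = 2 ^ n := by simp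

lemma abs_sub_lt_of_mem_cone {x z : Fin n → ℝ} {t : ℝ} (h : (z, t) ∈ cone x) (j : Fin n) :
    |x j - z j| < Real.sqrt t := by
  refine lt_of_le_of_lt ?_ h.2
  rw [abs_sub_comm, ← Real.sqrt_sq_eq_abs]
  exact Real.sqrt_le_sqrt (sq_le_normSq (z - x) j)

lemma measurableSet_cone :
    MeasurableSet {q : (Fin n → ℝ) × ((Fin n → ℝ) × ℝ) | q.2 ∈ cone q.1} := by
  have h1 : Measurable fun q : (Fin n → ℝ) × ((Fin n → ℝ) × ℝ) => normSq (q.2.1 - q.1) :=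
    (continuous_normSq.comp (by fun_prop)).measurable
  have h2 : Measurable fun q : (Fin n → ℝ) × ((Fin n → ℝ) × ℝ) => q.2.2 := by fun_prop
  exact (measurableSet_lt measurable_const h2).inter (measurableSet_lt h1.sqrt h2.sqrt)

lemma measurable_cubeMeasure (lam : Fin n → ℝ) :
    Measurable fun q : ℝ × (Fin n → ℝ) => cubeMeasure lam q.1 q.2 := by
  refine measurable_measure_prodMk_left (ν := wPlus lam)
    (s := {q : (ℝ × (Fin n → ℝ)) × (Fin n → ℝ) | ∀ j, |q.2 j - q.1.2 j| < q.1.1}) ?_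
  simp only [Set.ofPred_forall]
  exact MeasurableSet.iInter fun j => measurableSet_lt (by fun_prop) (by fun_prop)

/-- Extending the integrand by zero off the cone yields a jointly measurable function on a product
space, as Tonelli requires. -/
lemma exists_measurable_cone (lam : Fin n → ℝ) {Ψ : (Fin n → ℝ) × ℝ → ℝ≥0∞} (hΨ : Measurable Ψ) :
    ∃ Θ : (Fin n → ℝ) → (Fin n → ℝ) × ℝ → ℝ≥0∞,
      Measurable (fun q : (Fin n → ℝ) × ((Fin n → ℝ) × ℝ) => Θ q.1 q.2) ∧
      (∀ x, ∀ p ∈ cone x, Θ x p = Ψ p * (cubeMeasure lam (Real.sqrt p.2) x)⁻¹) ∧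
      ∀ x, ∀ p ∉ cone x, Θ x p = 0 := by
  have h1 : Measurable fun q : (Fin n → ℝ) × ((Fin n → ℝ) × ℝ) =>
      Ψ q.2 * (cubeMeasure lam (Real.sqrt q.2.2) q.1)⁻¹ :=
    (hΨ.comp measurable_snd).mul ((measurable_cubeMeasure lam).comp
      (f := fun q : (Fin n → ℝ) × ((Fin n → ℝ) × ℝ) => (Real.sqrt q.2.2, q.1))
      (by fun_prop)).inv
  set S : Set ((Fin n → ℝ) × ((Fin n → ℝ) × ℝ)) := {q | q.2 ∈ cone q.1} with hS
  refine ⟨fun x p => S.indicator (fun q => Ψ q.2 * (cubeMeasure lam (Real.sqrt q.2.2) q.1)⁻¹)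
    (x, p), h1.indicator measurableSet_cone, fun x p hp => ?_, fun x p hp => ?_⟩
  · exact Set.indicator_of_mem (s := S) (show (x, p) ∈ S from hp) _
  · exact Set.indicator_of_notMem (s := S) (show (x, p) ∉ S from hp) _

theorem sublinearBoundedL2_lusinOp (hlam : ∀ j, -1 / 2 < lam j) (η : Fin n → Fin 2) (K : ℕ)
    (M : Fin n → ℕ) (hKM : 0 < ∑ j, M j + K) : SublinearBoundedL2 lam (lusinOp lam η K M) := by
  obtain ⟨C, hC⟩ := exists_measurable_heatDeriv hlam η K M hKM
  refine sublinearBoundedL2_of_sq ⟨2 ^ n * C, fun f hf => ?_⟩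
  obtain ⟨Ψ, hΨ, heq, hle⟩ := hC f hf
  have hcone : ∀ x : Fin n → ℝ, MeasurableSet (cone x) := fun x =>
    measurableSet_cone.preimage (f := fun p : (Fin n → ℝ) × ℝ => (x, p)) measurable_prodMk_left
  obtain ⟨Θ, hΘm, hΘ, hΘ'⟩ := exists_measurable_cone lam hΨ
  have he : ∀ x, lusinOp lam η K M f x =
      (∫⁻ p, Θ x p ∂(wPlus lam).prod volume) ^ (1 / 2 : ℝ) := fun x => by
    have h0 : (fun p => Θ x p) =
        (cone x).indicator fun p => Ψ p * (cubeMeasure lam (Real.sqrt p.2) x)⁻¹ := by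
      funext p
      by_cases hp : p ∈ cone x
      · rw [hΘ x p hp, Set.indicator_of_mem hp]
      · rw [hΘ' x p hp, Set.indicator_of_notMem hp]
    rw [lusinOp, h0, lintegral_indicator (hcone x)]
    congr 1
    refine lintegral_congr_ae ?_
    -- `Ψ` describes the derivative only on the orthant, which has full measure.
    have h1 : ∀ᵐ p ∂(wPlus lam).prod (volume : Measure ℝ), p.1 ∈ orthant n :=
      Measure.quasiMeasurePreserving_fst.ae (ae_mem_orthant lam)
    filter_upwards [ae_restrict_of_ae h1, self_mem_ae_restrict (hcone x)] with p hp1 hp2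
    rw [heq p.1 hp1 p.2 hp2.1, ENNReal.div_eq_inv_mul, mul_comm]
  refine ⟨?_, ?_⟩
  · rw [funext he]
    exact (hΘm.lintegral_prod_right'.pow_const _).aemeasurable
  · calc ∫⁻ x, lusinOp lam η K M f x ^ 2 ∂wPlus lam
        = ∫⁻ x, ∫⁻ p, Θ x p ∂(wPlus lam).prod volume ∂wPlus lam := by
          refine lintegral_congr fun x => ?_
          rw [he, ← ENNReal.rpow_natCast, ← ENNReal.rpow_mul]
          norm_num
      _ = ∫⁻ p, ∫⁻ x, Θ x p ∂wPlus lam ∂(wPlus lam).prod volume :=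
          lintegral_lintegral_swap hΘm.aemeasurable
      _ ≤ ∫⁻ p, (Set.univ ×ˢ Set.Ioi (0 : ℝ)).indicator (fun p => 2 ^ n * Ψ p) p
            ∂(wPlus lam).prod volume := by
          refine lintegral_mono fun p => ?_
          by_cases hp : 0 < p.2
          · rw [Set.indicator_of_mem (by exact ⟨trivial, hp⟩)]
            calc ∫⁻ x, Θ x p ∂wPlus lam
                ≤ ∫⁻ x, {x : Fin n → ℝ | ∀ j, |x j - p.1 j| < Real.sqrt p.2}.indicator
                    (fun x => Ψ p * (cubeMeasure lam (Real.sqrt p.2) x)⁻¹) x ∂wPlus lam := by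
                  refine lintegral_mono fun x => ?_
                  by_cases hx : p ∈ cone x
                  · rw [hΘ x p hx, Set.indicator_of_mem (by exact abs_sub_lt_of_mem_cone hx)]
                  · rw [hΘ' x p hx]
                    exact bot_le
              _ ≤ ∫⁻ x in {x : Fin n → ℝ | ∀ j, |x j - p.1 j| < Real.sqrt p.2},
                    Ψ p * (cubeMeasure lam (Real.sqrt p.2) x)⁻¹ ∂wPlus lam :=
                  lintegral_indicator_le _ _
              _ = Ψ p * ∫⁻ x in {x : Fin n → ℝ | ∀ j, |x j - p.1 j| < Real.sqrt p.2},
                    (cubeMeasure lam (Real.sqrt p.2) x)⁻¹ ∂wPlus lam :=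
                  lintegral_const_mul _ ((measurable_cubeMeasure lam).comp
                    measurable_prodMk_left).inv
              _ ≤ 2 ^ n * Ψ p := by
                  rw [mul_comm]
                  gcongr
                  exact setLIntegral_inv_cubeMeasure_le lam _ _
          · refine le_trans (le_of_eq ?_) bot_le
            have : ∀ x, Θ x p = 0 := fun x => hΘ' x p fun h => hp h.1
            simp [this]
      _ = 2 ^ n * ∫⁻ p, Ψ p ∂(wPlus lam).prod (volume.restrict (Set.Ioi 0)) := by
          rw [lintegral_indicator (MeasurableSet.univ.prod measurableSet_Ioi),
            ← Measure.prod_restrict, Measure.restrict_univ, lintegral_const_mul _ hΨ]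
      _ ≤ 2 ^ n * (C * ∫⁻ x, ‖f x‖ₑ ^ 2 ∂wPlus lam) := by gcongr
      _ = _ := by push_cast; ring

end
end DunklBessel
end

noncomputable section

namespace DunklBessel

/-! ### The Riesz transforms -/

section
variable {n : ℕ} {lam : Fin n → ℝ} {η : Fin n → Fin 2}

lemma IsTest.const_mul {g : (Fin n → ℝ) → ℂ} (hg : IsTest g) (c : ℂ) :
    IsTest fun z => c * g z :=
  ⟨contDiff_const.mul hg.1, hg.2.1.mul_left,
    (tsupport_mul_subset_right (f := fun _ => c) (g := g)).trans hg.2.2⟩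

/-- The transform is the value at `0` of the convolution of the constant `1` with a compactly
supported function depending smoothly on the parameter `x`. -/
lemma IsTest.contDiff_hankel (hlam : ∀ j, -1 / 2 < lam j) (η : Fin n → Fin 2)
    {g : (Fin n → ℝ) → ℂ} (hg : IsTest g) :
    ContDiff ℝ ((⊤ : ℕ∞) : WithTop ℕ∞) (hankel lam η g) := by
  have hloc := isLocallyFiniteMeasure_wPlus hlam
  have hk : IsCompact ((fun z : Fin n → ℝ => -z) '' tsupport g) := hg.2.1.isCompact.image (by fun_prop)
  have h := contDiffOn_convolution_right_with_param_comp (𝕜 := ℝ) (μ := wPlus lam)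
    (n := (⊤ : ℕ∞)) (ContinuousLinearMap.lsmul ℝ ℝ (E := ℂ)) (s := Set.univ)
    (v := fun _ : Fin n → ℝ => (0 : Fin n → ℝ)) contDiffOn_const (f := fun _ : Fin n → ℝ => (1 : ℝ))
    (g := fun p u => (hankelKernel lam η p (-u) : ℂ) * g (-u)) isOpen_univ hk
    (fun p u _ hu => by
      rw [image_eq_zero_of_notMem_tsupport (f := g) fun h => hu ⟨-u, h, neg_neg u⟩, mul_zero])
    (locallyIntegrable_const _) (by
      refine ContDiff.contDiffOn ?_
      have h1 : ContDiff ℝ ((⊤ : ℕ∞) : WithTop ℕ∞)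
          (fun q : (Fin n → ℝ) × (Fin n → ℝ) => hankelKernel lam η q.1 (-q.2)) :=
        (contDiff_hankelKernel η hlam).comp (contDiff_fst.prodMk contDiff_snd.neg)
      exact (Complex.ofRealCLM.contDiff.comp h1).mul (hg.1.comp contDiff_snd.neg))
  rw [contDiffOn_univ] at h
  convert! h using 1
  funext x
  simp [convolution, hankel]

lemma IsTest.toLp_hankel (hlam : ∀ j, -1 / 2 < lam j) {g : (Fin n → ℝ) → ℂ} (hg : IsTest g)
    (hf : MemLp (hankel lam η g) 2 (wPlus lam)) :
    hf.toLp _ = hankelL2 hlam η ((hg.gaussDecay hlam).memLp.toLp g) := by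
  rw [← Lp.toLp_coeFn (hankelL2 hlam η ((hg.gaussDecay hlam).memLp.toLp g)) (Lp.memLp _),
    MemLp.toLp_eq_toLp_iff]
  exact hankel_ae_eq hlam η (hg.gaussDecay hlam) _

lemma dunklL2_symmExt_ae_wPlus (hlam : ∀ j, -1 / 2 < lam j) {f : (Fin n → ℝ) → ℂ}
    (hf : MemLp f 2 (wPlus lam)) :
    dunklL2 lam (symmExt η f) =ᵐ[wPlus lam] fun z => phase η * hankelL2 hlam η (hf.toLp f) z := by
  filter_upwards [ae_signFlip (dunklL2_symmExt η hlam hf) 0, ae_mem_orthant lam] with z hz hz'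
  have h0 : signFlip 0 z = z := by funext j; simp [signFlip]
  have h1 := symmExt_signFlip η (hankelL2 hlam η (hf.toLp f)) 0 hz'
  rw [h0] at hz h1
  rw [hz, h1]
  simp [signChar]

lemma IsTest.memLp_hankel (hlam : ∀ j, -1 / 2 < lam j) (η : Fin n → Fin 2)
    {g : (Fin n → ℝ) → ℂ} (hg : IsTest g) : MemLp (hankel lam η g) 2 (wPlus lam) :=
  (memLp_congr_ae (hankel_ae_eq hlam η (hg.gaussDecay hlam) (hg.gaussDecay hlam).memLp)).2
    (Lp.memLp _)

/-- The integral defining `hankel` makes sense on all of `ℝ^n` and is already `η`-symmetric, so it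
is the smooth extension itself; transforming back returns `g` up to a phase. -/
lemma IsTest.hankel_mem_rieszDomain (hlam : ∀ j, -1 / 2 < lam j) (η : Fin n → Fin 2)
    {g : (Fin n → ℝ) → ℂ} (hg : IsTest g) : hankel lam η g ∈ rieszDomain lam η := by
  have hf := hg.memLp_hankel hlam η
  refine ⟨hf, ⟨_, hg.contDiff_hankel hlam η, ?_⟩, _, (hg.const_mul (phase η)).1,
    (hg.const_mul (phase η)).2.1, (hg.const_mul (phase η)).2.2, ?_⟩
  · refine ae_w_of_signFlip fun ε => ?_
    filter_upwards [ae_mem_orthant lam] with x hx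
    rw [symmExt_signFlip η _ ε hx, hankel_signFlip]
  · have h := dunklL2_symmExt_ae_wPlus (η := η) hlam hf
    rw [hg.toLp_hankel hlam hf, hankelL2_hankelL2] at h
    filter_upwards [h, (hg.gaussDecay hlam).memLp.coeFn_toLp] with z h1 h2
    rw [h1, h2]

/-- The domain contains the image of the dense set of test functions under the unitary `H_η`, and is
therefore dense enough to determine a bounded operator. -/
lemma clm_ext_rieszDomain (hlam : ∀ j, -1 / 2 < lam j) (η : Fin n → Fin 2)
    {T : ((Fin n → ℝ) → ℂ) → (Fin n → ℝ) → ℂ}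
    {B B' : Lp ℂ 2 (wPlus lam) →L[ℂ] Lp ℂ 2 (wPlus lam)}
    (hB : ∀ f ∈ rieszDomain lam η, ∀ hf : MemLp f 2 (wPlus lam), B (hf.toLp f) =ᵐ[wPlus lam] T f)
    (hB' : ∀ f ∈ rieszDomain lam η, ∀ hf : MemLp f 2 (wPlus lam),
      B' (hf.toLp f) =ᵐ[wPlus lam] T f) : B = B' := by
  have hd : Dense {F : Lp ℂ 2 (wPlus lam) | ∃ g, ∃ hg : MemLp g 2 (wPlus lam), IsTest g ∧
      hg.toLp g = F} := by
    rw [Metric.dense_iff]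
    intro F r hr
    obtain ⟨g, hg, hle⟩ := exists_isTest_eLpNorm_sub_lt hlam (Lp.memLp F) (half_pos hr)
    refine ⟨(hg.gaussDecay hlam).memLp.toLp g, ?_, g, _, hg, rfl⟩
    rw [Metric.mem_ball, dist_edist, ← Lp.toLp_coeFn F (Lp.memLp F), Lp.edist_toLp_toLp]
    exact (ENNReal.toReal_le_of_le_ofReal (half_pos hr).le hle).trans_lt (half_lt_self hr)
  have h : B.comp (hankelL2 hlam η) = B'.comp (hankelL2 hlam η) := by
    refine ContinuousLinearMap.ext_on (s := {F : Lp ℂ 2 (wPlus lam) |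
      ∃ g, ∃ hg : MemLp g 2 (wPlus lam), IsTest g ∧ hg.toLp g = F})
      (hd.mono Submodule.subset_span) ?_
    rintro F ⟨g, hg', hg, rfl⟩
    have hm := hg.hankel_mem_rieszDomain hlam η
    have hf := hg.memLp_hankel hlam η
    have h1 := (hB _ hm hf).trans (hB' _ hm hf).symm
    rw [hg.toLp_hankel hlam hf] at h1
    exact Lp.ext h1
  ext1 F
  have := DFunLike.congr_fun h (hankelL2 hlam η F)
  simpa using this

/-- The symbol `|z|^{-m}`. -/
def rieszSymbol (m : ℕ) (z : Fin n → ℝ) : ℂ := ((Real.sqrt (normSq z) : ℂ) ^ m)⁻¹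

lemma norm_rieszSymbol (m : ℕ) (z : Fin n → ℝ) :
    ‖rieszSymbol m z‖ = (Real.sqrt (normSq z) ^ m)⁻¹ := by
  rw [rieszSymbol, norm_inv, norm_pow, Complex.norm_real, Real.norm_of_nonneg (Real.sqrt_nonneg _)]

lemma measurable_rieszSymbol (m : ℕ) : Measurable (rieszSymbol (n := n) m) := by
  have := (continuous_normSq (n := n)).measurable
  unfold rieszSymbol
  fun_prop

lemma norm_monomial_mul_rieszSymbol_le (M : Fin n → ℕ) (z : Fin n → ℝ) :
    ‖monomial M z * rieszSymbol (∑ j, M j) z‖ ≤ 1 := by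
  rw [norm_mul, norm_rieszSymbol]
  have h : ‖monomial M z‖ ≤ Real.sqrt (normSq z) ^ (∑ j, M j) := by
    refine le_of_sq_le_sq ?_ (by positivity)
    rw [← pow_mul, mul_comm _ 2, pow_mul, Real.sq_sqrt (normSq_nonneg z)]
    exact norm_monomial_le M z
  exact (mul_le_mul_of_nonneg_right h (by positivity)).trans mul_inv_le_one

/-- The support is compact and misses the origin, so the singularity of `|z|^{-m}` plays no role on
it. With `n = 0` the orthant would contain the origin. -/
lemma IsTest.exists_le_normSq (hn : n ≠ 0) {g : (Fin n → ℝ) → ℂ} (hg : IsTest g) :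
    ∃ c > 0, ∀ z ∈ tsupport g, c ≤ normSq z := by
  refine hg.2.1.isCompact.exists_forall_le' continuous_normSq.continuousOn fun z hz => ?_
  have hz' := hg.2.2 hz ⟨0, Nat.pos_of_ne_zero hn⟩
  exact (pow_pos hz' 2).trans_le (sq_le_normSq z _)

lemma IsTest.gaussDecay_rieszSymbol (hlam : ∀ j, -1 / 2 < lam j) (hn : n ≠ 0)
    {g : (Fin n → ℝ) → ℂ} (hg : IsTest g) (m : ℕ) :
    GaussDecay lam fun z => rieszSymbol m z * g z := by
  obtain ⟨c, hc, hle⟩ := hg.exists_le_normSq hn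
  refine (hg.gaussDecay hlam).mono ((measurable_rieszSymbol m).aestronglyMeasurable.mul
    (hg.gaussDecay hlam).aestronglyMeasurable) fun s hs =>
      ⟨(Real.sqrt c ^ m)⁻¹, ae_of_all _ fun z => ?_⟩
  by_cases hz : z ∈ tsupport g
  · have h1 : 1 ≤ Real.exp (s * normSq z) :=
      Real.one_le_exp (by have := normSq_nonneg z; positivity)
    have h2 := Real.sqrt_pos.2 hc
    rw [norm_mul, norm_rieszSymbol]
    refine mul_le_mul_of_nonneg_right (le_trans ?_ (le_mul_of_one_le_right (by positivity) h1))
      (norm_nonneg _)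
    have h3 := Real.sqrt_le_sqrt (hle z hz)
    gcongr
  · rw [image_eq_zero_of_notMem_tsupport hz]
    simp

theorem extendsBoundedL2_rieszOp (hlam : ∀ j, -1 / 2 < lam j) (η : Fin n → Fin 2)
    (M : Fin n → ℕ) (hM : 0 < ∑ j, M j) :
    ExtendsBoundedL2 lam (rieszDomain lam η) (rieszOp lam η M) := by
  have hn : n ≠ 0 := by
    rintro rfl
    simp at hM
  obtain ⟨η', c, hc, hdelta⟩ := exists_delta_eq hlam η M
  have hmeas : AEStronglyMeasurable
      (fun z => c * (monomial M z * rieszSymbol (∑ j, M j) z)) (wPlus lam) :=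
    ((continuous_monomial M).aestronglyMeasurable.mul
      (measurable_rieszSymbol _).aestronglyMeasurable).const_mul c
  obtain ⟨T, hT⟩ := exists_mulCLM hmeas (C := 1) (ae_of_all _ fun z => by
    rw [norm_mul, hc, one_mul]
    exact norm_monomial_mul_rieszSymbol_le M z)
  refine existsUnique_of_exists_of_unique
    ⟨(hankelL2 hlam η').comp (T.comp (hankelL2 hlam η)), fun f hfD hf => ?_⟩
    fun B B' hB hB' => clm_ext_rieszDomain hlam η hB hB'
  obtain ⟨-, -, g, hg1, hg2, hg3, hfg⟩ := hfD
  have hg : IsTest g := ⟨hg1, hg2, hg3⟩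
  set F := hankelL2 hlam η (hf.toLp f) with hF
  -- The domain condition concerns the Dunkl transform; dividing by the phase shows that `H_η f`
  -- itself is almost everywhere a test function.
  have hFg : F =ᵐ[wPlus lam] fun z => (phase η)⁻¹ * g z := by
    have hp : phase η ≠ 0 := norm_ne_zero_iff.1 (by rw [norm_phase]; exact one_ne_zero)
    filter_upwards [dunklL2_symmExt_ae_wPlus (η := η) hlam hf, hfg] with z h1 h2
    rw [← h2, h1, inv_mul_cancel_left₀ hp]
  have hdec : GaussDecay lam fun z => rieszSymbol (∑ j, M j) z * F z := by
    refine ((hg.const_mul (phase η)⁻¹).gaussDecay_rieszSymbol hlam hn (∑ j, M j)).congr ?_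
    filter_upwards [hFg] with z hz
    rw [hz]
  have hdec' := (hdec.monomial_mul M).const_mul c
  have h1 := hdelta (dunklInv lam fun z =>
    rieszSymbol (∑ j, M j) z * dunklL2 lam (symmExt η f) z) _
    (fun x _ => dunklInv_mul_dunklL2 η hlam hf
      (fun ε z => by rw [rieszSymbol, rieszSymbol, normSq_signFlip]) hdec x) hdec
  have h2 : hdec'.memLp.toLp _ = T F := by
    rw [← Lp.toLp_coeFn (T F) (Lp.memLp _), MemLp.toLp_eq_toLp_iff]
    filter_upwards [hT F] with z hz
    rw [hz]; ring
  have h3 := hankel_ae_eq hlam η' hdec' hdec'.memLp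
  rw [h2] at h3
  filter_upwards [h3, ae_mem_orthant lam] with x hx hx'
  exact hx.symm.trans (h1 x hx').symm

end
end DunklBessel
end

noncomputable section

namespace DunklBessel

/-! ### The heat kernel -/

/-- The kernel of `𝕎_t^{λ,η,+}` with respect to `dw_λ^+`. -/
def heatKernel {n : ℕ} (lam : Fin n → ℝ) (η : Fin n → Fin 2) (t : ℝ) (x y : Fin n → ℝ) : ℝ :=
  ∏ j, (x j * y j) ^ (η j : ℕ) * (2 * t) ^ (-(lam j + (η j : ℕ) + 1 / 2) : ℝ) *
    besselSeries (lam j + (η j : ℕ)) ((x j * y j / (4 * t)) ^ 2) *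
      Real.exp (-((x j ^ 2 + y j ^ 2) / (4 * t)))

section
variable {n : ℕ} {lam : Fin n → ℝ} (η : Fin n → Fin 2)

lemma heatKernel_comm (t : ℝ) (x y : Fin n → ℝ) :
    heatKernel lam η t x y = heatKernel lam η t y x := by
  unfold heatKernel
  refine Finset.prod_congr rfl fun j _ => ?_
  rw [mul_comm (x j), add_comm (x j ^ 2)]

lemma heatKernel_nonneg (hlam : ∀ j, -1 / 2 < lam j) {t : ℝ} (ht : 0 < t) {x y : Fin n → ℝ}
    (hx : x ∈ orthant n) (hy : y ∈ orthant n) : 0 ≤ heatKernel lam η t x y :=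
  Finset.prod_nonneg fun j _ => by
    have h1 := (hx j).le
    have h2 := (hy j).le
    have h3 := besselSeries_nonneg (order_gt hlam η j) (sq_nonneg (x j * y j / (4 * t)))
    positivity

lemma heatKernel_zero_nonneg (hlam : ∀ j, -1 / 2 < lam j) {t : ℝ} (ht : 0 < t)
    (x y : Fin n → ℝ) : 0 ≤ heatKernel lam 0 t x y :=
  Finset.prod_nonneg fun j _ => by
    have h3 := besselSeries_nonneg (order_gt hlam 0 j) (sq_nonneg (x j * y j / (4 * t)))
    simp only [Pi.zero_apply, Fin.val_zero, pow_zero] at h3 ⊢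
    positivity

lemma continuous_heatKernel (hlam : ∀ j, -1 / 2 < lam j) (t : ℝ) :
    Continuous fun p : (Fin n → ℝ) × (Fin n → ℝ) => heatKernel lam η t p.1 p.2 := by
  unfold heatKernel
  refine continuous_finsetProd _ fun j _ => ?_
  have h : Continuous fun p : (Fin n → ℝ) × (Fin n → ℝ) =>
      besselSeries (lam j + (η j : ℕ)) ((p.1 j * p.2 j / (4 * t)) ^ 2) :=
    (contDiff_besselSeries (order_gt hlam η j)).continuous.comp (by fun_prop)
  fun_prop

lemma continuous_heatKernel_right (hlam : ∀ j, -1 / 2 < lam j) (t : ℝ) (x : Fin n → ℝ) :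
    Continuous (heatKernel lam η t x) :=
  (continuous_heatKernel η hlam t).comp (Continuous.prodMk_right x)

/-- In each coordinate this is `integral_besselSeries_mul_exp` with a positive `c = (x_j/(4t))²`.
The value `b = 0` is admitted to obtain the total mass in type `0`. -/
lemma integral_heatKernel_mul_gauss (hlam : ∀ j, -1 / 2 < lam j) {t : ℝ} (ht : 0 < t)
    {b : Fin n → ℝ} (hb : ∀ j, 0 ≤ b j) (x : Fin n → ℝ) :
    ∫ y, heatKernel lam η t x y * gauss η b y ∂wPlus lam =
      gaussScale lam η (fun j => 1 + 2 * t * b j) *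
        gauss η (fun j => b j / (1 + 2 * t * b j)) x := by
  unfold gauss gaussScale heatKernel
  simp_rw [← Finset.prod_mul_distrib]
  rw [integral_wPlus_prod lam (fun j y =>
    (x j * y) ^ (η j : ℕ) * (2 * t) ^ (-(lam j + (η j : ℕ) + 1 / 2) : ℝ) *
    besselSeries (lam j + (η j : ℕ)) ((x j * y / (4 * t)) ^ 2) *
      Real.exp (-((x j ^ 2 + y ^ 2) / (4 * t))) *
      (y ^ (η j : ℕ) * Real.exp (-(b j * y ^ 2 / 2))))]
  refine Finset.prod_congr rfl fun j _ => ?_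
  have hbj := hb j
  have hB : 0 < b j + 1 / (2 * t) := by positivity
  have h := integral_besselSeries_mul_exp ((x j / (4 * t)) ^ 2) (order_gt hlam η j) hB
  have e1 : 1 + 2 * t * b j = 2 * t * (b j + 1 / (2 * t)) := by field_simp; ring
  have e2 : Real.exp (-(b j / (1 + 2 * t * b j) * x j ^ 2 / 2)) =
      Real.exp (-(x j ^ 2 / (4 * t))) *
        Real.exp (2 * (x j / (4 * t)) ^ 2 / (b j + 1 / (2 * t))) := by
    rw [← Real.exp_add]
    congr 1
    rw [e1]
    field_simp
    ring
  rw [e2, e1, Real.mul_rpow (by positivity) hB.le]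
  calc _ = ∫ y in Set.Ioi (0 : ℝ), ((2 * t) ^ (-(lam j + (η j : ℕ) + 1 / 2) : ℝ) * x j ^ (η j : ℕ) *
        Real.exp (-(x j ^ 2 / (4 * t)))) *
        (besselSeries (lam j + (η j : ℕ)) ((x j / (4 * t)) ^ 2 * y ^ 2) *
          Real.exp (-((b j + 1 / (2 * t)) * y ^ 2 / 2)) * y ^ (2 * (lam j + (η j : ℕ)))) := by
        refine setIntegral_congr_fun measurableSet_Ioi fun y hy => ?_
        have e3 : Real.exp (-((x j ^ 2 + y ^ 2) / (4 * t))) * Real.exp (-(b j * y ^ 2 / 2)) =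
            Real.exp (-(x j ^ 2 / (4 * t))) * Real.exp (-((b j + 1 / (2 * t)) * y ^ 2 / 2)) := by
          rw [← Real.exp_add, ← Real.exp_add]
          congr 1
          field_simp
          ring
        rw [← pow_mul_pow_mul_rpow _ _ hy, mul_pow,
          show (x j * y / (4 * t)) ^ 2 = (x j / (4 * t)) ^ 2 * y ^ 2 by ring]
        linear_combination x j ^ (η j : ℕ) * y ^ (η j : ℕ) *
          (2 * t) ^ (-(lam j + (η j : ℕ) + 1 / 2) : ℝ) *
          besselSeries (lam j + (η j : ℕ)) ((x j / (4 * t)) ^ 2 * y ^ 2) * y ^ (η j : ℕ) *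
          y ^ (2 * lam j) * e3
    _ = _ := by
        rw [integral_const_mul, h]
        ring

lemma integral_heatKernel_zero (hlam : ∀ j, -1 / 2 < lam j) {t : ℝ} (ht : 0 < t)
    (x : Fin n → ℝ) : ∫ y, heatKernel lam 0 t x y ∂wPlus lam = 1 := by
  have h := integral_heatKernel_mul_gauss 0 hlam ht (b := 0) (fun _ => le_rfl) x
  simpa [gauss, gaussScale] using h

lemma lintegral_heatKernel_zero (hlam : ∀ j, -1 / 2 < lam j) {t : ℝ} (ht : 0 < t)
    (x : Fin n → ℝ) : ∫⁻ y, ENNReal.ofReal (heatKernel lam 0 t x y) ∂wPlus lam = 1 := by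
  have h := integral_heatKernel_zero hlam ht x
  rw [← ofReal_integral_eq_lintegral_ofReal, h, ENNReal.ofReal_one]
  · exact Integrable.of_integral_ne_zero (by rw [h]; exact one_ne_zero)
  · exact ae_of_all _ fun y => heatKernel_zero_nonneg hlam ht x y

lemma exists_abs_heatKernel_le (hlam : ∀ j, -1 / 2 < lam j) {t : ℝ} (ht : 0 < t)
    (x : Fin n → ℝ) :
    ∃ C, ∀ y, |heatKernel lam η t x y| ≤ C * Real.exp (-(1 / (8 * t)) * normSq y) := by
  choose C hC hle using fun j => abs_besselSeries_le (order_gt hlam η j)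
  refine ⟨∏ j, |x j| ^ (η j : ℕ) * (2 * t) ^ (-(lam j + (η j : ℕ) + 1 / 2) : ℝ) * C j *
    Real.exp (2 * t * (1 + |x j| / t) ^ 2), fun y => ?_⟩
  rw [exp_neg_normSq, ← Finset.prod_mul_distrib, heatKernel, Finset.abs_prod]
  refine Finset.prod_le_prod (fun _ _ => abs_nonneg _) fun j _ => ?_
  have h1 := hle j ((x j * y j / (4 * t)) ^ 2)
  have e1 : 4 * √|(x j * y j / (4 * t)) ^ 2| = |x j| * |y j| / t := by
    rw [abs_of_nonneg (sq_nonneg _), Real.sqrt_sq_eq_abs, abs_div, abs_mul,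
      abs_of_pos (show 0 < 4 * t by positivity)]
    field_simp
  rw [e1] at h1
  have h2 : |y j| ^ (η j : ℕ) ≤ Real.exp |y j| := by
    have h3 := Real.add_one_le_exp |y j|
    have h4 := abs_nonneg (y j)
    generalize η j = e
    fin_cases e
    · simp
    · simp only [pow_one]; linarith
  have h3 : Real.exp |y j| * Real.exp (|x j| * |y j| / t) *
      Real.exp (-((x j ^ 2 + y j ^ 2) / (4 * t))) ≤
      Real.exp (2 * t * (1 + |x j| / t) ^ 2) * Real.exp (-(2 * (1 / (8 * t)) * y j ^ 2 / 2)) := by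
    rw [← Real.exp_add, ← Real.exp_add, ← Real.exp_add, Real.exp_le_exp, ← sq_abs (y j)]
    -- Completing the square: half of the available `|y_j|²/(4t)` absorbs all terms linear in
    -- `|y_j|`.
    have h5 : 0 ≤ (|y j| - 4 * t * (1 + |x j| / t)) ^ 2 / (8 * t) + x j ^ 2 / (4 * t) := by
      positivity
    have h6 : 2 * t * (1 + |x j| / t) ^ 2 + -(2 * (1 / (8 * t)) * |y j| ^ 2 / 2) -
        (|y j| + |x j| * |y j| / t + -((x j ^ 2 + |y j| ^ 2) / (4 * t))) =
        (|y j| - 4 * t * (1 + |x j| / t)) ^ 2 / (8 * t) + x j ^ 2 / (4 * t) := by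
      field_simp
      ring
    linarith
  have hCj := hC j
  rw [abs_mul, abs_mul, abs_mul, abs_pow, abs_mul, mul_pow, Real.abs_exp,
    abs_of_nonneg (Real.rpow_nonneg (by positivity : 0 ≤ 2 * t) _)]
  calc _ ≤ |x j| ^ (η j : ℕ) * Real.exp |y j| * (2 * t) ^ (-(lam j + (η j : ℕ) + 1 / 2) : ℝ) *
        (C j * Real.exp (|x j| * |y j| / t)) * Real.exp (-((x j ^ 2 + y j ^ 2) / (4 * t))) := by
        gcongr
    _ = |x j| ^ (η j : ℕ) * (2 * t) ^ (-(lam j + (η j : ℕ) + 1 / 2) : ℝ) * C j *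
        (Real.exp |y j| * Real.exp (|x j| * |y j| / t) *
          Real.exp (-((x j ^ 2 + y j ^ 2) / (4 * t)))) := by ring
    _ ≤ |x j| ^ (η j : ℕ) * (2 * t) ^ (-(lam j + (η j : ℕ) + 1 / 2) : ℝ) * C j *
        (Real.exp (2 * t * (1 + |x j| / t) ^ 2) *
          Real.exp (-(2 * (1 / (8 * t)) * y j ^ 2 / 2))) := by gcongr
    _ = _ := by ring

lemma memLp_heatKernel (hlam : ∀ j, -1 / 2 < lam j) {t : ℝ} (ht : 0 < t) (x : Fin n → ℝ) :
    MemLp (fun y => (heatKernel lam η t x y : ℂ)) 2 (wPlus lam) := by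
  obtain ⟨C, hC⟩ := exists_abs_heatKernel_le η hlam ht x
  refine (memLp_exp_neg_normSq hlam (s := 1 / (8 * t)) (by positivity)).of_le_mul (c := C)
    (Complex.continuous_ofReal.comp (continuous_heatKernel_right η hlam t x)).aestronglyMeasurable
    (ae_of_all _ fun y => ?_)
  rw [norm_ofReal_exp, Complex.norm_real]
  exact hC y

/-- The heat semigroup as an integral operator. -/
theorem hankel_exp_eq_integral (hlam : ∀ j, -1 / 2 < lam j) {t : ℝ} (ht : 0 < t)
    (F : Lp ℂ 2 (wPlus lam)) (x : Fin n → ℝ) :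
    hankel lam η (fun z => (Real.exp (-t * normSq z) : ℂ) * hankelL2 hlam η F z) x =
      ∫ y, (heatKernel lam η t x y : ℂ) * F y ∂wPlus lam := by
  have hk : MemLp (fun z => ((Real.exp (-t * normSq z) * hankelKernel lam η x z : ℝ) : ℂ)) 2
      (wPlus lam) := by
    obtain ⟨C, hC, hle⟩ := abs_hankelKernel_le η hlam
    have h0 := (memLp_exp_neg_normSq hlam (half_pos ht)).const_mul
      ((C * Real.exp (9 / (4 * (t / 2)) * normSq x) : ℝ) : ℂ)
    refine h0.of_le (Continuous.aestronglyMeasurable ?_) (ae_of_all _ fun z => ?_)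
    · have h1 := continuous_hankelKernel_right η hlam x
      have h2 := continuous_normSq (n := n)
      fun_prop
    · rw [Complex.norm_real, norm_mul, norm_mul, norm_ofReal_exp, Complex.norm_real,
        Real.norm_of_nonneg (Real.exp_pos _).le, Real.norm_eq_abs,
        Real.norm_of_nonneg (by positivity)]
      calc Real.exp (-t * normSq z) * |hankelKernel lam η x z|
          ≤ Real.exp (-t * normSq z) *
            (C * Real.exp (9 / (4 * (t / 2)) * normSq x + t / 2 * normSq z)) := by
            gcongr
            exact hle (t / 2) (half_pos ht) x z
        _ = C * Real.exp (9 / (4 * (t / 2)) * normSq x) * Real.exp (-(t / 2) * normSq z) := by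
            rw [mul_left_comm, mul_assoc, ← Real.exp_add, ← Real.exp_add]
            congr 2
            ring
  -- Both sides are continuous functionals of `F`, so agreement on Gaussians suffices, and there
  -- both are explicit.
  have key : (innerSL ℂ (hk.toLp _)).comp (hankelL2 hlam η) =
      innerSL ℂ ((memLp_heatKernel η hlam ht x).toLp _) := by
    refine clm_ext_gaussLp hlam η fun a => ?_
    have hb : ∀ j, 0 < (a.1 j)⁻¹ + 2 * t := fun j => by have := a.2 j; positivity
    rw [ContinuousLinearMap.comp_apply, innerSL_apply_apply, innerSL_apply_apply, hankelL2_gaussLp,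
      gaussDualLp, inner_smul_right, inner_toLp_ofReal, inner_toLp_ofReal]
    have e1 : ∫ z, ((Real.exp (-t * normSq z) * hankelKernel lam η x z : ℝ) : ℂ) *
        gaussLp hlam η ⟨fun j => (a.1 j)⁻¹, fun j => inv_pos.2 (a.2 j)⟩ z ∂wPlus lam =
        ((gaussScale lam η (fun j => (a.1 j)⁻¹ + 2 * t) *
          gauss η (fun j => ((a.1 j)⁻¹ + 2 * t)⁻¹) x : ℝ) : ℂ) := by
      rw [← integral_hankelKernel_mul_gauss η hlam hb x, ← integral_complex_ofReal]
      refine integral_congr_ae ?_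
      filter_upwards [(memLp_gauss hlam η (a := fun j => (a.1 j)⁻¹)
        fun j => inv_pos.2 (a.2 j)).coeFn_toLp] with z hz
      rw [gaussLp, hz, ← exp_mul_gauss]
      push_cast; ring
    have e2 : ∫ y, (heatKernel lam η t x y : ℂ) * gaussLp hlam η a y ∂wPlus lam =
        ((gaussScale lam η (fun j => 1 + 2 * t * a.1 j) *
        gauss η (fun j => a.1 j / (1 + 2 * t * a.1 j)) x : ℝ) : ℂ) := by
      rw [← integral_heatKernel_mul_gauss η hlam ht (fun j => (a.2 j).le) x,
        ← integral_complex_ofReal]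
      refine integral_congr_ae ?_
      filter_upwards [(memLp_gauss hlam η a.2).coeFn_toLp] with z hz
      rw [gaussLp, hz]
      push_cast; ring
    rw [e1, e2, ← Complex.ofReal_mul, ← mul_assoc,
      gaussScale_mul η (fun j => (a.2 j).le) fun j => (hb j).le]
    congr 3
    · funext j
      have := (a.2 j).ne'
      field_simp
    · funext j
      have := (a.2 j).ne'
      field_simp
  have h := DFunLike.congr_fun key F
  rw [ContinuousLinearMap.comp_apply, innerSL_apply_apply, innerSL_apply_apply, inner_toLp_ofReal,
    inner_toLp_ofReal] at h
  rw [← h, hankel]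
  refine integral_congr_ae (ae_of_all _ fun z => ?_)
  simp only
  push_cast; ring

/-- Factor by factor, the odd type costs `x_j y_j/(2t) = 2u` with `u = x_j y_j/(4t)` and raises the
order by one, and `mul_besselSeries_succ_le` bounds this by `2C`. The constant `1 + 2C` serves both
types. -/
lemma exists_heatKernel_le (hlam : ∀ j, -1 / 2 < lam j) :
    ∃ C : ℝ, 0 ≤ C ∧ ∀ t > 0, ∀ x ∈ orthant n, ∀ y ∈ orthant n,
      heatKernel lam η t x y ≤ C * heatKernel lam 0 t x y := by
  choose C hC hle using fun j => mul_besselSeries_succ_le (hlam j)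
  refine ⟨∏ j, (1 + 2 * C j), Finset.prod_nonneg fun j _ => by have := hC j; positivity,
    fun t ht x hx y hy => ?_⟩
  unfold heatKernel
  rw [← Finset.prod_mul_distrib]
  refine Finset.prod_le_prod (fun j _ => ?_) fun j _ => ?_
  · have h1 := (hx j).le
    have h2 := (hy j).le
    have h3 := besselSeries_nonneg (order_gt hlam η j) (sq_nonneg (x j * y j / (4 * t)))
    positivity
  · have hxj := hx j
    have hyj := hy j
    have hCj := hC j
    have h0 := besselSeries_nonneg (hlam j) (sq_nonneg (x j * y j / (4 * t)))
    have h1 := hle j (x j * y j / (4 * t)) (by positivity)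
    generalize η j = e
    fin_cases e
    · simp only [Fin.val_zero, pow_zero, one_mul, Nat.cast_zero, add_zero, Pi.zero_apply]
      refine le_mul_of_one_le_left (by positivity) (by linarith)
    · simp only [pow_one, Nat.cast_one, pow_zero, one_mul, Pi.zero_apply,
        Fin.val_zero, Nat.cast_zero, add_zero]
      have e1 : (2 * t) ^ (-(lam j + 1 + 1 / 2)) = (2 * t) ^ (-(lam j + 1 / 2)) / (2 * t) := by
        rw [show -(lam j + 1 + 1 / 2) = -(lam j + 1 / 2) - 1 by ring,
          Real.rpow_sub_one (by positivity)]
      rw [e1]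
      calc _ = 2 * ((2 * t) ^ (-(lam j + 1 / 2)) * (x j * y j / (4 * t) *
            besselSeries (lam j + 1) ((x j * y j / (4 * t)) ^ 2)) *
              Real.exp (-((x j ^ 2 + y j ^ 2) / (4 * t)))) := by
            field_simp
            ring
        _ ≤ 2 * ((2 * t) ^ (-(lam j + 1 / 2)) * (C j *
            besselSeries (lam j) ((x j * y j / (4 * t)) ^ 2)) *
              Real.exp (-((x j ^ 2 + y j ^ 2) / (4 * t)))) := by gcongr
        _ = 2 * C j * ((2 * t) ^ (-(lam j + 1 / 2)) *
            besselSeries (lam j) ((x j * y j / (4 * t)) ^ 2) *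
              Real.exp (-((x j ^ 2 + y j ^ 2) / (4 * t)))) := by ring
        _ ≤ _ := by
            gcongr
            linarith

end
end DunklBessel
end

noncomputable section

namespace DunklBessel

/-! ### The Hopf maximal inequality -/

section Hopf
variable {X : Type*} {a : ℕ → X → ℝ≥0∞}

/-- The maximal function of the averages of `a_0, …, a_{N-1}`. -/
def maxAverage (a : ℕ → X → ℝ≥0∞) (N : ℕ) (x : X) : ℝ≥0∞ :=
  (Finset.range N).sup fun k => (∑ i ∈ Finset.range (k + 1), a i x) / (k + 1 : ℕ)

/-- The maximal function of the partial sums of `a_k - s`. -/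
def maxExcess (a : ℕ → X → ℝ≥0∞) (s : ℝ≥0) (N : ℕ) (x : X) : ℝ≥0∞ :=
  (Finset.range N).sup fun k => ∑ i ∈ Finset.range (k + 1), a i x - ((k + 1 : ℕ) : ℝ≥0∞) * s

lemma maxExcess_pos_iff (s : ℝ≥0) (N : ℕ) (x : X) :
    0 < maxExcess a s N x ↔ s < maxAverage a N x := by
  unfold maxExcess maxAverage
  rw [Finset.lt_sup_iff, Finset.lt_sup_iff]
  refine exists_congr fun k => and_congr_right fun _ => ?_
  rw [tsub_pos_iff_lt, ENNReal.lt_div_iff_mul_lt (by simp) (by simp), mul_comm]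

lemma maxExcess_le_sum (s : ℝ≥0) (N : ℕ) (x : X) :
    maxExcess a s N x ≤ ∑ i ∈ Finset.range N, (a i x - s) := by
  refine Finset.sup_le fun k hk => ?_
  rw [tsub_le_iff_right]
  calc ∑ i ∈ Finset.range (k + 1), a i x ≤ ∑ i ∈ Finset.range (k + 1), ((a i x - s) + s) :=
        Finset.sum_le_sum fun i _ => le_tsub_add
    _ = ∑ i ∈ Finset.range (k + 1), (a i x - s) + ((k + 1 : ℕ) : ℝ≥0∞) * s := by
        rw [Finset.sum_add_distrib, Finset.sum_const, Finset.card_range, nsmul_eq_mul]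
    _ ≤ _ := by
        gcongr
        exact Finset.mem_range.1 hk

/-! ### From a weak type estimate to an `L²` estimate -/

variable [MeasurableSpace X] {μ : Measure X}

/-- The weights are chosen so that the `b²` term can be absorbed with coefficient `1/2`, which
produces the constant `4`. -/
lemma two_mul_mul_le_add (a b : ℝ≥0∞) : 2 * (a * b) ≤ 2 * a ^ 2 + b ^ 2 / 2 := by
  rcases eq_or_ne a ∞ with rfl | ha
  · simp
  rcases eq_or_ne b ∞ with rfl | hb
  · simp [ENNReal.top_div]
  lift a to ℝ≥0 using ha
  lift b to ℝ≥0 using hb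
  have h : 2 * (a * b) ≤ 2 * a ^ 2 + b ^ 2 / 2 := by
    rw [← NNReal.coe_le_coe]
    push_cast
    nlinarith [sq_nonneg (2 * (a : ℝ) - b)]
  have h2 : ((b ^ 2 / 2 : ℝ≥0) : ℝ≥0∞) = (b : ℝ≥0∞) ^ 2 / 2 := by
    rw [ENNReal.coe_div two_ne_zero]; norm_cast
  rw [← h2]
  exact_mod_cast h

lemma lintegral_indicator_lt_le (c : ℝ≥0∞) :
    ∫⁻ s in Set.Ioi (0 : ℝ), {s | ENNReal.ofReal s < c}.indicator 1 s ≤ c := by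
  rcases eq_or_ne c ∞ with rfl | hc
  · exact le_top
  have hm : MeasurableSet {s : ℝ | ENNReal.ofReal s < c} :=
    measurableSet_lt ENNReal.measurable_ofReal measurable_const
  rw [lintegral_indicator_one hm, Measure.restrict_apply hm]
  calc volume ({s : ℝ | ENNReal.ofReal s < c} ∩ Set.Ioi 0) ≤ volume (Set.Ioo 0 c.toReal) :=
        measure_mono fun s hs => ⟨hs.2, (ENNReal.ofReal_lt_iff_lt_toReal (le_of_lt hs.2) hc).1 hs.1⟩
    _ = c := by rw [Real.volume_Ioo, sub_zero, ENNReal.ofReal_toReal hc]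

lemma sq_le_lintegral_indicator_lt {c : ℝ≥0∞} (hc : c ≠ ∞) :
    c ^ 2 ≤ ∫⁻ s in Set.Ioi (0 : ℝ),
      ENNReal.ofReal (2 * s) * {s | ENNReal.ofReal s < c}.indicator 1 s := by
  have h0 := ENNReal.toReal_nonneg (a := c)
  have h1 : ∫ s in (0 : ℝ)..c.toReal, 2 * s = c.toReal ^ 2 := by
    rw [intervalIntegral.integral_const_mul, integral_id]; ring
  calc c ^ 2 = ENNReal.ofReal (∫ s in Set.Ioc 0 c.toReal, 2 * s) := by
        rw [← intervalIntegral.integral_of_le h0, h1, ENNReal.ofReal_pow h0,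
          ENNReal.ofReal_toReal hc]
    _ = ∫⁻ s in Set.Ioc 0 c.toReal, ENNReal.ofReal (2 * s) := by
        refine ofReal_integral_eq_lintegral_ofReal ?_ ?_
        · exact (Continuous.intervalIntegrable (by fun_prop) _ _).1
        · filter_upwards [self_mem_ae_restrict measurableSet_Ioc] with s hs
          have := hs.1
          positivity
    _ = ∫⁻ s in Set.Ioo 0 c.toReal, ENNReal.ofReal (2 * s) :=
        setLIntegral_congr Ioo_ae_eq_Ioc.symm
    _ = ∫⁻ s in Set.Ioo 0 c.toReal,
          ENNReal.ofReal (2 * s) * {s | ENNReal.ofReal s < c}.indicator 1 s := by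
        refine setLIntegral_congr_fun measurableSet_Ioo fun s hs => ?_
        rw [Set.indicator_of_mem
          (by exact (ENNReal.ofReal_lt_iff_lt_toReal hs.1.le hc).2 hs.2), Pi.one_apply, mul_one]
    _ ≤ _ := lintegral_mono_set Set.Ioo_subset_Ioi_self

/-- A weak type estimate of Doob type implies an `L²` estimate. -/
lemma lintegral_sq_le_of_weak [SFinite μ] {f g : X → ℝ≥0∞} (hf : Measurable f) (hg : Measurable g)
    (hfin : ∫⁻ x, f x ^ 2 ∂μ ≠ ∞)
    (h : ∀ s : ℝ≥0, s ≠ 0 → s * μ {x | s < f x} ≤ ∫⁻ x in {x | s < f x}, g x ∂μ) :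
    ∫⁻ x, f x ^ 2 ∂μ ≤ 4 * ∫⁻ x, g x ^ 2 ∂μ := by
  have hset : MeasurableSet {q : X × ℝ | ENNReal.ofReal q.2 < f q.1} :=
    measurableSet_lt (by fun_prop) (by fun_prop)
  have hset' : ∀ s : ℝ, MeasurableSet {x | ENNReal.ofReal s < f x} := fun s =>
    measurableSet_lt measurable_const hf
  have hind : Measurable fun q : X × ℝ => {s | ENNReal.ofReal s < f q.1}.indicator
      (1 : ℝ → ℝ≥0∞) q.2 :=
    measurable_const.indicator hset (f := fun _ : X × ℝ => (1 : ℝ≥0∞))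
  have hind' : ∀ (s : ℝ) (x : X), {s | ENNReal.ofReal s < f x}.indicator (1 : ℝ → ℝ≥0∞) s =
      {x | ENNReal.ofReal s < f x}.indicator 1 x := fun s x => rfl
  -- Layer cake: write `f² = ∫ 2s 1_{s<f} ds`, apply the weak estimate at each height `s`, and
  -- integrate back.
  have key : ∫⁻ x, f x ^ 2 ∂μ ≤ ∫⁻ x, 2 * (g x * f x) ∂μ := by
    calc ∫⁻ x, f x ^ 2 ∂μ
        ≤ ∫⁻ x, (∫⁻ s in Set.Ioi (0 : ℝ), ENNReal.ofReal (2 * s) *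
            {s | ENNReal.ofReal s < f x}.indicator 1 s) ∂μ := by
          refine lintegral_mono_ae ?_
          filter_upwards [ae_lt_top (hf.pow_const 2) hfin] with x hx
          refine sq_le_lintegral_indicator_lt fun h => ?_
          rw [h] at hx
          simp at hx
      _ = ∫⁻ s in Set.Ioi (0 : ℝ), (∫⁻ x, ENNReal.ofReal (2 * s) *
            {s | ENNReal.ofReal s < f x}.indicator 1 s ∂μ) := by
          refine lintegral_lintegral_swap ?_
          exact (Measurable.mul (by fun_prop) hind).aemeasurable
      _ ≤ ∫⁻ s in Set.Ioi (0 : ℝ), (∫⁻ x, 2 * g x *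
            {s | ENNReal.ofReal s < f x}.indicator 1 s ∂μ) := by
          refine setLIntegral_mono' measurableSet_Ioi fun s hs => ?_
          have hs0 : (0 : ℝ) < s := hs
          simp_rw [hind']
          have h1 := h s.toNNReal (by simpa using hs0)
          rw [lintegral_const_mul _ (measurable_one.indicator (hset' s)),
            lintegral_indicator_one (hset' s), ENNReal.ofReal_mul two_pos.le, mul_assoc]
          have e1 : ∀ x, 2 * g x * {x | ENNReal.ofReal s < f x}.indicator 1 x =
              2 * {x | ENNReal.ofReal s < f x}.indicator g x := fun x => by
            by_cases hx : x ∈ {x | ENNReal.ofReal s < f x}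
            · rw [Set.indicator_of_mem hx, Set.indicator_of_mem hx, Pi.one_apply, mul_one]
            · rw [Set.indicator_of_notMem hx, Set.indicator_of_notMem hx, mul_zero, mul_zero]
          simp_rw [e1]
          rw [lintegral_const_mul _ (hg.indicator (hset' s)), lintegral_indicator (hset' s)]
          rw [ENNReal.ofReal_ofNat]
          gcongr
          exact h1
      _ = ∫⁻ x, (∫⁻ s in Set.Ioi (0 : ℝ), 2 * g x *
            {s | ENNReal.ofReal s < f x}.indicator 1 s) ∂μ := by
          refine (lintegral_lintegral_swap ?_).symm
          exact (Measurable.mul (by fun_prop) hind).aemeasurable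
      _ ≤ ∫⁻ x, 2 * (g x * f x) ∂μ := by
          refine lintegral_mono fun x => ?_
          rw [lintegral_const_mul _ (measurable_one.indicator
            (measurableSet_lt ENNReal.measurable_ofReal measurable_const)), mul_assoc]
          gcongr
          exact lintegral_indicator_lt_le _
  set I := ∫⁻ x, f x ^ 2 ∂μ with hI
  have h2 : I ≤ 2 * ∫⁻ x, g x ^ 2 ∂μ + I / 2 := by
    calc I ≤ ∫⁻ x, (2 * g x ^ 2 + f x ^ 2 / 2) ∂μ :=
          key.trans (lintegral_mono fun x => two_mul_mul_le_add _ _)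
      _ = _ := by
          simp_rw [div_eq_mul_inv]
          rw [lintegral_add_left (by fun_prop), lintegral_const_mul _ (by fun_prop),
            lintegral_mul_const _ (by fun_prop)]
  -- The a priori finiteness of the left side is what permits subtracting `I / 2`.
  have h3 : I / 2 ≠ ∞ := (ENNReal.div_lt_top hfin two_ne_zero).ne
  nth_rw 1 [← ENNReal.add_halves I] at h2
  have h4 := (ENNReal.add_le_add_iff_right h3).1 h2
  calc I = 2 * (I / 2) := (ENNReal.mul_div_cancel two_ne_zero ENNReal.ofNat_ne_top).symm
    _ ≤ 2 * (2 * ∫⁻ x, g x ^ 2 ∂μ) := by gcongr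
    _ = _ := by rw [← mul_assoc]; norm_num

variable {κ : X → X → ℝ≥0∞}

lemma measurable_maxAverage (ha : ∀ k, Measurable (a k)) (N : ℕ) : Measurable (maxAverage a N) := by
  unfold maxAverage
  simp_rw [Finset.sup_eq_iSup]
  exact Measurable.iSup fun k => Measurable.iSup fun _ =>
    (Finset.measurable_sum _ fun i _ => ha i).div_const _

lemma measurable_maxExcess (ha : ∀ k, Measurable (a k)) (s : ℝ≥0) (N : ℕ) :
    Measurable (maxExcess a s N) := by
  unfold maxExcess
  simp_rw [Finset.sup_eq_iSup]
  exact Measurable.iSup fun k => Measurable.iSup fun _ =>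
    (Finset.measurable_sum _ fun i _ => ha i).sub_const _

lemma sum_range_succ_le (hκ : Measurable (Function.uncurry κ)) (ha : ∀ k, Measurable (a k))
    (h : ∀ k x, a (k + 1) x ≤ ∫⁻ y, κ x y * a k y ∂μ) (m : ℕ) (x : X) :
    ∑ i ∈ Finset.range (m + 1), a i x ≤
      a 0 x + ∫⁻ y, κ x y * ∑ i ∈ Finset.range m, a i y ∂μ := by
  have hκx : Measurable (κ x) := hκ.comp measurable_prodMk_left
  simp_rw [Finset.mul_sum]
  rw [Finset.sum_range_succ', add_comm,
    lintegral_finsetSum (f := fun i y => κ x y * a i y) _ fun i _ => hκx.mul (ha i)]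
  gcongr
  exact h _ _

/-- The core of Hopf's argument. If the maximum is positive it is attained by some sum of `m + 1`
terms; removing `a_0` leaves at most `κ` applied to a sum of `m` terms, whose excess is again at
most the maximal one. -/
lemma maxExcess_add_le (hκ : Measurable (Function.uncurry κ)) (ha : ∀ k, Measurable (a k))
    (hκ1 : ∀ x, ∫⁻ y, κ x y ∂μ ≤ 1) (h : ∀ k x, a (k + 1) x ≤ ∫⁻ y, κ x y * a k y ∂μ)
    {s : ℝ≥0} {N : ℕ} {x : X} (hx : 0 < maxExcess a s N x) :
    maxExcess a s N x + s ≤ a 0 x + ∫⁻ y, κ x y * maxExcess a s N y ∂μ := by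
  have hκx : Measurable (κ x) := hκ.comp measurable_prodMk_left
  have hN : (Finset.range N).Nonempty := by
    rw [Finset.nonempty_iff_ne_empty]
    intro h0
    rw [maxExcess, h0] at hx
    simp at hx
  obtain ⟨m, hm, he⟩ := Finset.exists_mem_eq_sup (Finset.range N) hN
    fun k => ∑ i ∈ Finset.range (k + 1), a i x - ((k + 1 : ℕ) : ℝ≥0∞) * s
  change maxExcess a s N x = _ at he
  have hle : ((m + 1 : ℕ) : ℝ≥0∞) * s ≤ ∑ i ∈ Finset.range (m + 1), a i x := by
    rw [he] at hx
    exact (tsub_pos_iff_lt.1 hx).le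
  -- The sum may be empty, when `m = 0`; the maximal excess then bounds it trivially, being
  -- nonnegative by truncated subtraction.
  have hm' : ∀ y, ∑ i ∈ Finset.range m, a i y ≤ maxExcess a s N y + m * s := by
    intro y
    rcases Nat.eq_zero_or_pos m with rfl | hm0
    · simp
    · obtain ⟨k, rfl⟩ := Nat.exists_eq_succ_of_ne_zero hm0.ne'
      rw [← tsub_le_iff_right]
      exact Finset.le_sup (f := fun k => ∑ i ∈ Finset.range (k + 1), a i y -
        ((k + 1 : ℕ) : ℝ≥0∞) * s) (Finset.mem_range.2
          ((Nat.lt_succ_self k).trans (Finset.mem_range.1 hm)))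
  have hfin : (m : ℝ≥0∞) * s ≠ ∞ := ENNReal.mul_ne_top (by simp) (by simp)
  rw [← ENNReal.add_le_add_iff_right hfin]
  calc maxExcess a s N x + s + m * s = ∑ i ∈ Finset.range (m + 1), a i x := by
        rw [he, add_assoc]
        have : (s : ℝ≥0∞) + m * s = ((m + 1 : ℕ) : ℝ≥0∞) * s := by push_cast; ring
        rw [this, tsub_add_cancel_of_le hle]
    _ ≤ a 0 x + ∫⁻ y, κ x y * ∑ i ∈ Finset.range m, a i y ∂μ := sum_range_succ_le hκ ha h m x
    _ ≤ a 0 x + ∫⁻ y, (κ x y * maxExcess a s N y + κ x y * (m * s)) ∂μ := by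
        gcongr with y
        rw [← mul_add]
        gcongr
        exact hm' y
    _ = a 0 x + (∫⁻ y, κ x y * maxExcess a s N y ∂μ + (∫⁻ y, κ x y ∂μ) * (m * s)) := by
        rw [lintegral_add_left (f := fun y => κ x y * maxExcess a s N y)
          (hκx.mul (measurable_maxExcess ha s N)), lintegral_mul_const _ hκx]
    _ ≤ a 0 x + (∫⁻ y, κ x y * maxExcess a s N y ∂μ + 1 * (m * s)) := by
        gcongr
        exact hκ1 x
    _ = _ := by rw [one_mul, add_assoc]

/-- Makes the maximal excess integrable even though the `a_k` are only square integrable. -/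
lemma tsub_le_sq_div (b : ℝ≥0∞) {s : ℝ≥0} (hs : s ≠ 0) : b - s ≤ b ^ 2 / s := by
  rcases le_total b s with h | h
  · rw [tsub_eq_zero_of_le h]; exact bot_le
  · refine tsub_le_self.trans ?_
    rw [ENNReal.le_div_iff_mul_le (Or.inl (by simpa using hs)) (Or.inl (by simp)), sq]
    gcongr

lemma lintegral_maxExcess_ne_top (ha : ∀ k, Measurable (a k))
    (hfin : ∀ k, ∫⁻ x, a k x ^ 2 ∂μ ≠ ∞) {s : ℝ≥0} (hs : s ≠ 0) (N : ℕ) :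
    ∫⁻ x, maxExcess a s N x ∂μ ≠ ∞ := by
  refine ne_top_of_le_ne_top ?_ (lintegral_mono fun x => maxExcess_le_sum s N x)
  rw [lintegral_finsetSum _ fun i _ => (ha i).sub_const _]
  refine ENNReal.sum_ne_top.2 fun i _ => ?_
  refine ne_top_of_le_ne_top ?_ (lintegral_mono fun x => tsub_le_sq_div (a i x) hs)
  simp_rw [div_eq_mul_inv]
  rw [lintegral_mul_const _ ((ha i).pow_const 2)]
  exact ENNReal.mul_ne_top (hfin i) (by simpa using hs)

/-- The Hopf maximal ergodic inequality. -/
theorem mul_measure_maxAverage_le [SFinite μ] (hκ : Measurable (Function.uncurry κ))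
    (ha : ∀ k, Measurable (a k)) (hκ1 : ∀ x, ∫⁻ y, κ x y ∂μ ≤ 1)
    (hκ2 : ∀ y, ∫⁻ x, κ x y ∂μ ≤ 1) (h : ∀ k x, a (k + 1) x ≤ ∫⁻ y, κ x y * a k y ∂μ)
    (hfin : ∀ k, ∫⁻ x, a k x ^ 2 ∂μ ≠ ∞) {s : ℝ≥0} (hs : s ≠ 0) (N : ℕ) :
    s * μ {x | s < maxAverage a N x} ≤ ∫⁻ x in {x | s < maxAverage a N x}, a 0 x ∂μ := by
  have hM := measurable_maxExcess ha s N
  have hE : {x | (s : ℝ≥0∞) < maxAverage a N x} = {x | 0 < maxExcess a s N x} := by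
    ext x; exact (maxExcess_pos_iff s N x).symm
  have hEm : MeasurableSet {x | 0 < maxExcess a s N x} := measurableSet_lt measurable_const hM
  have hprod : Measurable fun q : X × X => κ q.1 q.2 * maxExcess a s N q.2 :=
    hκ.mul (hM.comp measurable_snd)
  rw [hE]
  set E := {x | 0 < maxExcess a s N x} with hEdef
  have hfinM := lintegral_maxExcess_ne_top ha hfin hs N
  -- The finite integral of the maximal excess is added to both sides; it will reappear on the right
  -- because `κ` does not increase integrals.
  rw [← ENNReal.add_le_add_iff_left hfinM]
  calc ∫⁻ x, maxExcess a s N x ∂μ + s * μ E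
      = ∫⁻ x in E, (maxExcess a s N x + s) ∂μ := by
        rw [lintegral_add_left hM, setLIntegral_const, setLIntegral_eq_of_support_subset]
        intro x hx
        exact pos_iff_ne_zero.2 hx
    _ ≤ ∫⁻ x in E, (a 0 x + ∫⁻ y, κ x y * maxExcess a s N y ∂μ) ∂μ :=
        setLIntegral_mono' hEm fun x hx => maxExcess_add_le hκ ha hκ1 h hx
    _ = ∫⁻ x in E, a 0 x ∂μ + ∫⁻ x in E, ∫⁻ y, κ x y * maxExcess a s N y ∂μ ∂μ :=
        lintegral_add_left (ha 0) _
    _ ≤ ∫⁻ x in E, a 0 x ∂μ + ∫⁻ x, ∫⁻ y, κ x y * maxExcess a s N y ∂μ ∂μ :=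
        add_le_add le_rfl (setLIntegral_le_lintegral _ _)
    _ = ∫⁻ x in E, a 0 x ∂μ + ∫⁻ y, (∫⁻ x, κ x y ∂μ) * maxExcess a s N y ∂μ := by
        rw [lintegral_lintegral_swap hprod.aemeasurable]
        congr 1
        refine lintegral_congr fun y => ?_
        rw [lintegral_mul_const (f := fun x => κ x y) _ (hκ.comp measurable_prodMk_right)]
    _ ≤ ∫⁻ x in E, a 0 x ∂μ + ∫⁻ y, 1 * maxExcess a s N y ∂μ := by
        gcongr with y
        exact hκ2 y
    _ = _ := by simp_rw [one_mul]; rw [add_comm]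

theorem lintegral_maxAverage_sq_le [SFinite μ] (hκ : Measurable (Function.uncurry κ))
    (ha : ∀ k, Measurable (a k)) (hκ1 : ∀ x, ∫⁻ y, κ x y ∂μ ≤ 1)
    (hκ2 : ∀ y, ∫⁻ x, κ x y ∂μ ≤ 1) (h : ∀ k x, a (k + 1) x ≤ ∫⁻ y, κ x y * a k y ∂μ)
    (hfin : ∀ k, ∫⁻ x, a k x ^ 2 ∂μ ≠ ∞) (N : ℕ) :
    ∫⁻ x, maxAverage a N x ^ 2 ∂μ ≤ 4 * ∫⁻ x, a 0 x ^ 2 ∂μ := by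
  refine lintegral_sq_le_of_weak (measurable_maxAverage ha N) (ha 0) ?_
    fun s hs => mul_measure_maxAverage_le hκ ha hκ1 hκ2 h hfin hs N
  -- Cauchy–Schwarz over the finitely many averages, only to supply the a priori finiteness; the
  -- dependence on `N` does not reach the conclusion.
  have hle : ∀ x, maxAverage a N x ^ 2 ≤ N * ∑ i ∈ Finset.range N, a i x ^ 2 := fun x => by
    have h1 : maxAverage a N x ≤ ∑ i ∈ Finset.range N, a i x := by
      refine Finset.sup_le fun k hk => ?_
      refine (ENNReal.div_le_of_le_mul ?_)
      calc ∑ i ∈ Finset.range (k + 1), a i x ≤ ∑ i ∈ Finset.range N, a i x := by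
            gcongr
            exact Finset.mem_range.1 hk
        _ ≤ _ := le_mul_of_one_le_right bot_le (by exact_mod_cast Nat.succ_le_succ (Nat.zero_le k))
    calc maxAverage a N x ^ 2 ≤ (∑ i ∈ Finset.range N, a i x) ^ 2 := by gcongr
      _ ≤ _ := by
        have h2 := ENNReal.inner_le_Lp_mul_Lq (Finset.range N) (fun i => a i x) (fun _ => 1)
          (p := 2) (q := 2) (by constructor <;> norm_num)
        simp only [mul_one, one_pow, Finset.sum_const, Finset.card_range, nsmul_eq_mul,
          ENNReal.rpow_ofNat] at h2
        calc _ ≤ ((∑ i ∈ Finset.range N, a i x ^ 2) ^ (1 / 2 : ℝ) * (N : ℝ≥0∞) ^ (1 / 2 : ℝ)) ^ 2 := by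
              gcongr
          _ = _ := by
              rw [mul_pow, ← ENNReal.rpow_natCast, ← ENNReal.rpow_natCast, ← ENNReal.rpow_mul,
                ← ENNReal.rpow_mul]
              norm_num
              rw [mul_comm]
  refine ne_top_of_le_ne_top ?_ (lintegral_mono hle)
  rw [lintegral_const_mul _ (Finset.measurable_sum _ fun i _ => (ha i).pow_const 2),
    lintegral_finsetSum _ fun i _ => (ha i).pow_const 2]
  exact ENNReal.mul_ne_top (by simp) (ENNReal.sum_ne_top.2 fun i _ => hfin i)

end Hopf

end DunklBessel
end

noncomputable section

namespace DunklBessel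

/-! ### The maximal operator -/

/-- The heat semigroup of type `η = 0` applied to `|f|`, as an integral with values in `[0,∞]`. -/
def heatMajorant {n : ℕ} (lam : Fin n → ℝ) (f : (Fin n → ℝ) → ℂ) (t : ℝ) (x : Fin n → ℝ) : ℝ≥0∞ :=
  ∫⁻ y, ENNReal.ofReal (heatKernel lam 0 t x y) * ‖f y‖ₑ ∂wPlus lam

section
variable {n : ℕ} {lam : Fin n → ℝ} {f : (Fin n → ℝ) → ℂ}

lemma heatMajorant_congr_ae {f' : (Fin n → ℝ) → ℂ} (h : f =ᵐ[wPlus lam] f') :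
    heatMajorant lam f = heatMajorant lam f' := by
  funext t x
  refine lintegral_congr_ae ?_
  filter_upwards [h] with y hy
  rw [hy]

lemma memLp_norm_ofReal (hf : MemLp f 2 (wPlus lam)) :
    MemLp (fun y => ((‖f y‖ : ℝ) : ℂ)) 2 (wPlus lam) := hf.norm.ofReal

lemma measurable_heatMajorant (hlam : ∀ j, -1 / 2 < lam j) (hf : Measurable f) (t : ℝ) :
    Measurable (heatMajorant lam f t) := by
  have h1 : Measurable fun q : (Fin n → ℝ) × (Fin n → ℝ) =>
      ENNReal.ofReal (heatKernel lam 0 t q.1 q.2) * ‖f q.2‖ₑ :=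
    (continuous_heatKernel 0 hlam t).measurable.ennreal_ofReal.mul (hf.comp measurable_snd).enorm
  exact h1.lintegral_prod_right'

lemma enorm_heat_norm (hlam : ∀ j, -1 / 2 < lam j) (hf : MemLp f 2 (wPlus lam)) {t : ℝ}
    (ht : 0 < t) (x : Fin n → ℝ) :
    ‖heat lam 0 t (fun y => ((‖f y‖ : ℝ) : ℂ)) x‖ₑ = heatMajorant lam f t x := by
  have hf0 := memLp_norm_ofReal hf
  have hint : Integrable (fun y => heatKernel lam 0 t x y * ‖f y‖) (wPlus lam) := by
    have h := ((memLp_heatKernel 0 hlam ht x).integrable_mul hf0).re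
    refine h.congr (ae_of_all _ fun y => ?_)
    simp [← Complex.ofReal_mul]
  rw [heat_eq hlam hf0 ht, hankel_exp_eq_integral 0 hlam ht]
  have h1 : ∫ y, (heatKernel lam 0 t x y : ℂ) * hf0.toLp _ y ∂wPlus lam =
      ((∫ y, heatKernel lam 0 t x y * ‖f y‖ ∂wPlus lam : ℝ) : ℂ) := by
    rw [← integral_complex_ofReal]
    refine integral_congr_ae ?_
    filter_upwards [hf0.coeFn_toLp] with y hy
    rw [hy]
    push_cast; rfl
  have hnn : ∀ y, 0 ≤ heatKernel lam 0 t x y * ‖f y‖ := fun y =>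
    mul_nonneg (heatKernel_zero_nonneg hlam ht x y) (norm_nonneg _)
  rw [h1, ← ofReal_norm, Complex.norm_real, Real.norm_of_nonneg (integral_nonneg hnn),
    ofReal_integral_eq_lintegral_ofReal hint (ae_of_all _ hnn), heatMajorant]
  refine lintegral_congr fun y => ?_
  rw [ENNReal.ofReal_mul (heatKernel_zero_nonneg hlam ht x y), ofReal_norm]

lemma lintegral_heatMajorant_sq_ne_top (hlam : ∀ j, -1 / 2 < lam j) (hf : MemLp f 2 (wPlus lam))
    {t : ℝ} (ht : 0 < t) : ∫⁻ x, heatMajorant lam f t x ^ 2 ∂wPlus lam ≠ ∞ := by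
  have hf0 := memLp_norm_ofReal hf
  have hd := gaussDecay_exp_mul ht (Lp.memLp (hankelL2 hlam 0 (hf0.toLp _)))
  have h := eLpNorm_hankel 0 hlam hd
  have h2 : ∫⁻ x, heatMajorant lam f t x ^ 2 ∂wPlus lam =
      eLpNorm (hankel lam 0 fun z => (Real.exp (-t * normSq z) : ℂ) *
        hankelL2 hlam 0 (hf0.toLp _) z) 2 (wPlus lam) ^ 2 := by
    rw [eLpNorm_two_sq]
    refine lintegral_congr fun x => ?_
    rw [← heat_eq hlam hf0 ht, enorm_heat_norm hlam hf ht]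
  rw [h2, h]
  exact ENNReal.pow_ne_top hd.memLp.eLpNorm_ne_top

/-- The semigroup law, read off from `e^{-s|z|²} e^{-t|z|²}` between two Hankel transforms. An
inequality is all that Hopf's argument uses. -/
lemma heatMajorant_add_le (hlam : ∀ j, -1 / 2 < lam j) (hf : MemLp f 2 (wPlus lam)) {s t : ℝ}
    (hs : 0 < s) (ht : 0 < t) (x : Fin n → ℝ) :
    heatMajorant lam f (s + t) x ≤
      ∫⁻ y, ENNReal.ofReal (heatKernel lam 0 t x y) * heatMajorant lam f s y ∂wPlus lam := by
  have hf0 := memLp_norm_ofReal hf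
  set F := hankelL2 hlam 0 (hf0.toLp _) with hF
  have hd := gaussDecay_exp_mul hs (Lp.memLp F)
  have h1 : heat lam 0 (s + t) (fun y => ((‖f y‖ : ℝ) : ℂ)) x =
      ∫ y, (heatKernel lam 0 t x y : ℂ) * heat lam 0 s (fun y => ((‖f y‖ : ℝ) : ℂ)) y
        ∂wPlus lam := by
    have h2 : ∀ᵐ y ∂wPlus lam, heat lam 0 s (fun y => ((‖f y‖ : ℝ) : ℂ)) y =
        hankelL2 hlam 0 (hd.memLp.toLp _) y := by
      filter_upwards [hankel_ae_eq hlam 0 hd hd.memLp] with y hy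
      rw [heat_eq hlam hf0 hs, hy]
    rw [integral_congr_ae (g := fun y => (heatKernel lam 0 t x y : ℂ) *
      hankelL2 hlam 0 (hd.memLp.toLp _) y) (by filter_upwards [h2] with y hy; rw [hy]),
      ← hankel_exp_eq_integral 0 hlam ht, hankelL2_hankelL2, heat_eq hlam hf0 (add_pos hs ht)]
    refine congrFun (hankel_congr_ae 0 ?_) x
    filter_upwards [hd.memLp.coeFn_toLp] with z hz
    rw [hz, ← mul_assoc, ← Complex.ofReal_mul, ← Real.exp_add]
    congr 3
    ring
  rw [← enorm_heat_norm hlam hf (add_pos hs ht), h1]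
  refine (enorm_integral_le_lintegral_enorm _).trans (le_of_eq (lintegral_congr fun y => ?_))
  rw [enorm_mul, enorm_heat_norm hlam hf hs, ← ofReal_norm, Complex.norm_real,
    Real.norm_of_nonneg (heatKernel_zero_nonneg hlam ht x y)]

lemma delta_zero (lam : Fin n → ℝ) (η : Fin n → Fin 2) (F : (Fin n → ℝ) → ℂ) :
    delta lam η 0 F = F := by
  unfold delta
  induction List.finRange n with
  | nil => rfl
  | cons j l ih =>
    rw [List.foldr_cons, ih]
    simp [delOne]

lemma gaussDecay_exp_mul_normSq {g : (Fin n → ℝ) → ℂ} (hg : MemLp g 2 (wPlus lam)) {t : ℝ}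
    (ht : 0 < t) :
    GaussDecay lam fun z => (Real.exp (-t * normSq z) : ℂ) * (-(normSq z : ℂ) * g z) :=
  ((gaussDecay_exp_mul ht hg).normSq_mul.const_mul (-1)).congr
    (ae_of_all _ fun z => by simp only; ring)

lemma hasDerivAt_heat (hlam : ∀ j, -1 / 2 < lam j) (η : Fin n → Fin 2)
    (hf : MemLp f 2 (wPlus lam)) (x : Fin n → ℝ) {t : ℝ} (ht : 0 < t) :
    HasDerivAt (fun s => heat lam η s f x) (hankel lam η (fun z => (Real.exp (-t * normSq z) : ℂ) *
      (-(normSq z : ℂ) * hankelL2 hlam η (hf.toLp f) z)) x) t := by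
  refine (hasDerivAt_hankel_exp hlam η (fun s hs => gaussDecay_exp_mul hs (Lp.memLp _))
    x ht).congr_of_eventuallyEq ?_
  filter_upwards [Ioi_mem_nhds ht] with s hs
  exact heat_eq hlam hf hs x

lemma sq_lintegral_le {α : Type*} [MeasurableSpace α] {μ : Measure α} {h : α → ℝ≥0∞}
    (hh : AEMeasurable h μ) : (∫⁻ x, h x ∂μ) ^ 2 ≤ μ Set.univ * ∫⁻ x, h x ^ 2 ∂μ := by
  have h1 := ENNReal.lintegral_mul_le_Lp_mul_Lq μ (p := 2) (q := 2)
    (by constructor <;> norm_num) hh (aemeasurable_const (b := (1 : ℝ≥0∞)))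
  simp only [Pi.mul_apply, mul_one, ENNReal.rpow_ofNat, one_pow, lintegral_one] at h1
  calc _ ≤ ((∫⁻ x, h x ^ 2 ∂μ) ^ (1 / 2 : ℝ) * μ Set.univ ^ (1 / 2 : ℝ)) ^ 2 := by gcongr
    _ = _ := by
      rw [mul_pow, ← ENNReal.rpow_natCast, ← ENNReal.rpow_natCast, ← ENNReal.rpow_mul,
        ← ENNReal.rpow_mul]
      norm_num
      rw [mul_comm]

/-- Integrate the time derivative over `(s,t]` and apply Cauchy–Schwarz. The length is at most `s`,
hence at most the integration variable `r`, and `r dr` is exactly the measure in the `g`-function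
with `K = 1`, `M = 0`. -/
lemma enorm_heat_sub_le (hlam : ∀ j, -1 / 2 < lam j) (η : Fin n → Fin 2)
    (hf : MemLp f 2 (wPlus lam)) (x : Fin n → ℝ) {s t : ℝ} (hs : 0 < s) (hst : s ≤ t)
    (hts : t ≤ 2 * s) : ‖heat lam η t f x - heat lam η s f x‖ₑ ≤ gFun lam η 1 0 f x := by
  set v : ℝ → ℂ := fun t => hankel lam η (fun z => (Real.exp (-t * normSq z) : ℂ) *
      (-(normSq z : ℂ) * hankelL2 hlam η (hf.toLp f) z)) x with hv
  have hcont : ContinuousOn v (Set.Icc s t) := fun r hr =>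
    (hasDerivAt_hankel_exp hlam η (fun s hs => gaussDecay_exp_mul_normSq (Lp.memLp _) hs) x
      (hs.trans_le hr.1)).continuousAt.continuousWithinAt
  have hint : IntervalIntegrable v volume s t :=
    (hcont.mono (by rw [Set.uIcc_of_le hst])).intervalIntegrable
  have h1 := intervalIntegral.integral_eq_sub_of_hasDerivAt (f := fun s => heat lam η s f x)
    (f' := v) (fun r hr => by
      rw [Set.uIcc_of_le hst] at hr
      exact hasDerivAt_heat hlam η hf x (hs.trans_le hr.1)) hint
  have hg : ∀ r > 0, heatDeriv lam η 1 0 f x r = v r := fun r hr => by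
    unfold heatDeriv
    simp_rw [delta_zero]
    rw [iteratedDeriv_one]
    exact (hasDerivAt_heat hlam η hf x hr).deriv
  have hm : AEMeasurable (fun r => ‖v r‖ₑ) (volume.restrict (Set.Ioc s t)) :=
    hint.1.aestronglyMeasurable.enorm
  have hsq : ‖heat lam η t f x - heat lam η s f x‖ₑ ^ 2 ≤ ∫⁻ r in Set.Ioi (0 : ℝ),
      ENNReal.ofReal (r ^ (2 * ((1 : ℕ) : ℝ) + ((∑ j, (0 : Fin n → ℕ) j : ℕ) : ℝ) - 1)) *
        ‖heatDeriv lam η 1 0 f x r‖ₑ ^ 2 := by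
    calc _ ≤ (∫⁻ r in Set.Ioc s t, ‖v r‖ₑ) ^ 2 := by
          rw [← h1, intervalIntegral.integral_of_le hst]
          gcongr
          exact enorm_integral_le_lintegral_enorm _
      _ ≤ ENNReal.ofReal s * ∫⁻ r in Set.Ioc s t, ‖v r‖ₑ ^ 2 := by
          refine (sq_lintegral_le hm).trans ?_
          gcongr
          rw [Measure.restrict_apply_univ, Real.volume_Ioc]
          exact ENNReal.ofReal_le_ofReal (by linarith)
      _ = ∫⁻ r in Set.Ioc s t, ENNReal.ofReal s * ‖v r‖ₑ ^ 2 :=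
          (lintegral_const_mul' _ _ ENNReal.ofReal_ne_top).symm
      _ ≤ ∫⁻ r in Set.Ioc s t, ENNReal.ofReal
          (r ^ (2 * ((1 : ℕ) : ℝ) + ((∑ j, (0 : Fin n → ℕ) j : ℕ) : ℝ) - 1)) *
            ‖heatDeriv lam η 1 0 f x r‖ₑ ^ 2 := by
          refine setLIntegral_mono' measurableSet_Ioc fun r hr => ?_
          have e1 : 2 * ((1 : ℕ) : ℝ) + ((∑ j, (0 : Fin n → ℕ) j : ℕ) : ℝ) - 1 = 1 := by
            simp; norm_num
          rw [hg r (hs.trans hr.1), e1, Real.rpow_one]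
          gcongr
          exact hr.1.le
      _ ≤ _ := lintegral_mono_set fun r hr => hs.trans hr.1
  have h3 := ENNReal.rpow_le_rpow hsq (show (0 : ℝ) ≤ 1 / 2 by norm_num)
  rw [← ENNReal.rpow_natCast, ← ENNReal.rpow_mul] at h3
  norm_num at h3
  unfold gFun
  norm_num
  exact h3

lemma heatMajorant_le_add (hlam : ∀ j, -1 / 2 < lam j) (hf : MemLp f 2 (wPlus lam))
    (x : Fin n → ℝ) {s t : ℝ} (hs : 0 < s) (hst : s ≤ t) (hts : t ≤ 2 * s) :
    heatMajorant lam f t x ≤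
      heatMajorant lam f s x + gFun lam 0 1 0 (fun y => ((‖f y‖ : ℝ) : ℂ)) x := by
  have h := enorm_heat_sub_le hlam 0 (memLp_norm_ofReal hf) x hs hst hts
  rw [← enorm_heat_norm hlam hf hs, ← enorm_heat_norm hlam hf (hs.trans_le hst)]
  calc _ = ‖heat lam 0 s (fun y => ((‖f y‖ : ℝ) : ℂ)) x +
        (heat lam 0 t (fun y => ((‖f y‖ : ℝ) : ℂ)) x -
          heat lam 0 s (fun y => ((‖f y‖ : ℝ) : ℂ)) x)‖ₑ := by rw [add_sub_cancel]
    _ ≤ _ := (enorm_add_le _ _).trans (by gcongr)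

/-- The iterates of the heat semigroup at time `ε`, applied to `|f|`. -/
def heatIterates (lam : Fin n → ℝ) (f : (Fin n → ℝ) → ℂ) (ε : ℝ) (k : ℕ) (x : Fin n → ℝ) : ℝ≥0∞ :=
  if k = 0 then ‖f x‖ₑ else heatMajorant lam f (k * ε) x

lemma heatMajorant_le_maxAverage (hlam : ∀ j, -1 / 2 < lam j) (hf : MemLp f 2 (wPlus lam))
    (x : Fin n → ℝ) {ε : ℝ} (hε : 0 < ε) {L N : ℕ} (hL : 0 < L) (hN : 2 * L ≤ N) :
    heatMajorant lam f (2 * L * ε) x ≤ 2 * maxAverage (heatIterates lam f ε) N x +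
      gFun lam 0 1 0 (fun y => ((‖f y‖ : ℝ) : ℂ)) x := by
  set g := gFun lam 0 1 0 (fun y => ((‖f y‖ : ℝ) : ℂ)) x
  set a := heatIterates lam f ε
  have hLL : 2 * L - L = L := by omega
  have hL0 : (L : ℝ≥0∞) ≠ 0 := by simpa using hL.ne'
  -- For these `k` the time `2Lε` lies between `kε` and `2kε`, where the `g`-function controls the
  -- difference.
  have h1 : ∀ k ∈ Finset.Ico L (2 * L), heatMajorant lam f (2 * L * ε) x ≤ a k x + g := by
    intro k hk
    obtain ⟨hk1, hk2⟩ := Finset.mem_Ico.1 hk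
    have hk0 : k ≠ 0 := by omega
    have hk1' : (L : ℝ) ≤ k := by exact_mod_cast hk1
    have hk2' : (k : ℝ) ≤ 2 * L := by exact_mod_cast hk2.le
    have hk3 : (0 : ℝ) < k := by exact_mod_cast Nat.pos_of_ne_zero hk0
    have : a k x = heatMajorant lam f (k * ε) x := if_neg hk0
    rw [this]
    refine heatMajorant_le_add hlam hf x (by positivity) (by gcongr) ?_
    rw [← mul_assoc]
    gcongr
  -- The average of the first `2L` iterates has index `2L - 1` in `maxAverage`. Comparing `2L` terms
  -- with the `L` terms averaged above gives the factor `2`.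
  have h2 : ∑ i ∈ Finset.range (2 * L), a i x ≤ (2 * L : ℕ) * maxAverage a N x := by
    have h3 := Finset.le_sup (f := fun k => (∑ i ∈ Finset.range (k + 1), a i x) /
      ((k + 1 : ℕ) : ℝ≥0∞)) (Finset.mem_range.2 (show 2 * L - 1 < N by omega))
    change _ ≤ maxAverage a N x at h3
    rw [Nat.sub_add_cancel (by omega), ENNReal.div_le_iff_le_mul (Or.inl (by simp; omega))
      (Or.inl (ENNReal.natCast_ne_top _))] at h3
    rwa [mul_comm _ (maxAverage a N x)]
  have h3 : (L : ℝ≥0∞) * heatMajorant lam f (2 * L * ε) x ≤ L * (2 * maxAverage a N x + g) := by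
    calc _ = ∑ _ ∈ Finset.Ico L (2 * L), heatMajorant lam f (2 * L * ε) x := by
          rw [Finset.sum_const, Nat.card_Ico, nsmul_eq_mul, hLL]
      _ ≤ ∑ k ∈ Finset.Ico L (2 * L), (a k x + g) := Finset.sum_le_sum h1
      _ = ∑ k ∈ Finset.Ico L (2 * L), a k x + L * g := by
          rw [Finset.sum_add_distrib, Finset.sum_const, Nat.card_Ico, nsmul_eq_mul, hLL]
      _ ≤ ∑ i ∈ Finset.range (2 * L), a i x + L * g := by
          gcongr
          intro i hi
          exact Finset.mem_range.2 (Finset.mem_Ico.1 hi).2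
      _ ≤ (2 * L : ℕ) * maxAverage a N x + L * g := by gcongr
      _ = _ := by push_cast; ring
  exact (ENNReal.mul_le_mul_iff_right hL0 (ENNReal.natCast_ne_top L)).1 h3

lemma lintegral_maxAverage_heatIterates_le (hlam : ∀ j, -1 / 2 < lam j)
    (hf : MemLp f 2 (wPlus lam)) (hfm : Measurable f) {ε : ℝ} (hε : 0 < ε) (N : ℕ) :
    ∫⁻ x, maxAverage (heatIterates lam f ε) N x ^ 2 ∂wPlus lam ≤
      4 * ∫⁻ x, ‖f x‖ₑ ^ 2 ∂wPlus lam := by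
  have hm : ∀ k, Measurable (heatIterates lam f ε k) := fun k => by
    unfold heatIterates
    split_ifs
    · exact hfm.enorm
    · exact measurable_heatMajorant hlam hfm _
  have h := lintegral_maxAverage_sq_le (μ := wPlus lam)
    (κ := fun x y => ENNReal.ofReal (heatKernel lam 0 ε x y)) (a := heatIterates lam f ε)
    (continuous_heatKernel 0 hlam ε).measurable.ennreal_ofReal hm
    (fun x => (lintegral_heatKernel_zero hlam hε x).le)
    -- Symmetry of the kernel turns the row mass one into column mass one.
    (fun y => by
      simp_rw [heatKernel_comm 0 ε _ y]
      exact (lintegral_heatKernel_zero hlam hε y).le)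
    (fun k x => ?_) (fun k => ?_) N
  · exact h
  · by_cases hk : k = 0
    · subst hk
      simp [heatIterates, heatMajorant]
    · have hk' : (0 : ℝ) < k := by exact_mod_cast Nat.pos_of_ne_zero hk
      simp only [heatIterates, if_neg hk, if_neg (Nat.succ_ne_zero k)]
      have := heatMajorant_add_le hlam hf (mul_pos hk' hε) hε x
      convert! this using 2
      push_cast; ring
  · by_cases hk : k = 0
    · subst hk
      simp only [heatIterates, if_pos]
      rw [← eLpNorm_two_sq]
      exact ENNReal.pow_ne_top hf.eLpNorm_ne_top
    · have hk' : (0 : ℝ) < k := by exact_mod_cast Nat.pos_of_ne_zero hk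
      simp only [heatIterates, if_neg hk]
      exact lintegral_heatMajorant_sq_ne_top hlam hf (mul_pos hk' hε)

/-! ### Reduction to dyadic times -/

/-- The times `2(L+1)2^{-m}`. -/
def dyadicTime (m L : ℕ) : ℝ := 2 * (L + 1 : ℕ) * (2 ^ m)⁻¹

lemma dyadicTime_pos (m L : ℕ) : 0 < dyadicTime m L := by
  unfold dyadicTime; positivity

lemma dyadicTime_succ (m L : ℕ) : dyadicTime (m + 1) (2 * L + 1) = dyadicTime m L := by
  unfold dyadicTime
  rw [pow_succ]
  push_cast
  field_simp
  ring

/-- The supremum over the times `2(L+1)2^{-m}` with `L < 4^m`. -/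
def dyadicSup (h : ℝ → ℝ≥0∞) (m : ℕ) : ℝ≥0∞ :=
  (Finset.range (4 ^ m)).sup fun L => h (dyadicTime m L)

lemma monotone_dyadicSup (h : ℝ → ℝ≥0∞) : Monotone (dyadicSup h) := by
  refine monotone_nat_of_le_succ fun m => Finset.sup_le fun L hL => ?_
  rw [← dyadicTime_succ]
  refine Finset.le_sup (f := fun L => h (dyadicTime (m + 1) L)) (Finset.mem_range.2 ?_)
  have := Finset.mem_range.1 hL
  rw [pow_succ]
  omega

lemma exists_dyadicTime_mem {t δ : ℝ} (ht : 0 < t) (hδ : 0 < δ) :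
    ∃ m, ∃ L < 4 ^ m, |dyadicTime m L - t| < δ := by
  -- The bound `2/δ` makes the spacing `2·2^{-m}` smaller than `δ`, and `t + 1` keeps the index `L`
  -- below `4^m`.
  obtain ⟨m, hm⟩ := pow_unbounded_of_one_lt (max (t + 1) (2 / δ)) (one_lt_two (α := ℝ))
  have hm1 : t + 1 < 2 ^ m := (le_max_left _ _).trans_lt hm
  have hm2 : 2 / δ < 2 ^ m := (le_max_right _ _).trans_lt hm
  have hp : (0 : ℝ) < 2 ^ m := by positivity
  have h0 : 0 ≤ t * 2 ^ m / 2 := by positivity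
  set L := ⌊t * 2 ^ m / 2⌋₊ with hL
  have h1 := Nat.floor_le h0
  have h2 := Nat.lt_floor_add_one (t * 2 ^ m / 2)
  rw [← hL] at h1 h2
  refine ⟨m, L, ?_, ?_⟩
  · have h4 : ((4 ^ m : ℕ) : ℝ) = 2 ^ m * 2 ^ m := by
      push_cast; rw [← mul_pow]; norm_num
    rw [← Nat.cast_lt (α := ℝ), h4]
    nlinarith
  · have e : dyadicTime m L - t = 2 * (L + 1 - t * 2 ^ m / 2) * (2 ^ m)⁻¹ := by
      unfold dyadicTime
      push_cast
      field_simp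
    rw [e, abs_of_nonneg (by
      have : 0 ≤ (L : ℝ) + 1 - t * 2 ^ m / 2 := by linarith
      positivity)]
    have h3 : 2 < 2 ^ m * δ := by rwa [div_lt_iff₀ hδ] at hm2
    rw [mul_inv_lt_iff₀ hp]
    linarith

/-- For continuous functions, the `L^∞` norm on the half-line is a supremum over dyadic times. -/
lemma eLpNorm_top_eq_iSup_dyadicSup {h : ℝ → ℂ} (hc : ContinuousOn h (Set.Ioi 0)) :
    eLpNorm h ∞ (volume.restrict (Set.Ioi 0)) = ⨆ m, dyadicSup (fun t => ‖h t‖ₑ) m := by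
  have hopen : ∀ t > 0, ∀ c < ‖h t‖ₑ, {s | c < ‖h s‖ₑ} ∈ 𝓝 t := fun t ht c hct =>
    (hc.continuousAt (Ioi_mem_nhds ht)).enorm.eventually (lt_mem_nhds hct)
  rw [eLpNorm_exponent_top]
  refine le_antisymm (eLpNormEssSup_le_of_ae_enorm_bound ?_)
    (iSup_le fun m => Finset.sup_le fun L _ => ?_)
  · filter_upwards [self_mem_ae_restrict measurableSet_Ioi] with t ht
    by_contra! hlt
    obtain ⟨δ, hδ, hball⟩ := Metric.mem_nhds_iff.1 (hopen t ht _ hlt)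
    obtain ⟨m, L, hL, hd⟩ := exists_dyadicTime_mem ht hδ
    have hmem : ⨆ m, dyadicSup (fun t => ‖h t‖ₑ) m < ‖h (dyadicTime m L)‖ₑ :=
      hball (by simpa [Real.dist_eq] using hd)
    refine lt_irrefl _ (hmem.trans_le ?_)
    exact (Finset.le_sup (f := fun L => ‖h (dyadicTime m L)‖ₑ) (Finset.mem_range.2 hL)).trans
      (le_iSup (dyadicSup fun t => ‖h t‖ₑ) m)
  · by_contra! hlt
    have hpos := dyadicTime_pos m L
    have h1 := inter_mem (hopen _ hpos _ hlt) (Ioi_mem_nhds hpos)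
    have h2 := enorm_ae_le_eLpNormEssSup h (volume.restrict (Set.Ioi 0))
    rw [ae_restrict_iff' measurableSet_Ioi] at h2
    -- By continuity, exceeding the bound at one time means exceeding it on a neighbourhood, which
    -- has positive measure.
    have h3 := Measure.measure_pos_of_mem_nhds volume h1
    refine h3.ne' (measure_mono_null ?_ h2)
    intro s hs hs'
    exact absurd (hs' hs.2) (not_le.2 hs.1)

lemma iSup_sq {u : ℕ → ℝ≥0∞} : (⨆ m, u m) ^ 2 = ⨆ m, u m ^ 2 :=
  ENNReal.iSup_pow_of_ne_zero two_ne_zero u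

lemma measurable_dyadicSup_heatMajorant (hlam : ∀ j, -1 / 2 < lam j) (hf : Measurable f) (m : ℕ) :
    Measurable fun x => dyadicSup (fun t => heatMajorant lam f t x) m := by
  unfold dyadicSup
  simp_rw [Finset.sup_eq_iSup]
  exact Measurable.iSup fun L => Measurable.iSup fun _ => measurable_heatMajorant hlam hf _

lemma dyadicSup_heatMajorant_le (hlam : ∀ j, -1 / 2 < lam j) (hf : MemLp f 2 (wPlus lam))
    (x : Fin n → ℝ) (m : ℕ) :
    dyadicSup (fun t => heatMajorant lam f t x) m ≤
      2 * maxAverage (heatIterates lam f (2 ^ m)⁻¹) (2 * 4 ^ m) x +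
        gFun lam 0 1 0 (fun y => ((‖f y‖ : ℝ) : ℂ)) x := by
  refine Finset.sup_le fun L hL => ?_
  refine heatMajorant_le_maxAverage hlam hf x (by positivity) (Nat.succ_pos L) ?_
  have := Finset.mem_range.1 hL
  omega

lemma exists_lintegral_iSup_dyadicSup_le (hlam : ∀ j, -1 / 2 < lam j) :
    ∃ C : ℝ≥0, ∀ f : (Fin n → ℝ) → ℂ, MemLp f 2 (wPlus lam) →
      ∫⁻ x, (⨆ m, dyadicSup (fun t => heatMajorant lam f t x) m) ^ 2 ∂wPlus lam ≤
        C * ∫⁻ x, ‖f x‖ₑ ^ 2 ∂wPlus lam := by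
  obtain ⟨C, hC⟩ := sublinearBoundedL2_gFun hlam 0 1 0 (n := n) (by simp)
  -- From `(2A + g)² ≤ 8A² + 2g²`: Hopf's constant `4` gives `8·4`, and the `g`-function gives
  -- `2C²`.
  refine ⟨32 + 2 * C ^ 2, fun f₀ hf₀ => ?_⟩
  obtain ⟨f, hfm, hff⟩ : ∃ f : (Fin n → ℝ) → ℂ, Measurable f ∧ f₀ =ᵐ[wPlus lam] f :=
    ⟨hf₀.1.mk f₀, hf₀.1.stronglyMeasurable_mk.measurable, hf₀.1.ae_eq_mk⟩
  have hf : MemLp f 2 (wPlus lam) := (memLp_congr_ae hff).1 hf₀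
  rw [heatMajorant_congr_ae hff, lintegral_congr_ae (g := fun x => ‖f x‖ₑ ^ 2)
    (f := fun x => ‖f₀ x‖ₑ ^ 2) (by filter_upwards [hff] with x hx; rw [hx])]
  simp_rw [iSup_sq]
  -- The dyadic suprema increase with `m`, so monotone convergence reduces matters to a bound
  -- uniform in `m`.
  rw [lintegral_iSup (fun m => (measurable_dyadicSup_heatMajorant hlam hfm m).pow_const 2)
    fun m m' hm x => by
      have := monotone_dyadicSup (fun t => heatMajorant lam f t x) hm
      simp only
      gcongr]
  refine iSup_le fun m => ?_
  obtain ⟨hgm, hg⟩ := hC _ (memLp_norm_ofReal hf)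
  set g := gFun lam 0 1 0 (fun y => ((‖f y‖ : ℝ) : ℂ)) with hgdef
  have hg2 : ∫⁻ x, g x ^ 2 ∂wPlus lam ≤ C ^ 2 * ∫⁻ x, ‖f x‖ₑ ^ 2 ∂wPlus lam := by
    have h1 : eLpNorm (fun y => ((‖f y‖ : ℝ) : ℂ)) 2 (wPlus lam) = eLpNorm f 2 (wPlus lam) :=
      eLpNorm_congr_norm_ae (ae_of_all _ fun y => by simp)
    rw [h1] at hg
    have h2 := pow_le_pow_left₀ bot_le hg 2
    rw [mul_pow, eLpNorm_two_sq, eLpNorm_two_sq] at h2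
    simpa only [enorm_eq_self] using h2
  have hA := lintegral_maxAverage_heatIterates_le hlam hf hfm (ε := (2 ^ m)⁻¹) (by positivity)
    (2 * 4 ^ m)
  calc _ ≤ ∫⁻ x, (8 * maxAverage (heatIterates lam f (2 ^ m)⁻¹) (2 * 4 ^ m) x ^ 2 +
        2 * g x ^ 2) ∂wPlus lam := by
        refine lintegral_mono fun x => ?_
        calc _ ≤ (2 * maxAverage (heatIterates lam f (2 ^ m)⁻¹) (2 * 4 ^ m) x + g x) ^ 2 := by
              have := dyadicSup_heatMajorant_le hlam hf x m
              gcongr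
          _ ≤ 2 * ((2 * maxAverage (heatIterates lam f (2 ^ m)⁻¹) (2 * 4 ^ m) x) ^ 2 +
              g x ^ 2) := by
              have := ENNReal.rpow_add_le_mul_rpow_add_rpow
                (2 * maxAverage (heatIterates lam f (2 ^ m)⁻¹) (2 * 4 ^ m) x) (g x)
                (show (1 : ℝ) ≤ 2 by norm_num)
              norm_num at this
              exact this
          _ = _ := by ring
    _ = 8 * ∫⁻ x, maxAverage (heatIterates lam f (2 ^ m)⁻¹) (2 * 4 ^ m) x ^ 2 ∂wPlus lam +
        2 * ∫⁻ x, g x ^ 2 ∂wPlus lam := by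
        rw [lintegral_add_right' _ ((hgm.pow_const 2).const_mul 2),
          lintegral_const_mul' _ _ (by norm_num), lintegral_const_mul' _ _ (by norm_num)]
    _ ≤ 8 * (4 * ∫⁻ x, ‖f x‖ₑ ^ 2 ∂wPlus lam) + 2 * (C ^ 2 * ∫⁻ x, ‖f x‖ₑ ^ 2 ∂wPlus lam) := by
        gcongr
    _ = _ := by push_cast; ring

/-- Domination of the kernels transfers the maximal estimate from type `0` and `|f|` to every type.
-/
lemma exists_enorm_heat_le (hlam : ∀ j, -1 / 2 < lam j) (η : Fin n → Fin 2) :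
    ∃ C : ℝ≥0, ∀ f : (Fin n → ℝ) → ℂ, MemLp f 2 (wPlus lam) → ∀ t > 0, ∀ x ∈ orthant n,
      ‖heat lam η t f x‖ₑ ≤ C * heatMajorant lam f t x := by
  obtain ⟨C, hC, hle⟩ := exists_heatKernel_le (lam := lam) η hlam
  refine ⟨C.toNNReal, fun f hf t ht x hx => ?_⟩
  rw [heat_eq hlam hf ht, hankel_exp_eq_integral η hlam ht, heatMajorant,
    ← lintegral_const_mul' _ _ ENNReal.coe_ne_top]
  refine (enorm_integral_le_lintegral_enorm _).trans (lintegral_mono_ae ?_)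
  filter_upwards [hf.coeFn_toLp, ae_mem_orthant lam] with y hy hy'
  rw [enorm_mul, hy, ← mul_assoc, ← ofReal_norm, Complex.norm_real,
    Real.norm_of_nonneg (heatKernel_nonneg η hlam ht hx hy')]
  gcongr
  change _ ≤ ENNReal.ofReal C * _
  rw [← ENNReal.ofReal_mul hC]
  exact ENNReal.ofReal_le_ofReal (hle t ht x hx y hy')

theorem sublinearBoundedL2_maximalOp (hlam : ∀ j, -1 / 2 < lam j) (η : Fin n → Fin 2) :
    SublinearBoundedL2 lam (maximalOp lam η) := by
  obtain ⟨C, hC⟩ := exists_lintegral_iSup_dyadicSup_le hlam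
  obtain ⟨C', hC'⟩ := exists_enorm_heat_le hlam η
  refine sublinearBoundedL2_of_sq ⟨C' ^ 2 * C, fun f hf => ?_⟩
  have he : ∀ x, maximalOp lam η f x = ⨆ m, dyadicSup (fun t => ‖heat lam η t f x‖ₑ) m := fun x =>
    eLpNorm_top_eq_iSup_dyadicSup fun t ht =>
      (hasDerivAt_heat hlam η hf x ht).continuousAt.continuousWithinAt
  refine ⟨?_, ?_⟩
  · rw [funext he]
    unfold dyadicSup
    simp_rw [Finset.sup_eq_iSup]
    refine AEMeasurable.iSup fun m => AEMeasurable.iSup fun L => AEMeasurable.iSup fun _ => ?_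
    have := (aestronglyMeasurable_hankel η hlam
      (gaussDecay_exp_mul (dyadicTime_pos m L) (Lp.memLp (hankelL2 hlam η (hf.toLp f))))).enorm
    refine this.congr (ae_of_all _ fun x => ?_)
    simp only
    rw [heat_eq hlam hf (dyadicTime_pos m L)]
  · calc ∫⁻ x, maximalOp lam η f x ^ 2 ∂wPlus lam
        ≤ ∫⁻ x, (C' * ⨆ m, dyadicSup (fun t => heatMajorant lam f t x) m) ^ 2 ∂wPlus lam := by
          refine lintegral_mono_ae ?_
          filter_upwards [ae_mem_orthant lam] with x hx
          rw [he]
          gcongr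
          refine iSup_le fun m => Finset.sup_le fun L hL => ?_
          refine (hC' f hf _ (dyadicTime_pos m L) x hx).trans ?_
          gcongr
          exact (Finset.le_sup (f := fun L => heatMajorant lam f (dyadicTime m L) x) hL).trans
            (le_iSup (dyadicSup fun t => heatMajorant lam f t x) m)
      _ = C' ^ 2 * ∫⁻ x, (⨆ m, dyadicSup (fun t => heatMajorant lam f t x) m) ^ 2 ∂wPlus lam := by
          simp_rw [mul_pow]
          rw [lintegral_const_mul' _ _ (by finiteness)]
      _ ≤ C' ^ 2 * (C * ∫⁻ x, ‖f x‖ₑ ^ 2 ∂wPlus lam) := by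
          gcongr
          exact hC f hf
      _ = _ := by push_cast; ring

end
end DunklBessel
end

theorem proposition2p5 (n : ℕ) (hn : 1 ≤ n) (lam : Fin n → ℝ) (hlam : ∀ j, -1 / 2 < lam j)
    (η : Fin n → Fin 2) :
    DunklBessel.SublinearBoundedL2 lam (DunklBessel.maximalOp lam η) ∧
    (∀ (K : ℕ) (M : Fin n → ℕ), 0 < ∑ j, M j + K →
      DunklBessel.SublinearBoundedL2 lam (DunklBessel.gFun lam η K M)) ∧
    (∀ Φ : ℝ → ℂ, MemLp Φ ∞ (volume.restrict (Set.Ioi 0)) →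
      DunklBessel.LinearBoundedL2 lam
        (DunklBessel.multiplierOp lam η (DunklBessel.laplaceSymbol Φ))) ∧
    (∀ ν : ComplexMeasure (Set.Ioi (0 : ℝ)),
      DunklBessel.LinearBoundedL2 lam
        (DunklBessel.multiplierOp lam η (DunklBessel.laplaceStieltjesSymbol ν))) ∧
    (∀ M : Fin n → ℕ, 0 < ∑ j, M j →
      DunklBessel.ExtendsBoundedL2 lam (DunklBessel.rieszDomain lam η)
        (DunklBessel.rieszOp lam η M)) ∧
    (∀ (K : ℕ) (M : Fin n → ℕ), 0 < ∑ j, M j + K →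
      DunklBessel.SublinearBoundedL2 lam (DunklBessel.lusinOp lam η K M)) := by
  refine ⟨DunklBessel.sublinearBoundedL2_maximalOp hlam η,
    DunklBessel.sublinearBoundedL2_gFun hlam η,
    fun Φ hΦ => DunklBessel.linearBoundedL2_laplace hlam η hΦ,
    DunklBessel.linearBoundedL2_laplaceStieltjes hlam η,
    fun M hM => DunklBessel.extendsBoundedL2_rieszOp hlam η M hM,
    DunklBessel.sublinearBoundedL2_lusinOp hlam η⟩
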